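/- **Setting.** Let $\mathbb F$ be a field of characteristic not $2$ and $C\subseteq\mathbb F_2^n$ a projective binary linear code (every nonzero word of $C^\perp$ has weight at least $3$). Let $C^*=C\setminus\{\mathbf 0,\mathbf 1\}$ and write $\beta^c=\mathbf 1+\beta$. Fix $\alpha\in C^*$ such that the set $S$ of conjugates of $\alpha$ under $\mathrm{Aut}(C)$ generates $C$ and such that the characteristic of $\mathbb F$ does not divide $|\alpha|$ (the Hamming weight). The code algebra $A_C$ is the commutative algebra with basis $t_1,\dots,t_n$, $e^\beta$ ($\beta\in C^*$) and products $t_it_j=\delta_{ij}t_i$; $t_ie^\beta=a_{i,\beta}e^\beta$ if $\beta_i=1$ and $0$ otherwise; $e^\beta e^\gamma=b_{\beta,\gamma}e^{\beta+\gamma}$ if $\gamma\ne\beta,\beta^c$; $e^\beta e^\beta=\sum_{i\in\mathrm{supp}(\beta)}c_{i,\beta}t_i$; $e^\beta e^{\beta^c}=0$. It is assumed non-degenerate: $\mathrm{supp}(C)=\{1,\dots,n\}$, $C^*\neq\emptyset$ and the structure parameters are nonzero. For $\alpha'\in S$ and $\beta\in C^*\setminus\{\alpha',\alpha'^c\}$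 let $p_{\alpha'}(\beta)$ be the unordered pair $(|\alpha'\cap\beta|,|\alpha'\cap(\alpha'+\beta)|)$. Assume that $a_{i,\beta}=a$ is constant, that $c_{i,\beta}=c_\beta$ depends only on $\beta$, and that for $\alpha',\alpha''\in S$ one has $b_{\alpha',\beta}=b_{\alpha'',\gamma}$ and (if $\mathbf 1\in C$) $b_{\alpha'^c,\beta}=b_{\alpha''^c,\gamma}$ whenever $p_{\alpha'}(\beta)=p_{\alpha''}(\gamma)$. Assume $2a|\alpha|\neq1$ and $3a|\alpha|\ne1$. A small idempotent at $\alpha'\in S$ is $e=\lambda t_{\alpha'}+\mu e^{\alpha'}$, where $t_{\alpha'}=\sum_{i\in\mathrm{supp}(\alpha')}t_i$, $\lambda=\frac1{2a|\alpha'|}$, $\mu^2=\frac{\lambda-\lambda^2}{c_{\alpha'}}$, $\mu\in\mathbb F$ (either square root). Put $\xi_\beta=\frac1{4\mu b_{\alpha',\beta}}\bigl(1-\frac{2|\alpha'\cap\beta|}{|\alpha'|}\bigr)$ and assume that the roots $\theta^\beta_\pm$ of $x^2+2\xi_\beta x-1$ lie in $\mathbb F$ and are distinct; they are labelled so that $\theta^\beta_\pm$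 depends only on $|\alpha'\cap\beta|$ and $\theta^{\alpha'+\beta}_\pm=-\theta^\beta_\mp$. The labels are $1,0,\lambda,\lambda-\frac12$ and $\nu^p_\pm$ for weight partitions $p$, with parts $A_1=\langle e\rangle$; $A_0=\langle t_i\ (i\notin\mathrm{supp}(\alpha')),\ e^{\alpha'^c}\text{ (if it exists)}\rangle$; $A_\lambda=\langle t_j-t_k: j,k\in\mathrm{supp}(\alpha')\rangle$; $A_{\lambda-\frac12}=\langle 2\mu c_{\alpha'}t_{\alpha'}-e^{\alpha'}\rangle$; $A_{\nu^p_\pm}=\langle\theta^\beta_\pm e^\beta+e^{\alpha'+\beta}: p_{\alpha'}(\beta)=p\rangle$. Let $X$ be any nonempty set of small idempotents at words of $S$. The fusion law of $X$ consists of the set $\mathcal F$ of labels whose part is nonzero and of the smallest sets $f\star g$ of labels with $A_fA_g\subseteq\bigoplus_{h\in f\star g}A_h$ for all members of $X$. For a finite abelian group $T$ a $T$-grading is a partition $\mathcal F=\bigsqcup_{t\in T}\mathcal F_t$ (empty parts allowed) with $\mathcal F_s\star\mathcal F_t\subseteq\mathcal F_{st}$, and then $A_t=\bigoplus_{f\in\mathcal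 F_t}A_f$. The law is called $\mathbb Z_2$-graded if it has a $\{+,-\}$-grading with $\mathcal F_-\neq\emptyset$. **Theorem.** For each $e \in X$, $e$ is idempotent and $A_C$ is the direct sum of the parts, which consist of eigenvectors of $\mathrm{ad}_e$ for the eigenvalues $1,0,\lambda,\lambda-\frac12$, $\nu^p_\pm=\frac14+\mu b_{\alpha',\beta}(\theta^\beta_\pm+\xi_\beta)$ ($p_{\alpha'}(\beta)=p$). The fusion law of $X$ is $\mathbb Z_2$-graded if and only if one of the following holds. 1. $|\alpha|=1$, $C=\mathbb F_2^n$, and either (a) $n=2$ and $a=-1$, or (b) $n=3$. 2. $|\alpha|=2$ and, up to the order of the coordinates, $C$ is a direct sum of even weight codes, all of the same length $m\ge3$. 3. $|\alpha|>2$, the code $D=\mathrm{proj}_\alpha(C)$ (the restriction of $C$ to $\mathrm{supp}(\alpha)$) is projective, $\mathbf 1\in D$, and $D$ has a codimension one linear subcode $D_+$ with $\mathbf 1\in D_+$ which is a union of weight sets $\{v\in D:|v|=w\}$ of $D$. If, for some $e\in X$, different labels in $\mathcal F$ have different eigenvalues, the same equivalence holds for the fusion law of $e$ defined on the spectrum of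 $\mathrm{ad}_e$ with the eigenspaces as parts. Moreover, for all members of $X$: * In case 1 the grading is unique: $A_+=A_1\oplus A_0$, $A_-=A_{\lambda-\frac12}$ if $n=2$, and $A_+=A_1\oplus A_0\oplus A_{\lambda-\frac12}$, $A_-=A_{\nu^{(0,1)}_+}\oplus A_{\nu^{(0,1)}_-}$ if $n=3$. * If $|\alpha|=2$, there is a grading with $A_+=A_1\oplus A_0\oplus A_\lambda\oplus A_{\lambda-\frac12}\oplus A_{\nu^{(0,2)}_+}\oplus A_{\nu^{(0,2)}_-}$ and $A_-=A_{\nu^{(1,1)}_+}\oplus A_{\nu^{(1,1)}_-}$. Suppose further that for every word $\alpha'$ of a member of $X$ and every $\beta$ with $p_{\alpha'}(\beta)=(1,1)$ we have $c_\beta=c_{\alpha'+\beta}$; $b_{\beta,\gamma}=b_{\alpha'+\beta,\gamma}$ for all $\gamma\in C^*\setminus\{\alpha',\alpha'^c\}$ different from $\beta,\alpha'+\beta$ and their complements; and, if $\mathbf 1\in C$, $b_{\beta,(\alpha'+\beta)^c}=b_{\beta^c,\alpha'+\beta}$. Then the law is $\mathbb Z_2\times\mathbb Z_2$-graded with all four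 parts nonempty: $A_{(0,0)}=A_1\oplus A_0\oplus A_{\lambda-\frac12}\oplus A_{\nu^{(0,2)}_+}\oplus A_{\nu^{(0,2)}_-}$, $A_{(1,0)}=A_{\nu^{(1,1)}_+}$, $A_{(0,1)}=A_{\nu^{(1,1)}_-}$, $A_{(1,1)}=A_\lambda$. * If $|\alpha|>2$, each $D_+$ as in case 3 gives a $\mathbb Z_2$-grading, and every $\mathbb Z_2$-grading with $\mathcal F_-\ne\emptyset$ arises from such a $D_+$, by $$A_+=A_1\oplus A_0\oplus A_\lambda\oplus A_{\lambda-\frac12}\oplus\bigoplus_{m\in\mathrm{wt}(D_+)}A_{\nu^{(m,|\alpha|-m)}_\pm},\qquad A_-=\bigoplus_{m\in\mathrm{wt}(D)\setminus\mathrm{wt}(D_+)}A_{\nu^{(m,|\alpha|-m)}_\pm},$$ where $\mathrm{wt}$ denotes the set of weights, parts of labels that do not occur are $0$, and each distinct label is taken once. -/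

import Mathlib

noncomputable section

namespace CodeAlg

open scoped Classical

/-! ## Binary linear codes -/

/-- Projective code: every nonzero word of the dual code has weight at least three. -/
def IsProjective {ι : Type*} [Fintype ι] (C : Submodule (ZMod 2) (ι → ZMod 2)) : Prop :=
  ∀ v : ι → ZMod 2, (∀ w ∈ C, v ⬝ᵥ w = 0) → v ≠ 0 → 3 ≤ hammingNorm v

/-- The set of weights of the codewords. -/
def weights {ι : Type*} [Fintype ι] (C : Submodule (ZMod 2) (ι → ZMod 2)) : Set ℕ :=
  {w | ∃ v ∈ C, hammingNorm v = w}

/-- `E` is a union of weight sets of `D`. -/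
def IsUnionOfWeightSets {ι : Type*} [Fintype ι] (D E : Submodule (ZMod 2) (ι → ZMod 2)) : Prop :=
  ∃ W : Set ℕ, ∀ v, v ∈ E ↔ v ∈ D ∧ hammingNorm v ∈ W

/-- `g` permutes the coordinates so that the code is preserved. -/
def IsCodeAut {n : ℕ} (C : Submodule (ZMod 2) (Fin n → ZMod 2)) (g : Equiv.Perm (Fin n)) : Prop :=
  ∀ v : Fin n → ZMod 2, v ∘ g ∈ C ↔ v ∈ C

/-- The conjugates of a word under the automorphism group of the code. -/
def conjugates {n : ℕ} (C : Submodule (ZMod 2) (Fin n → ZMod 2)) (α : Fin n → ZMod 2) :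
    Set (Fin n → ZMod 2) :=
  {v | ∃ g : Equiv.Perm (Fin n), IsCodeAut C g ∧ v = α ∘ g}

/-- The projection of a code to the coordinates in the support of `α`. -/
def proj {n : ℕ} (C : Submodule (ZMod 2) (Fin n → ZMod 2)) (α : Fin n → ZMod 2) :
    Submodule (ZMod 2) ({i : Fin n // α i ≠ 0} → ZMod 2) :=
  C.map (LinearMap.funLeft (ZMod 2) (ZMod 2) (Subtype.val : {i : Fin n // α i ≠ 0} → Fin n))

/-- `C` is, up to the order of the coordinates, a direct sum of even weight codes of length `m`:
the coordinates split into `r` blocks of size `m`, and the codewords are the vectors whose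
restriction to every block has even weight. -/
def IsSumOfEvenWeightCodes {n : ℕ} (C : Submodule (ZMod 2) (Fin n → ZMod 2)) (m : ℕ) : Prop :=
  ∃ (r : ℕ) (block : Fin n → Fin r),
    (∀ j, (Finset.univ.filter fun i => block i = j).card = m) ∧
    ∀ v : Fin n → ZMod 2,
      v ∈ C ↔ ∀ j, Even (Finset.univ.filter fun i => block i = j ∧ v i ≠ 0).card

/-- The nonconstant codewords `C^*`. -/
def Cstar {n : ℕ} (C : Submodule (ZMod 2) (Fin n → ZMod 2)) : Type :=
  {v : Fin n → ZMod 2 // v ∈ C ∧ v ≠ 0 ∧ v ≠ 1}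

/-- The size of the intersection of the supports of two words. -/
def interCard {n : ℕ} (α β : Fin n → ZMod 2) : ℕ :=
  (Finset.univ.filter fun i => α i ≠ 0 ∧ β i ≠ 0).card

/-- The weight partition `p(β)` with respect to `α`, an unordered pair. -/
def weightPartition {n : ℕ} (α β : Fin n → ZMod 2) : Sym2 ℕ :=
  s(interCard α β, interCard α (α + β))

/-- `β ∈ C_α(p)`. -/
def InPartition {n : ℕ} {C : Submodule (ZMod 2) (Fin n → ZMod 2)} (α : Cstar C) (p : Sym2 ℕ)
    (β : Cstar C) : Prop :=
  β.1 ≠ α.1 ∧ β.1 ≠ 1 + α.1 ∧ weightPartition α.1 β.1 = p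

/-! ## Code algebras -/

/-- Structure parameters. Only `a i β` and `c i β` with `i` in the support of `β`, and `b β γ` with
`γ` different from `β` and from its complement, enter the multiplication. -/
structure Params (F : Type*) [Field F] {n : ℕ} (C : Submodule (ZMod 2) (Fin n → ZMod 2)) where
  a : Fin n → Cstar C → F
  b : Cstar C → Cstar C → F
  c : Fin n → Cstar C → F
  b_symm : ∀ β γ, b β γ = b γ β

/-- The underlying space of the code algebra; its basis is `t_i`, `e^β`. -/
abbrev Alg (F : Type*) [Field F] {n : ℕ} (C : Submodule (ZMod 2) (Fin n → ZMod 2)) : Type _ :=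
  (Fin n ⊕ Cstar C) →₀ F

/-- The toral element `t_i`. -/
def tor (F : Type*) [Field F] {n : ℕ} (C : Submodule (ZMod 2) (Fin n → ZMod 2)) (i : Fin n) :
    Alg F C :=
  Finsupp.single (Sum.inl i) 1

/-- The codeword element `e^β`. -/
def cw (F : Type*) [Field F] {n : ℕ} {C : Submodule (ZMod 2) (Fin n → ZMod 2)} (β : Cstar C) :
    Alg F C :=
  Finsupp.single (Sum.inr β) 1

/-- Products of basis elements. -/
def basisMul {F : Type*} [Field F] {n : ℕ} {C : Submodule (ZMod 2) (Fin n → ZMod 2)}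
    (P : Params F C) : Fin n ⊕ Cstar C → Fin n ⊕ Cstar C → Alg F C
  | Sum.inl i, Sum.inl j => if i = j then tor F C i else 0
  | Sum.inl i, Sum.inr β => if β.1 i ≠ 0 then P.a i β • cw F β else 0
  | Sum.inr β, Sum.inl i => if β.1 i ≠ 0 then P.a i β • cw F β else 0
  | Sum.inr β, Sum.inr γ =>
      if h : β.1 + γ.1 ≠ 0 ∧ β.1 + γ.1 ≠ 1 then
        P.b β γ • cw F ⟨β.1 + γ.1, C.add_mem β.2.1 γ.2.1, h⟩
      else if β = γ then ∑ i ∈ Finset.univ.filter (fun i => β.1 i ≠ 0), P.c i β • tor F C i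
      else 0

/-- The multiplication of the code algebra `A_C(Λ)`. -/
def mul {F : Type*} [Field F] {n : ℕ} {C : Submodule (ZMod 2) (Fin n → ZMod 2)}
    (P : Params F C) : Alg F C →ₗ[F] Alg F C →ₗ[F] Alg F C :=
  Finsupp.linearCombination F fun i => Finsupp.linearCombination F fun j => basisMul P i j

/-- Nondegenerate code algebras. -/
def IsNondegenerate {F : Type*} [Field F] {n : ℕ} {C : Submodule (ZMod 2) (Fin n → ZMod 2)}
    (P : Params F C) : Prop :=
  (∀ i, ∃ v ∈ C, v i ≠ 0) ∧ Nonempty (Cstar C) ∧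
  (∀ i (β : Cstar C), β.1 i ≠ 0 → P.a i β ≠ 0 ∧ P.c i β ≠ 0) ∧
  (∀ β γ : Cstar C, β.1 ≠ γ.1 → β.1 ≠ 1 + γ.1 → P.b β γ ≠ 0)

/-- The conditions on the parameters: `a` is constant, `c` depends on the codeword only,
and `b` at a conjugate of `α`, or at the complement of one, depends on the weight partition only. -/
def ParamsRegular {F : Type*} [Field F] {n : ℕ} {C : Submodule (ZMod 2) (Fin n → ZMod 2)}
    (P : Params F C) (α : Cstar C) (a : F) (c : Cstar C → F) : Prop :=
  (∀ i (β : Cstar C), β.1 i ≠ 0 → P.a i β = a) ∧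
  (∀ i (β : Cstar C), β.1 i ≠ 0 → P.c i β = c β) ∧
  (∀ α₁ α₂ : Cstar C, α₁.1 ∈ conjugates C α.1 → α₂.1 ∈ conjugates C α.1 →
    ∀ (p : Sym2 ℕ) (β γ : Cstar C), InPartition α₁ p β → InPartition α₂ p γ →
      P.b α₁ β = P.b α₂ γ) ∧
  (∀ α₁ α₂ : Cstar C, α₁.1 ∈ conjugates C α.1 → α₂.1 ∈ conjugates C α.1 →
    ∀ α₁' α₂' : Cstar C, α₁'.1 = 1 + α₁.1 → α₂'.1 = 1 + α₂.1 →
    ∀ (p : Sym2 ℕ) (β γ : Cstar C), InPartition α₁ p β → InPartition α₂ p γ →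
      P.b α₁' β = P.b α₂' γ)

/-! ## Small idempotents -/

/-- `λ = 1 / (2 a |α|)`. -/
def lam {F : Type*} [Field F] {n : ℕ} {C : Submodule (ZMod 2) (Fin n → ZMod 2)}
    (a : F) (α : Cstar C) : F :=
  1 / (2 * a * (hammingNorm α.1 : F))

/-- `ξ_β = (1 - 2 |α ∩ β| / |α|) / (4 μ b_{α,β})`. -/
def xi {F : Type*} [Field F] {n : ℕ} {C : Submodule (ZMod 2) (Fin n → ZMod 2)}
    (P : Params F C) (α : Cstar C) (μ : F) (β : Cstar C) : F :=
  1 / (4 * μ * P.b α β) * (1 - 2 * (interCard α.1 β.1 : F) / (hammingNorm α.1 : F))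

/-- A small idempotent `λ t_α + μ e^α`, where `μ ^ 2 = (λ - λ ^ 2) / c_α` (so that `μ` may be
either square root), together with a labelling `θ_+`, `θ_-` of the two roots of
`x ^ 2 + 2 ξ_β x - 1`, which are required to lie in `F` and to be distinct. The labelling depends
only on `|α ∩ β|`, and `θ^{α+β}_± = - θ^β_∓`. -/
structure SmallIdem {F : Type*} [Field F] {n : ℕ} {C : Submodule (ZMod 2) (Fin n → ZMod 2)}
    (P : Params F C) (a : F) (c : Cstar C → F) where
  word : Cstar C
  μ : F
  mu_sq : μ ^ 2 = (lam a word - lam a word ^ 2) / c word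
  θ : ℕ → ℤˣ → F
  theta_add : ∀ β : Cstar C, β.1 ≠ word.1 → β.1 ≠ 1 + word.1 →
    θ (interCard word.1 β.1) 1 + θ (interCard word.1 β.1) (-1) = -2 * xi P word μ β
  theta_mul : ∀ β : Cstar C, β.1 ≠ word.1 → β.1 ≠ 1 + word.1 →
    θ (interCard word.1 β.1) 1 * θ (interCard word.1 β.1) (-1) = -1
  theta_ne : ∀ β : Cstar C, β.1 ≠ word.1 → β.1 ≠ 1 + word.1 →
    θ (interCard word.1 β.1) 1 ≠ θ (interCard word.1 β.1) (-1)
  theta_swap : ∀ β : Cstar C, β.1 ≠ word.1 → β.1 ≠ 1 + word.1 → ∀ ε : ℤˣ,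
    θ (interCard word.1 (word.1 + β.1)) ε = -θ (interCard word.1 β.1) (-ε)

/-- The labels of the fusion law: `1`, `0`, `λ`, `λ - 1/2`, and `ν^p_±` for weight partitions. -/
inductive Label where
  | one : Label
  | zero : Label
  | lam : Label
  | lamHalf : Label
  | nu (p : Sym2 ℕ) (ε : ℤˣ) : Label

namespace SmallIdem

/-- `t_α`, the sum of the toral elements over the support of `α`. -/
def torSum {F : Type*} [Field F] {n : ℕ} {C : Submodule (ZMod 2) (Fin n → ZMod 2)}
    {P : Params F C} {a : F} {c : Cstar C → F} (x : SmallIdem P a c) : Alg F C :=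
  ∑ i ∈ Finset.univ.filter (fun i => x.word.1 i ≠ 0), tor F C i

/-- The idempotent itself. -/
def elt {F : Type*} [Field F] {n : ℕ} {C : Submodule (ZMod 2) (Fin n → ZMod 2)}
    {P : Params F C} {a : F} {c : Cstar C → F} (x : SmallIdem P a c) : Alg F C :=
  lam a x.word • x.torSum + x.μ • cw F x.word

/-- The part of the algebra attached to a label, spanned by the corresponding eigenvectors. -/
def part {F : Type*} [Field F] {n : ℕ} {C : Submodule (ZMod 2) (Fin n → ZMod 2)}
    {P : Params F C} {a : F} {c : Cstar C → F} (x : SmallIdem P a c) :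
    Label → Submodule F (Alg F C)
  | Label.one => Submodule.span F {x.elt}
  | Label.zero => Submodule.span F
      ({v | ∃ i, x.word.1 i = 0 ∧ v = tor F C i} ∪
        {v | ∃ γ : Cstar C, γ.1 = 1 + x.word.1 ∧ v = cw F γ})
  | Label.lam => Submodule.span F
      {v | ∃ j k, x.word.1 j ≠ 0 ∧ x.word.1 k ≠ 0 ∧ v = tor F C j - tor F C k}
  | Label.lamHalf => Submodule.span F {(2 * x.μ * c x.word) • x.torSum - cw F x.word}
  | Label.nu p ε => Submodule.span F
      {v | ∃ β γ : Cstar C, InPartition x.word p β ∧ γ.1 = x.word.1 + β.1 ∧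
        v = x.θ (interCard x.word.1 β.1) ε • cw F β + cw F γ}

/-- The eigenvalue attached to a label; `ν^p_± = 1/4 + μ b_{α,β} (θ^β_± + ξ_β)` for any
`β ∈ C_α(p)` (and a dummy value if there is none). -/
def eigenvalue {F : Type*} [Field F] {n : ℕ} {C : Submodule (ZMod 2) (Fin n → ZMod 2)}
    {P : Params F C} {a : F} {c : Cstar C → F} (x : SmallIdem P a c) : Label → F
  | Label.one => 1
  | Label.zero => 0
  | Label.lam => CodeAlg.lam a x.word
  | Label.lamHalf => CodeAlg.lam a x.word - 1 / 2
  | Label.nu p ε =>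
      if h : ∃ β : Cstar C, InPartition x.word p β then
        1 / 4 + x.μ * P.b x.word h.choose *
          (x.θ (interCard x.word.1 h.choose.1) ε + xi P x.word x.μ h.choose)
      else 0

end SmallIdem

/-! ## Fusion laws and gradings -/

/-- A fusion law on a set of labels. -/
structure FusionLaw (L : Type*) where
  carrier : Set L
  star : L → L → Set L

/-- The (smallest) fusion law of a family of decompositions `V = ⨁ A x f` with respect to a
bilinear product: the labels that occur, and for `f`, `g` the labels needed to
contain the products of the `f`-part and the `g`-part, for all members of the family. -/
def fusionLaw {F V ι L : Type*} [Field F] [AddCommGroup V] [Module F V]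
    (m : V →ₗ[F] V →ₗ[F] V) (A : ι → L → Submodule F V) : FusionLaw L where
  carrier := {f | ∃ x, A x f ≠ ⊥}
  star f g := {h | ∀ T : Set L,
    (∀ x, ∀ u ∈ A x f, ∀ v ∈ A x g, m u v ∈ ⨆ k ∈ T, A x k) → h ∈ T}

/-- A grading of a fusion law by an abelian group: a partition (with possibly empty parts). -/
def FusionLaw.IsGrading {L : Type*} (𝓕 : FusionLaw L) {T : Type*} [CommGroup T]
    (p : T → Set L) : Prop :=
  (⋃ t, p t) = 𝓕.carrier ∧ (∀ s t, s ≠ t → Disjoint (p s) (p t)) ∧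
  ∀ s t, ∀ f ∈ p s, ∀ g ∈ p t, 𝓕.star f g ⊆ p (s * t)

/-- A nontrivial grading by the group of signs. -/
def FusionLaw.IsZ2Grading {L : Type*} (𝓕 : FusionLaw L) (p : ℤˣ → Set L) : Prop :=
  𝓕.IsGrading p ∧ (p (-1)).Nonempty

/-- The law is (nontrivially) graded by the group of order two. -/
def FusionLaw.IsZ2Graded {L : Type*} (𝓕 : FusionLaw L) : Prop :=
  ∃ p : ℤˣ → Set L, 𝓕.IsZ2Grading p

/-- The fusion law of a set of small idempotents. -/
def idemLaw {F : Type*} [Field F] {n : ℕ} {C : Submodule (ZMod 2) (Fin n → ZMod 2)}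
    {P : Params F C} {a : F} {c : Cstar C → F} (X : Set (SmallIdem P a c)) : FusionLaw Label :=
  fusionLaw (mul P) fun x : X => x.1.part

/-- The fusion law of a single element with respect to the eigenspaces of its adjoint map. -/
def eigenLaw {F : Type*} [Field F] {n : ℕ} {C : Submodule (ZMod 2) (Fin n → ZMod 2)}
    (P : Params F C) (e : Alg F C) : FusionLaw F :=
  fusionLaw (mul P) fun _ : Unit => Module.End.eigenspace (mul P e)

/-- The sum of the parts with labels in a given set. -/
def SmallIdem.sumPart {F : Type*} [Field F] {n : ℕ} {C : Submodule (ZMod 2) (Fin n → ZMod 2)}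
    {P : Params F C} {a : F} {c : Cstar C → F} (x : SmallIdem P a c) (T : Set Label) :
    Submodule F (Alg F C) :=
  ⨆ f ∈ T, x.part f

/-! ## The cases of the classification -/

/-- `E` is a codimension one subcode of `D` containing the all-ones word, and a union of
weight sets of `D`. -/
def IsPlusSubcode {ι : Type*} [Fintype ι] (D E : Submodule (ZMod 2) (ι → ZMod 2)) : Prop :=
  E ≤ D ∧ Module.finrank (ZMod 2) D = Module.finrank (ZMod 2) E + 1 ∧
  (1 : ι → ZMod 2) ∈ E ∧ IsUnionOfWeightSets D E

def CaseOne {F : Type*} [Field F] {n : ℕ} (C : Submodule (ZMod 2) (Fin n → ZMod 2))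
    (α : Fin n → ZMod 2) (a : F) : Prop :=
  hammingNorm α = 1 ∧ C = ⊤ ∧ ((n = 2 ∧ a = -1) ∨ n = 3)

def CaseTwo {n : ℕ} (C : Submodule (ZMod 2) (Fin n → ZMod 2)) (α : Fin n → ZMod 2) : Prop :=
  hammingNorm α = 2 ∧ ∃ m, 3 ≤ m ∧ IsSumOfEvenWeightCodes C m

def CaseThree {n : ℕ} (C : Submodule (ZMod 2) (Fin n → ZMod 2)) (α : Fin n → ZMod 2) : Prop :=
  2 < hammingNorm α ∧ IsProjective (proj C α) ∧ (1 : {i : Fin n // α i ≠ 0} → ZMod 2) ∈ proj C α ∧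
  ∃ E, IsPlusSubcode (proj C α) E

end CodeAlg

end

noncomputable section

namespace CodeAlg

open scoped Classical

/-! ## Binary words -/

/-! Fix a small idempotent `e` at a word `α`. Multiplication by `e` preserves the plane of `t_α` and
`e^α`, each plane of `e^β` and `e^{α+β}`, and the span of the differences `t_j - t_k` over the
support of `α`; it kills the `t_i` off the support and `e^{α^c}`. Diagonalising these small blocks
produces the parts. The condition `2a|α| ≠ 1` gives `μ ≠ 0`, while `3a|α| ≠ 1` and `θ_+ ≠ θ_-` make
the eigenvectors of the two kinds of plane independent. So the parts span (`iSup_part`) and are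
independent (`iSupIndep_part`), and a grading of the law is the same thing as a simultaneous grading
of the algebra by sums of parts (`isGrading_iff`).

Given a sign grading, idempotents force parts to be even: `e` itself, any `t_i` off the support of
`α`, and, for three points of the support, `(t_i - t_j)(t_i - t_k) = t_i`. If `|α| ≥ 2`, the
spanning vector of `A_{λ-1/2}` maps `t_j - t_k` to a nonzero multiple of itself, so it is even too.
As soon as `A_λ` and `A_{λ-1/2}` are even, so is every `t_i`. For `i` in the support of `α`, `t_i`
kills exactly one of `e^β` and `e^{α+β}`, hence every `e^β` is homogeneous, with a sign depending
only on the weight partition of `β`. Since `e^β e^γ` is a nonzero multiple of `e^{β+γ}`, the sign is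
additive on `C`. Gradings of this type are therefore subgroups of `C` of index at most two that
contain `0, 1, α, 1 + α` and are otherwise cut out by weight partitions (`exists_isEvenSplit`);
conversely every such subgroup grades the algebra by spans of basis elements (`isGrading_sign`). By
conjugacy it is enough to look at one member of `X`.

It remains to find the subgroups. If `|α| > 2`, projectivity shows that words vanishing on the
support of `α` are even, so the subgroup is pulled back from a subcode `D_+` of the projection. If
`|α| = 2` with support `{i, j}`, the function `v_i + v_j` always works, and a code generated by
conjugate words of weight two is a sum of even weight codes. If `|α| = 1`, then `C` is the whole
space and all nontrivial words share one partition; the even words must then be the four trivial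
ones, which have index two only for `n = 3`. The exceptional gradings, with `A_{λ-1/2}` odd, need
`|α| = 1` and no `ν`-parts, that is `n = 2`; squaring the spanning vector of `A_{λ-1/2}` then gives
`a = -1`.

For the Klein four-group, the transposition of the two points of `α` preserves `C` and, under the
extra conditions, induces an algebra involution. Its eigenspaces refine the parity grading, because
`θ_± = ±1`, in some order, for the partition `(1,1)`. -/

lemma zmod_two_add_ne_zero {a b : ZMod 2} (ha : a ≠ 0) : a + b ≠ 0 ↔ b = 0 := by
  revert a b; decide

lemma zmod_two_eq_one {a : ZMod 2} (ha : a ≠ 0) : a = 1 := by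
  revert a; decide

lemma word_add_self {ι : Type*} (v : ι → ZMod 2) : v + v = 0 := ZModModule.add_self v

lemma word_add_eq_iff {ι : Type*} {u v w : ι → ZMod 2} : u + v = w ↔ u = w + v := by
  constructor
  · rintro rfl; rw [add_assoc, word_add_self, add_zero]
  · rintro rfl; rw [add_assoc, word_add_self, add_zero]

lemma word_add_cancel {ι : Type*} (u v : ι → ZMod 2) : u + (u + v) = v := by
  rw [← add_assoc, word_add_self, zero_add]

lemma word_add_eq_zero {ι : Type*} {u v : ι → ZMod 2} : u + v = 0 ↔ u = v := by
  rw [word_add_eq_iff, zero_add]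

section words

variable {n : ℕ}

lemma interCard_add (α β : Fin n → ZMod 2) :
    interCard α β + interCard α (α + β) = hammingNorm α := by
  unfold interCard hammingNorm
  rw [← Finset.card_filter_add_card_filter_not (s := Finset.univ.filter fun i => α i ≠ 0)
    (fun i => β i ≠ 0), Finset.filter_filter, Finset.filter_filter]
  congr 2
  ext i
  simp only [Finset.mem_filter, Finset.mem_univ, true_and, Pi.add_apply, not_not]
  exact and_congr_right fun h => zmod_two_add_ne_zero h

lemma interCard_one_add (α β : Fin n → ZMod 2) :
    interCard α (1 + β) = interCard α (α + β) := by
  unfold interCard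
  congr 1
  ext i
  simp only [Finset.mem_filter, Finset.mem_univ, true_and, Pi.add_apply, Pi.one_apply]
  refine and_congr_right fun h => ?_
  rw [zmod_two_eq_one h]

lemma interCard_self (α : Fin n → ZMod 2) : interCard α α = hammingNorm α := by
  simp [interCard, hammingNorm]

lemma interCard_one (α : Fin n → ZMod 2) : interCard α 1 = hammingNorm α := by
  simp [interCard, hammingNorm]

lemma interCard_zero (α : Fin n → ZMod 2) : interCard α 0 = 0 := by
  simp [interCard]

lemma interCard_le (α β : Fin n → ZMod 2) : interCard α β ≤ hammingNorm α := by
  have := interCard_add α β; omega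

lemma interCard_self_add (α β : Fin n → ZMod 2) :
    interCard α (α + β) = hammingNorm α - interCard α β := by
  have := interCard_add α β; omega

lemma weightPartition_eq (α β : Fin n → ZMod 2) :
    weightPartition α β = s(interCard α β, hammingNorm α - interCard α β) := by
  rw [weightPartition, interCard_self_add]

lemma weightPartition_self_add (α β : Fin n → ZMod 2) :
    weightPartition α (α + β) = weightPartition α β := by
  rw [weightPartition, weightPartition, word_add_cancel, Sym2.eq_swap]

lemma weightPartition_one_add (α β : Fin n → ZMod 2) :
    weightPartition α (1 + β) = weightPartition α β := by
  rw [← weightPartition_self_add α β, weightPartition_eq, weightPartition_eq, interCard_one_add]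

lemma weightPartition_eq_iff (α β γ : Fin n → ZMod 2) :
    weightPartition α β = weightPartition α γ ↔
      interCard α β = interCard α γ ∨ interCard α β = interCard α (α + γ) := by
  have h1 := interCard_add α β
  have h2 := interCard_add α γ
  rw [weightPartition, weightPartition, Sym2.eq_iff]
  omega

lemma hammingNorm_comp (α : Fin n → ZMod 2) (g : Equiv.Perm (Fin n)) :
    hammingNorm (α ∘ g) = hammingNorm α := by
  unfold hammingNorm
  exact Finset.card_bij (fun i _ => g i) (by simp) (by simp)
    (fun i hi => ⟨g.symm i, by simpa using hi, by simp⟩)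

lemma interCard_comp (α β : Fin n → ZMod 2) (g : Equiv.Perm (Fin n)) :
    interCard (α ∘ g) (β ∘ g) = interCard α β := by
  unfold interCard
  exact Finset.card_bij (fun i _ => g i) (by simp) (by simp)
    (fun i hi => ⟨g.symm i, by simpa using hi, by simp⟩)

variable {C : Submodule (ZMod 2) (Fin n → ZMod 2)}

lemma Cstar.ext {β γ : Cstar C} (h : β.1 = γ.1) : β = γ := Subtype.ext h

lemma InPartition.self_add {α β γ : Cstar C} {p : Sym2 ℕ} (h : InPartition α p β)
    (hγ : γ.1 = α.1 + β.1) : InPartition α p γ := by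
  refine ⟨?_, ?_, ?_⟩
  · rw [hγ]; intro h'; exact β.2.2.1 (by simpa using h')
  · rw [hγ, add_comm 1]; intro h'; exact β.2.2.2 (by simpa using h')
  · rw [hγ, weightPartition_self_add, h.2.2]

/-- The word `α + β`, for `β` different from `α` and its complement. -/
def Cstar.translate (α β : Cstar C) (h : β.1 ≠ α.1) (h' : β.1 ≠ 1 + α.1) : Cstar C :=
  ⟨α.1 + β.1, C.add_mem α.2.1 β.2.1, fun e => h (word_add_eq_zero.1 e).symm,
    fun e => h' (by rw [add_comm] at e; exact word_add_eq_iff.1 e)⟩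

lemma InPartition.exists_translate {α β : Cstar C} {p : Sym2 ℕ} (h : InPartition α p β) :
    ∃ γ : Cstar C, γ.1 = α.1 + β.1 := ⟨Cstar.translate α β h.1 h.2.1, rfl⟩

lemma Cstar.exists_ne_zero (α : Cstar C) : ∃ i, α.1 i ≠ 0 := Function.ne_iff.1 α.2.2.1

lemma Cstar.exists_eq_zero (α : Cstar C) : ∃ i, α.1 i = 0 := by
  obtain ⟨i, hi⟩ := Function.ne_iff.1 α.2.2.2
  refine ⟨i, ?_⟩
  by_contra h
  exact hi (zmod_two_eq_one h)

end words

/-! ## Products of basis elements -/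

section products

variable {F : Type*} [Field F] {n : ℕ} {C : Submodule (ZMod 2) (Fin n → ZMod 2)} (P : Params F C)

lemma mul_single (i j : Fin n ⊕ Cstar C) :
    mul P (Finsupp.single i 1) (Finsupp.single j 1) = basisMul P i j := by
  simp [mul, Finsupp.linearCombination_single]

lemma mul_tor_tor (i j : Fin n) :
    mul P (tor F C i) (tor F C j) = if i = j then tor F C i else 0 := mul_single P _ _

lemma mul_tor_cw (i : Fin n) (β : Cstar C) :
    mul P (tor F C i) (cw F β) = if β.1 i ≠ 0 then P.a i β • cw F β else 0 := mul_single P _ _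

/-- The sum enters as a separate element `δ` with an equation between words, so that later uses need
no membership proof for `β + γ` inside the term. -/
lemma mul_cw_cw {β γ δ : Cstar C} (h : δ.1 = β.1 + γ.1) :
    mul P (cw F β) (cw F γ) = P.b β γ • cw F δ := by
  refine (mul_single P _ _).trans ?_
  have h' : β.1 + γ.1 ≠ 0 ∧ β.1 + γ.1 ≠ 1 := h ▸ δ.2.2
  rw [basisMul, dif_pos h']
  congr 2
  exact Subtype.ext h.symm

lemma mul_cw_self (β : Cstar C) :
    mul P (cw F β) (cw F β) =
      ∑ i ∈ Finset.univ.filter (fun i => β.1 i ≠ 0), P.c i β • tor F C i := by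
  refine (mul_single P _ _).trans ?_
  rw [basisMul, dif_neg (by simp [word_add_self]), if_pos rfl]

lemma mul_cw_compl {β γ : Cstar C} (h : γ.1 = 1 + β.1) : mul P (cw F β) (cw F γ) = 0 := by
  refine (mul_single P _ _).trans ?_
  have h1 : β.1 + γ.1 = 1 := by rw [h, add_comm, add_assoc, word_add_self, add_zero]
  rw [basisMul, dif_neg (by simp [h1]), if_neg]
  rintro rfl
  rw [word_add_self] at h1
  obtain ⟨i, hi⟩ := β.exists_ne_zero
  exact zero_ne_one (congr_fun h1 i)

lemma basisMul_comm (i j : Fin n ⊕ Cstar C) : basisMul P i j = basisMul P j i := by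
  rcases i with i | β <;> rcases j with j | γ
  · simp only [basisMul]
    by_cases h : i = j
    · subst h; rfl
    · rw [if_neg h, if_neg (Ne.symm h)]
  · rfl
  · rfl
  · by_cases h : β = γ
    · subst h; rfl
    · have e : γ.1 + β.1 = β.1 + γ.1 := add_comm _ _
      by_cases h' : β.1 + γ.1 ≠ 0 ∧ β.1 + γ.1 ≠ 1
      · rw [← mul_single, ← mul_single]
        exact (mul_cw_cw P (δ := ⟨_, C.add_mem β.2.1 γ.2.1, h'⟩) rfl).trans
          ((congrArg (fun r => r • cw F _) (P.b_symm β γ)).trans (mul_cw_cw P e.symm).symm)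
      · simp only [basisMul]
        rw [dif_neg h', dif_neg (by rwa [e]), if_neg h, if_neg (Ne.symm h)]

lemma mul_comm' (u v : Alg F C) : mul P u v = mul P v u := by
  suffices mul P = (mul P).flip from congrArg (fun f => f u v) this
  refine Finsupp.lhom_ext' fun i => LinearMap.ext_ring ?_
  refine Finsupp.lhom_ext' fun j => LinearMap.ext_ring ?_
  simp only [LinearMap.comp_apply, Finsupp.lsingle_apply, LinearMap.flip_apply]
  rw [mul_single, mul_single, basisMul_comm]

lemma tor_ne_zero (i : Fin n) : tor F C i ≠ 0 := by simp [tor]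

lemma cw_ne_zero (β : Cstar C) : cw F β ≠ 0 := by simp [cw]

end products

/-! ## Fusion laws of decompositions -/

section fusion

variable {F V ι κ L L' : Type*} [Field F] [AddCommGroup V] [Module F V]

/-- Independence is certified by one explicit subspace `N f` per label, containing all the other
parts and meeting `A f` trivially; no sum of parts has to be analysed. -/
lemma iSupIndep_of_le_of_disjoint {A : L → Submodule F V} (N : L → Submodule F V)
    (h : ∀ f g, g ≠ f → A g ≤ N f) (hd : ∀ f, Disjoint (A f) (N f)) : iSupIndep A :=
  fun f => (hd f).mono_right (iSup₂_le (h f))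

/-- The set `star f g` is an intersection of admissible sets, and that it is itself admissible is
not formal: it holds because components in a direct sum are unique. -/
lemma mem_iSup_star (m : V →ₗ[F] V →ₗ[F] V) (A : ι → L → Submodule F V)
    (hind : ∀ x, iSupIndep (A x)) (htop : ∀ x, ⨆ f, A x f = ⊤) {f g : L} {x : ι} {u v : V}
    (hu : u ∈ A x f) (hv : v ∈ A x g) : m u v ∈ ⨆ k ∈ (fusionLaw m A).star f g, A x k := by
  have h0 : m u v ∈ ⨆ k, A x k := by rw [htop]; trivial
  obtain ⟨z, hz, hs⟩ := (Submodule.mem_iSup_iff_exists_finsupp _ _).1 h0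
  rw [← hs]
  refine Submodule.sum_mem _ fun k hk => ?_
  have hk0 : z k ≠ 0 := Finsupp.mem_support_iff.1 hk
  refine Submodule.mem_iSup_of_mem k (Submodule.mem_iSup_of_mem ?_ (hz k))
  -- If an admissible `T` missed `k`, the product would lie in the sum of the parts other than `k`,
  -- so its nonzero component `z k` would lie there as well.
  intro T hT
  by_contra hkT
  have hle : ⨆ j ∈ T, A x j ≤ ⨆ j ≠ k, A x j :=
    iSup₂_le fun j hj => le_iSup₂ (f := fun j (_ : j ≠ k) => A x j) j (ne_of_mem_of_not_mem hj hkT)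
  have h1 : m u v ∈ ⨆ j ≠ k, A x j := hle (hT x u hu v hv)
  have h2 : ∑ j ∈ z.support.erase k, z j ∈ ⨆ j ≠ k, A x j :=
    Submodule.sum_mem _ fun j hj =>
      Submodule.mem_iSup_of_mem j (Submodule.mem_iSup_of_mem (Finset.ne_of_mem_erase hj) (hz j))
  have h3 : z k = m u v - ∑ j ∈ z.support.erase k, z j := by
    rw [← hs, Finsupp.sum, ← Finset.add_sum_erase _ _ hk, add_sub_cancel_right]
  exact hk0 (Submodule.disjoint_def.1 (hind x k) _ (hz k) (h3 ▸ Submodule.sub_mem _ h1 h2))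

/-- Bilinearity passes from products of single parts to products of their sums. From here on only
subspaces and their products matter, not labels. -/
lemma isGrading_iff (m : V →ₗ[F] V →ₗ[F] V) (A : ι → L → Submodule F V)
    (hind : ∀ x, iSupIndep (A x)) (htop : ∀ x, ⨆ f, A x f = ⊤) {T : Type*} [CommGroup T]
    (p : T → Set L) :
    (fusionLaw m A).IsGrading p ↔
      (⋃ t, p t) = {f | ∃ x, A x f ≠ ⊥} ∧ (∀ s t, s ≠ t → Disjoint (p s) (p t)) ∧
      ∀ x s t, ∀ u ∈ ⨆ f ∈ p s, A x f, ∀ v ∈ ⨆ f ∈ p t, A x f, m u v ∈ ⨆ f ∈ p (s * t), A x f := by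
  refine and_congr Iff.rfl (and_congr Iff.rfl ⟨fun h x s t => ?_, fun h s t f hf g hg => ?_⟩)
  · rw [← Submodule.map₂_le, Submodule.map₂_iSup_left]
    refine iSup_le fun f => ?_
    rw [Submodule.map₂_iSup_left]
    refine iSup_le fun hf => ?_
    rw [Submodule.map₂_iSup_right]
    refine iSup_le fun g => ?_
    rw [Submodule.map₂_iSup_right]
    refine iSup_le fun hg => ?_
    rw [Submodule.map₂_le]
    have hle : ⨆ k ∈ (fusionLaw m A).star f g, A x k ≤ ⨆ k ∈ p (s * t), A x k :=
      biSup_mono (h s t f hf g hg)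
    exact fun u hu v hv => hle (mem_iSup_star m A hind htop hu hv)
  · exact fun k hk => hk _ fun x u hu v hv => h x s t u
      (Submodule.mem_iSup_of_mem f (Submodule.mem_iSup_of_mem hf hu)) v
      (Submodule.mem_iSup_of_mem g (Submodule.mem_iSup_of_mem hg hv))

/-- Labels outside the carrier have zero part, so sign classes may be taken in the set of all
labels. -/
lemma iSup_inter_carrier (m : V →ₗ[F] V →ₗ[F] V) (A : ι → L → Submodule F V) (x : ι) (Q : Set L) :
    ⨆ f ∈ (fusionLaw m A).carrier ∩ Q, A x f = ⨆ f ∈ Q, A x f := by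
  refine le_antisymm (biSup_mono fun f hf => hf.2) (iSup₂_le fun f hf => ?_)
  by_cases h : A x f = ⊥
  · rw [h]; exact bot_le
  · exact le_iSup₂_of_le f ⟨⟨x, h⟩, hf⟩ le_rfl

/-- Gradings constructed from multiplicatively closed families of subspaces. -/
lemma isGrading_of_subspaces (m : V →ₗ[F] V →ₗ[F] V) (A : ι → L → Submodule F V)
    {T : Type*} [CommGroup T] (Q : T → Set L)
    (hcov : ∀ x f, A x f ≠ ⊥ → ∃ t, f ∈ Q t) (hdis : ∀ s t, s ≠ t → Disjoint (Q s) (Q t))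
    (B : ι → T → Submodule F V) (hle : ∀ x t, ∀ f ∈ Q t, A x f ≤ B x t)
    (hge : ∀ x t, B x t ≤ ⨆ f ∈ Q t, A x f)
    (hmul : ∀ x s t, ∀ u ∈ B x s, ∀ v ∈ B x t, m u v ∈ B x (s * t)) :
    (fusionLaw m A).IsGrading fun t => (fusionLaw m A).carrier ∩ Q t := by
  refine ⟨?_, fun s t h => (hdis s t h).mono Set.inter_subset_right Set.inter_subset_right, ?_⟩
  · rw [← Set.inter_iUnion]
    refine Set.inter_eq_left.2 ?_
    rintro f ⟨x, hx⟩
    exact Set.mem_iUnion.2 (hcov x f hx)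
  · intro s t f hf g hg k hk
    refine hk _ fun x u hu v hv => ?_
    rw [iSup_inter_carrier]
    exact hge x _ (hmul x s t u (hle x s f hf.2 hu) v (hle x t g hg.2 hv))

lemma disjoint_iSup_of_disjoint {A : L → Submodule F V} (hind : iSupIndep A) {S T : Set L}
    (h : Disjoint S T) : Disjoint (⨆ f ∈ S, A f) (⨆ f ∈ T, A f) :=
  hind.disjoint_biSup_biSup h

/-- A grading only sees the nonzero parts as subspaces. When every member has the same
decomposition, it can be carried along a bijection `φ` between the labels that occur. -/
lemma IsZ2Graded.relabel (m : V →ₗ[F] V →ₗ[F] V) (A : ι → L → Submodule F V)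
    (B : κ → L' → Submodule F V) (hικ : Nonempty ι → Nonempty κ) (A₀ : L → Submodule F V)
    (B₀ : L' → Submodule F V)
    (hA : ∀ x, A x = A₀) (hB : ∀ y, B y = B₀) (hiA : iSupIndep A₀) (htA : ⨆ f, A₀ f = ⊤)
    (hiB : iSupIndep B₀) (htB : ⨆ f, B₀ f = ⊤)
    (φ : L → L') (hinj : Set.InjOn φ {f | A₀ f ≠ ⊥}) (hφ : ∀ f, A₀ f ≠ ⊥ → B₀ (φ f) = A₀ f)
    (hsurj : ∀ l, B₀ l ≠ ⊥ → ∃ f, A₀ f ≠ ⊥ ∧ φ f = l) (h : (fusionLaw m A).IsZ2Graded) :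
    (fusionLaw m B).IsZ2Graded := by
  obtain ⟨p, hp, hne⟩ := h
  rw [isGrading_iff m A (fun x => by rw [hA]; exact hiA) (fun x => by rw [hA]; exact htA)] at hp
  obtain ⟨h1, h2, h3⟩ := hp
  have hcar : ∀ t, ∀ f ∈ p t, A₀ f ≠ ⊥ ∧ Nonempty ι := fun t f hf => by
    have : f ∈ ⋃ t, p t := Set.mem_iUnion.2 ⟨t, hf⟩
    rw [h1] at this
    obtain ⟨x, hx⟩ := this
    rw [hA] at hx
    exact ⟨hx, ⟨x⟩⟩
  have hι : Nonempty ι := (hcar _ _ hne.some_mem).2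
  have hsum : ∀ t, ⨆ l ∈ φ '' p t, B₀ l = ⨆ f ∈ p t, A₀ f := fun t => by
    rw [iSup_image]
    exact iSup_congr fun f => iSup_congr fun hf => hφ f (hcar t f hf).1
  refine ⟨fun t => φ '' p t, ?_, hne.image φ⟩
  rw [isGrading_iff m B (fun x => by rw [hB]; exact hiB) (fun x => by rw [hB]; exact htB)]
  refine ⟨?_, ?_, ?_⟩
  · rw [← Set.image_iUnion, h1]
    ext l
    constructor
    · rintro ⟨f, ⟨x, hx⟩, rfl⟩
      obtain ⟨y⟩ := hικ hι
      rw [hA] at hx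
      refine ⟨y, ?_⟩
      rw [hB, hφ f hx]
      exact hx
    · rintro ⟨y, hy⟩
      rw [hB] at hy
      obtain ⟨f, hf, rfl⟩ := hsurj l hy
      obtain ⟨x⟩ := hι
      exact ⟨f, ⟨x, by rwa [hA]⟩, rfl⟩
  · intro s t hst
    rw [Set.disjoint_left]
    rintro _ ⟨f, hf, rfl⟩ ⟨g, hg, he⟩
    have := hinj (hcar t g hg).1 (hcar s f hf).1 he
    subst this
    exact Set.disjoint_left.1 (h2 s t hst) hf hg
  · intro y s t
    obtain ⟨x⟩ := hι
    have := h3 x s t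
    simp only [hA] at this
    simp only [hB]
    rw [hsum, hsum, hsum]
    exact this

lemma isZ2Graded_relabel_iff (m : V →ₗ[F] V →ₗ[F] V) (A : ι → L → Submodule F V)
    (B : κ → L' → Submodule F V) [Nonempty ι] [Nonempty κ] (A₀ : L → Submodule F V)
    (B₀ : L' → Submodule F V)
    (hA : ∀ x, A x = A₀) (hB : ∀ y, B y = B₀) (hiA : iSupIndep A₀) (htA : ⨆ f, A₀ f = ⊤)
    (hiB : iSupIndep B₀) (htB : ⨆ f, B₀ f = ⊤)
    (φ : L → L') (hinj : Set.InjOn φ {f | A₀ f ≠ ⊥}) (hφ : ∀ f, A₀ f ≠ ⊥ → B₀ (φ f) = A₀ f)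
    (hsurj : ∀ l, B₀ l ≠ ⊥ → ∃ f, A₀ f ≠ ⊥ ∧ φ f = l) :
    (fusionLaw m A).IsZ2Graded ↔ (fusionLaw m B).IsZ2Graded := by
  refine ⟨IsZ2Graded.relabel m A B (fun _ => inferInstance) A₀ B₀ hA hB hiA htA hiB htB φ hinj hφ
    hsurj, ?_⟩
  -- The inverse relabelling needs a default value in `L`; with no labels at all the second family
  -- has no nonzero part, hence no odd label.
  by_cases hL : Nonempty L
  · have hleft : ∀ l, B₀ l ≠ ⊥ → A₀ (Function.invFunOn φ {f | A₀ f ≠ ⊥} l) ≠ ⊥ ∧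
        φ (Function.invFunOn φ {f | A₀ f ≠ ⊥} l) = l := fun l hl =>
      ⟨Function.invFunOn_mem (s := {f | A₀ f ≠ ⊥}) (hsurj l hl),
        Function.invFunOn_eq (s := {f | A₀ f ≠ ⊥}) (hsurj l hl)⟩
    refine IsZ2Graded.relabel m B A (fun _ => inferInstance) B₀ A₀ hB hA hiB htB hiA htA
      (Function.invFunOn φ {f | A₀ f ≠ ⊥}) ?_ ?_ ?_
    · intro l hl l' hl' he
      rw [← (hleft l hl).2, he, (hleft l' hl').2]
    · intro l hl
      rw [← hφ _ (hleft l hl).1, (hleft l hl).2]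
    · intro f hf
      refine ⟨φ f, by rwa [hφ f hf], ?_⟩
      have h' := hleft (φ f) (by rwa [hφ f hf])
      exact hinj h'.1 hf h'.2
  · rintro ⟨p, hp, l, hl⟩
    have : l ∈ (fusionLaw m B).carrier := hp.1 ▸ Set.mem_iUnion.2 ⟨_, hl⟩
    obtain ⟨y, hy⟩ := this
    rw [hB] at hy
    obtain ⟨f, -⟩ := hsurj l hy
    exact absurd ⟨f⟩ hL

/-- If every label has an eigenvalue, and these are different for labels that occur, then the
eigenspaces of an endomorphism are the parts. -/
lemma isZ2Graded_iff_eigenspaces (m : V →ₗ[F] V →ₗ[F] V) (A : ι → L → Submodule F V) [Nonempty ι]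
    (A₀ : L → Submodule F V) (hA : ∀ x, A x = A₀) (hiA : iSupIndep A₀) (htA : ⨆ f, A₀ f = ⊤)
    (T : Module.End F V) (ev : L → F) (hev : ∀ f, A₀ f ≤ T.eigenspace (ev f))
    (hinj : Set.InjOn ev {f | A₀ f ≠ ⊥}) :
    (fusionLaw m A).IsZ2Graded ↔
      (fusionLaw m fun _ : Unit => (T.eigenspace : F → Submodule F V)).IsZ2Graded := by
  have hiB := Module.End.eigenspaces_iSupIndep T
  have htB : ⨆ l, T.eigenspace l = ⊤ := by
    rw [eq_top_iff, ← htA]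
    exact iSup_le fun f => le_iSup_of_le (ev f) (hev f)
  -- Split an `l`-eigenvector into its components with eigenvalue `l` and the rest. The rest is
  -- again an `l`-eigenvector and also a sum of vectors from other eigenspaces, so it vanishes.
  have key : ∀ l, T.eigenspace l ≤ ⨆ f ∈ {f | ev f = l}, A₀ f := by
    intro l v hv
    have hv' : v ∈ (⨆ f ∈ {f | ev f = l}, A₀ f) ⊔ ⨆ f ∈ {f | ev f ≠ l}, A₀ f := by
      rw [← iSup_union]
      have : ({f | ev f = l} ∪ {f | ev f ≠ l} : Set L) = Set.univ := by
        ext f; simp [em]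
      rw [this, iSup_univ, htA]
      trivial
    obtain ⟨y, hy, z, hz, rfl⟩ := Submodule.mem_sup.1 hv'
    have hle : ⨆ f ∈ {f | ev f = l}, A₀ f ≤ T.eigenspace l :=
      iSup₂_le fun f (hf : ev f = l) => hf ▸ hev f
    have hle' : ⨆ f ∈ {f | ev f ≠ l}, A₀ f ≤ ⨆ l' ≠ l, T.eigenspace l' :=
      iSup₂_le fun f (hf : ev f ≠ l) => (hev f).trans
        (le_iSup₂ (f := fun l' (_ : l' ≠ l) => T.eigenspace l') (ev f) hf)
    have hy' : y ∈ T.eigenspace l := hle hy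
    have hz' : z ∈ ⨆ l' ≠ l, T.eigenspace l' := hle' hz
    have hz'' : z ∈ T.eigenspace l := by
      have := Submodule.sub_mem _ hv hy'
      rwa [add_sub_cancel_left] at this
    have h0 : z = 0 := Submodule.disjoint_def.1 (hiB l) z hz'' hz'
    rw [h0, add_zero]
    exact hy
  refine isZ2Graded_relabel_iff m A _ A₀ _ hA (fun _ => rfl) hiA htA hiB htB ev hinj ?_ ?_
  · intro f hf
    refine le_antisymm ((key _).trans (iSup₂_le fun g hg => ?_)) (hev f)
    by_cases h : A₀ g = ⊥
    · rw [h]; exact bot_le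
    · rw [hinj h hf hg]
  · intro l hl
    by_contra! hcon
    refine hl (eq_bot_iff.2 ((key l).trans (iSup₂_le fun g hg => ?_)))
    by_cases h : A₀ g = ⊥
    · rw [h]
    · exact absurd hg (hcon g h)

end fusion

/-! ## Small idempotents and their eigenvectors -/

section idem

variable {F : Type*} [Field F] {n : ℕ} {C : Submodule (ZMod 2) (Fin n → ZMod 2)}
  {P : Params F C} {a : F} {c : Cstar C → F}

namespace SmallIdem

/-- The conditions on the parameters which are used for a single small idempotent. -/
structure IsRegular (x : SmallIdem P a c) : Prop where
  two_ne_zero : (2 : F) ≠ 0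
  card_ne_zero : (hammingNorm x.word.1 : F) ≠ 0
  a_eq : ∀ i (β : Cstar C), β.1 i ≠ 0 → P.a i β = a
  c_eq : ∀ i (β : Cstar C), β.1 i ≠ 0 → P.c i β = c β
  b_eq : ∀ (p : Sym2 ℕ) (β γ : Cstar C), InPartition x.word p β → InPartition x.word p γ →
    P.b x.word β = P.b x.word γ
  b_compl_eq : ∀ (p : Sym2 ℕ) (β γ δ : Cstar C), δ.1 = 1 + x.word.1 → InPartition x.word p β →
    InPartition x.word p γ → P.b δ β = P.b δ γ
  a_ne_zero : a ≠ 0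
  c_ne_zero : ∀ β, c β ≠ 0
  b_ne_zero : ∀ β γ : Cstar C, β.1 ≠ γ.1 → β.1 ≠ 1 + γ.1 → P.b β γ ≠ 0
  two_ne : 2 * a * (hammingNorm x.word.1 : F) ≠ 1
  three_ne : 3 * a * (hammingNorm x.word.1 : F) ≠ 1

/-- The element spanning the part with label `λ - 1/2`. -/
def halfVec (x : SmallIdem P a c) : Alg F C := (2 * x.μ * c x.word) • x.torSum - cw F x.word

/-- The eigenvectors of type `ν`. -/
def nuVec (x : SmallIdem P a c) (β γ : Cstar C) (ε : ℤˣ) : Alg F C :=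
  x.θ (interCard x.word.1 β.1) ε • cw F β + cw F γ

variable {x : SmallIdem P a c}

namespace IsRegular

variable (hx : x.IsRegular)

include hx

lemma lam_mul : CodeAlg.lam a x.word * (2 * a * (hammingNorm x.word.1 : F)) = 1 :=
  one_div_mul_cancel (mul_ne_zero (mul_ne_zero hx.two_ne_zero hx.a_ne_zero) hx.card_ne_zero)

lemma lam_ne_zero : CodeAlg.lam a x.word ≠ 0 := left_ne_zero_of_mul_eq_one hx.lam_mul

lemma mu_sq_mul : x.μ ^ 2 * c x.word = CodeAlg.lam a x.word - CodeAlg.lam a x.word ^ 2 := by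
  rw [x.mu_sq, div_mul_cancel₀ _ (hx.c_ne_zero _)]

lemma lam_ne_one : CodeAlg.lam a x.word ≠ 1 := fun h => hx.two_ne (by
  have := hx.lam_mul; rwa [h, one_mul] at this)

/-- Otherwise `λ(1 - λ) = 0`, while `λ ≠ 0` and `λ = 1` would mean `2a|α| = 1`. -/
lemma mu_ne_zero : x.μ ≠ 0 := by
  intro h
  have h1 := hx.mu_sq_mul
  rw [h] at h1
  have h2 : CodeAlg.lam a x.word * (1 - CodeAlg.lam a x.word) = 0 := by linear_combination -h1
  rcases mul_eq_zero.1 h2 with h3 | h3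
  · exact hx.lam_ne_zero h3
  · exact hx.lam_ne_one (sub_eq_zero.1 h3).symm

/-- Up to sign this is the determinant of the change from `t_α, e^α` to `e, halfVec`. Substituting
`μ²c = λ - λ²` turns it into `λ(3 - 2λ)`, and `3 = 2λ` would mean `3a|α| = 1`. -/
lemma det_ne_zero : CodeAlg.lam a x.word + 2 * x.μ ^ 2 * c x.word ≠ 0 := by
  intro h
  have h1 := hx.mu_sq_mul
  have h2 := hx.lam_mul
  have h3 : CodeAlg.lam a x.word * (3 - 2 * CodeAlg.lam a x.word) = 0 := by
    linear_combination h - 2 * h1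
  rcases mul_eq_zero.1 h3 with h4 | h4
  · exact hx.lam_ne_zero h4
  · have h5 : 2 * (3 * a * (hammingNorm x.word.1 : F) - 1) = 0 := by
      linear_combination 2 * a * (hammingNorm x.word.1 : F) * h4 + 2 * h2
    rcases mul_eq_zero.1 h5 with h6 | h6
    · exact hx.two_ne_zero h6
    · exact hx.three_ne (sub_eq_zero.1 h6)

lemma tor_mul_cw (i : Fin n) (β : Cstar C) :
    mul P (tor F C i) (cw F β) = if β.1 i ≠ 0 then a • cw F β else 0 := by
  rw [mul_tor_cw]
  split_ifs with h
  · rw [hx.a_eq i β h]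
  · rfl

omit hx in
lemma tor_mul_torSum (i : Fin n) :
    mul P (tor F C i) x.torSum = if x.word.1 i ≠ 0 then tor F C i else 0 := by
  rw [torSum, map_sum]
  simp only [mul_tor_tor]
  rw [Finset.sum_ite_eq]
  simp

omit hx in
lemma torSum_mul_tor (i : Fin n) :
    mul P x.torSum (tor F C i) = if x.word.1 i ≠ 0 then tor F C i else 0 := by
  rw [mul_comm', tor_mul_torSum]

omit hx in
lemma torSum_mul_torSum : mul P x.torSum x.torSum = x.torSum := by
  conv_lhs => enter [2]; rw [torSum]
  rw [map_sum, torSum]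
  refine Finset.sum_congr rfl fun i hi => ?_
  have := torSum_mul_tor (P := P) (x := x) i
  rw [torSum] at this
  rw [this, if_pos (Finset.mem_filter.1 hi).2]

lemma torSum_mul_cw (β : Cstar C) :
    mul P x.torSum (cw F β) = (a * (interCard x.word.1 β.1 : F)) • cw F β := by
  rw [torSum, map_sum, LinearMap.sum_apply]
  simp only [hx.tor_mul_cw]
  rw [← Finset.sum_filter, Finset.filter_filter, Finset.sum_const, ← interCard, mul_comm, mul_smul,
    Nat.cast_smul_eq_nsmul]

lemma cw_mul_self (β : Cstar C) : mul P (cw F β) (cw F β) =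
    c β • ∑ i ∈ Finset.univ.filter (fun i => β.1 i ≠ 0), tor F C i := by
  rw [mul_cw_self, Finset.smul_sum]
  exact Finset.sum_congr rfl fun i hi => by rw [hx.c_eq i β (Finset.mem_filter.1 hi).2]

lemma cw_word_mul_self : mul P (cw F x.word) (cw F x.word) = c x.word • x.torSum :=
  hx.cw_mul_self _

lemma torSum_mul_cw_word :
    mul P x.torSum (cw F x.word) = (a * (hammingNorm x.word.1 : F)) • cw F x.word := by
  rw [hx.torSum_mul_cw, interCard_self]

lemma cw_word_mul_torSum :
    mul P (cw F x.word) x.torSum = (a * (hammingNorm x.word.1 : F)) • cw F x.word := by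
  rw [mul_comm', hx.torSum_mul_cw_word]

lemma elt_mul_self : mul P x.elt x.elt = x.elt := by
  have h1 := hx.mu_sq_mul
  have h2 := hx.lam_mul
  simp only [elt, map_add, map_smul, LinearMap.add_apply, LinearMap.smul_apply,
    torSum_mul_torSum, hx.torSum_mul_cw_word, hx.cw_word_mul_torSum, hx.cw_word_mul_self]
  linear_combination (norm := module) h1 • x.torSum + (x.μ * h2) • cw F x.word

lemma elt_mul_tor (i : Fin n) : mul P x.elt (tor F C i) =
    if x.word.1 i ≠ 0 then CodeAlg.lam a x.word • tor F C i + (x.μ * a) • cw F x.word else 0 := by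
  simp only [elt, map_add, map_smul, LinearMap.add_apply, LinearMap.smul_apply, torSum_mul_tor,
    mul_comm' P (cw F x.word) (tor F C i), hx.tor_mul_cw]
  split_ifs with h
  · rw [mul_smul]
  · simp

lemma elt_mul_compl {γ : Cstar C} (h : γ.1 = 1 + x.word.1) : mul P x.elt (cw F γ) = 0 := by
  have : interCard x.word.1 γ.1 = 0 := by
    rw [h, interCard_one_add, word_add_self, interCard_zero]
  simp [elt, hx.torSum_mul_cw, mul_cw_compl P h, this]

lemma elt_mul_halfVec :
    mul P x.elt x.halfVec = (CodeAlg.lam a x.word - 1 / 2) • x.halfVec := by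
  have h1 := hx.mu_sq_mul
  have h2 := hx.lam_mul
  have h3 : (2 : F)⁻¹ * 2 = 1 := inv_mul_cancel₀ hx.two_ne_zero
  simp only [elt, halfVec, map_add, map_sub, map_smul, LinearMap.add_apply, LinearMap.smul_apply,
    torSum_mul_torSum, hx.torSum_mul_cw_word, hx.cw_word_mul_torSum, hx.cw_word_mul_self]
  linear_combination (norm := module) (x.μ * c x.word * h3) • x.torSum +
    (2 * a * (hammingNorm x.word.1 : F) * h1 + (1 / 2 - CodeAlg.lam a x.word) * h2
      - a * (hammingNorm x.word.1 : F) * CodeAlg.lam a x.word * h3) • cw F x.word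

lemma b_word_ne_zero {β : Cstar C} (h : β.1 ≠ x.word.1) (h' : β.1 ≠ 1 + x.word.1) :
    P.b x.word β ≠ 0 := by
  rw [P.b_symm]; exact hx.b_ne_zero _ _ h h'

lemma b_translate {β γ : Cstar C} (h : β.1 ≠ x.word.1) (h' : β.1 ≠ 1 + x.word.1)
    (hγ : γ.1 = x.word.1 + β.1) : P.b x.word γ = P.b x.word β :=
  hx.b_eq _ γ β (InPartition.self_add ⟨h, h', rfl⟩ hγ) ⟨h, h', rfl⟩

omit hx in
lemma theta_mul' {β : Cstar C} (h : β.1 ≠ x.word.1) (h' : β.1 ≠ 1 + x.word.1) (ε : ℤˣ) :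
    x.θ (interCard x.word.1 β.1) ε * x.θ (interCard x.word.1 β.1) (-ε) = -1 := by
  rcases Int.units_eq_one_or ε with rfl | rfl
  · exact x.theta_mul β h h'
  · rw [neg_neg, mul_comm]; exact x.theta_mul β h h'

omit hx in
lemma theta_add' {β : Cstar C} (h : β.1 ≠ x.word.1) (h' : β.1 ≠ 1 + x.word.1) (ε : ℤˣ) :
    x.θ (interCard x.word.1 β.1) ε + x.θ (interCard x.word.1 β.1) (-ε) =
      -2 * xi P x.word x.μ β := by
  rcases Int.units_eq_one_or ε with rfl | rfl
  · exact x.theta_add β h h'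
  · rw [neg_neg, add_comm]; exact x.theta_add β h h'

omit hx in
lemma theta_ne' {β : Cstar C} (h : β.1 ≠ x.word.1) (h' : β.1 ≠ 1 + x.word.1) (ε : ℤˣ) :
    x.θ (interCard x.word.1 β.1) ε ≠ x.θ (interCard x.word.1 β.1) (-ε) := by
  rcases Int.units_eq_one_or ε with rfl | rfl
  · exact x.theta_ne β h h'
  · rw [neg_neg]; exact (x.theta_ne β h h').symm

omit hx in
lemma theta_ne_zero {β : Cstar C} (h : β.1 ≠ x.word.1) (h' : β.1 ≠ 1 + x.word.1) (ε : ℤˣ) :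
    x.θ (interCard x.word.1 β.1) ε ≠ 0 := by
  intro h0
  have := theta_mul' h h' ε
  rw [h0, zero_mul] at this
  exact one_ne_zero (neg_eq_zero.1 this.symm)

lemma mu_b_xi {β : Cstar C} (h : β.1 ≠ x.word.1) (h' : β.1 ≠ 1 + x.word.1) :
    4 * x.μ * P.b x.word β * xi P x.word x.μ β =
      1 - 2 * (interCard x.word.1 β.1 : F) / (hammingNorm x.word.1 : F) := by
  have h4 : (4 : F) = 2 * 2 := by norm_num
  have h5 : 4 * x.μ * P.b x.word β ≠ 0 := by
    rw [h4]
    exact mul_ne_zero (mul_ne_zero (mul_ne_zero hx.two_ne_zero hx.two_ne_zero) hx.mu_ne_zero)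
      (hx.b_word_ne_zero h h')
  rw [xi, ← mul_assoc, mul_one_div_cancel h5, one_mul]

lemma mu_b_xi' {β : Cstar C} (h : β.1 ≠ x.word.1) (h' : β.1 ≠ 1 + x.word.1) :
    4 * x.μ * P.b x.word β * xi P x.word x.μ β =
      1 - 4 * CodeAlg.lam a x.word * a * (interCard x.word.1 β.1 : F) := by
  rw [hx.mu_b_xi h h']
  have h2 := hx.lam_mul
  have h3 := hx.card_ne_zero
  field_simp
  linear_combination 2 * (interCard x.word.1 β.1 : F) * h2

lemma elt_mul_cw {β γ : Cstar C} (hγ : γ.1 = x.word.1 + β.1) : mul P x.elt (cw F β) =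
    (CodeAlg.lam a x.word * (a * (interCard x.word.1 β.1 : F))) • cw F β +
      (x.μ * P.b x.word β) • cw F γ := by
  simp only [elt, map_add, map_smul, LinearMap.add_apply, LinearMap.smul_apply,
    hx.torSum_mul_cw, mul_cw_cw P hγ, mul_smul]

/-- On the plane of `e^β` and `e^γ` the matrix of `e` has equal off-diagonal entries `μb` and
diagonal entries `λa|α∩β|` and `λa|α∩γ|` with sum `1/2`. The eigenvector equation for `θ e^β + e^γ`
is then `θ² + 2ξθ - 1 = 0`. -/
lemma elt_mul_nuVec {β γ : Cstar C} (h : β.1 ≠ x.word.1) (h' : β.1 ≠ 1 + x.word.1)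
    (hγ : γ.1 = x.word.1 + β.1) (ε : ℤˣ) :
    mul P x.elt (x.nuVec β γ ε) = (1 / 4 + x.μ * P.b x.word β *
      (x.θ (interCard x.word.1 β.1) ε + xi P x.word x.μ β)) • x.nuVec β γ ε := by
  have hβ : β.1 = x.word.1 + γ.1 := by rw [hγ, word_add_cancel]
  have h1 : (interCard x.word.1 β.1 : F) + (interCard x.word.1 γ.1 : F) = hammingNorm x.word.1 := by
    rw [hγ, ← Nat.cast_add, interCard_add]
  have h2 := hx.lam_mul
  have h3 := hx.mu_b_xi' h h'
  have h4 := theta_mul' h h' ε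
  have h5 := theta_add' h h' ε
  simp only [nuVec, map_add, map_smul, hx.elt_mul_cw hγ, hx.elt_mul_cw hβ,
    hx.b_translate h h' hγ]
  set θ := x.θ (interCard x.word.1 β.1) ε
  set θ' := x.θ (interCard x.word.1 β.1) (-ε)
  set k := (interCard x.word.1 β.1 : F)
  set k' := (interCard x.word.1 γ.1 : F)
  set ξ := xi P x.word x.μ β
  set b := P.b x.word β
  set w := (hammingNorm x.word.1 : F)
  set l := CodeAlg.lam a x.word
  have e4 : (4 : F) ≠ 0 := by
    rw [show (4 : F) = 2 * 2 by norm_num]; exact mul_ne_zero hx.two_ne_zero hx.two_ne_zero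
  have e2 := hx.two_ne_zero
  -- The `e^γ` coefficient identifies the eigenvalue; the `e^β` coefficient, next, is where the
  -- quadratic equation is used.
  have c2 : l * (a * k') + x.μ * b * θ = 1 / 4 + x.μ * b * (θ + ξ) := by
    field_simp
    linear_combination 4 * l * a * h1 + 2 * h2 - h3
  have c1 : l * (a * k) * θ + x.μ * b = (1 / 4 + x.μ * b * (θ + ξ)) * θ := by
    field_simp
    linear_combination θ * h3 + 4 * x.μ * b * h4 - 4 * x.μ * b * θ * h5
  linear_combination (norm := module) c1 • cw F β + c2 • cw F γ

end IsRegular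

end SmallIdem

end idem

/-! ### Eigenvalues of the parts, spanning, and coordinates of their elements. -/

section idem

variable {F : Type*} [Field F] {n : ℕ} {C : Submodule (ZMod 2) (Fin n → ZMod 2)}
  {P : Params F C} {a : F} {c : Cstar C → F}

lemma eq_top_of_basis_mem (S : Submodule F (Alg F C)) (h1 : ∀ i, tor F C i ∈ S)
    (h2 : ∀ β, cw F β ∈ S) : S = ⊤ := by
  rw [eq_top_iff]
  rintro v -
  induction v using Finsupp.induction_linear with
  | zero => exact S.zero_mem
  | add u v hu hv => exact S.add_mem hu hv
  | single i r =>
    rw [← mul_one r, ← smul_eq_mul, ← Finsupp.smul_single]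
    rcases i with i | β
    · exact S.smul_mem r (h1 i)
    · exact S.smul_mem r (h2 β)

namespace SmallIdem

namespace IsRegular

variable {x : SmallIdem P a c} (hx : x.IsRegular)

lemma nuVec_mem {β γ : Cstar C} {p : Sym2 ℕ} (h : InPartition x.word p β)
    (hγ : γ.1 = x.word.1 + β.1) (ε : ℤˣ) : x.nuVec β γ ε ∈ x.part (Label.nu p ε) :=
  Submodule.subset_span ⟨β, γ, h, hγ, rfl⟩

lemma halfVec_mem : x.halfVec ∈ x.part Label.lamHalf := Submodule.mem_span_singleton_self _

lemma elt_mem : x.elt ∈ x.part Label.one := Submodule.mem_span_singleton_self _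

lemma tor_mem_zero {i : Fin n} (hi : x.word.1 i = 0) : tor F C i ∈ x.part Label.zero :=
  Submodule.subset_span (Or.inl ⟨i, hi, rfl⟩)

lemma compl_mem_zero {γ : Cstar C} (h : γ.1 = 1 + x.word.1) : cw F γ ∈ x.part Label.zero :=
  Submodule.subset_span (Or.inr ⟨γ, h, rfl⟩)

lemma tor_sub_tor_mem {j k : Fin n} (hj : x.word.1 j ≠ 0) (hk : x.word.1 k ≠ 0) :
    tor F C j - tor F C k ∈ x.part Label.lam :=
  Submodule.subset_span ⟨j, k, hj, hk, rfl⟩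

include hx

/-- The value does not depend on the chosen representative of `p`. Two representatives meet `α` in
equal or in complementary numbers of points; in the second case `θ_ε` becomes `-θ_{-ε}` and `ξ`
becomes `-ξ`, which leaves `θ_ε + ξ` unchanged because `θ_+ + θ_- = -2ξ`. -/
lemma eigenvalue_nu {β : Cstar C} {p : Sym2 ℕ} (h : InPartition x.word p β) (ε : ℤˣ) :
    x.eigenvalue (Label.nu p ε) = 1 / 4 + x.μ * P.b x.word β *
      (x.θ (interCard x.word.1 β.1) ε + xi P x.word x.μ β) := by
  have hex : ∃ β : Cstar C, InPartition x.word p β := ⟨β, h⟩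
  rw [eigenvalue, dif_pos hex]
  have h0 := hex.choose_spec
  set β₀ := hex.choose
  rw [hx.b_eq p β₀ β h0 h]
  congr 2
  have hp : weightPartition x.word.1 β₀.1 = weightPartition x.word.1 β.1 := h0.2.2.trans h.2.2.symm
  rcases (weightPartition_eq_iff _ _ _).1 hp with e | e
  · rw [e, xi, xi, hx.b_eq p β₀ β h0 h, e]
  · have e1 : (interCard x.word.1 β₀.1 : F) = hammingNorm x.word.1 - interCard x.word.1 β.1 := by
      rw [e, eq_sub_iff_add_eq, ← Nat.cast_add, add_comm, interCard_add]
    have hξ : xi P x.word x.μ β₀ = -xi P x.word x.μ β := by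
      rw [xi, xi, hx.b_eq p β₀ β h0 h, e1, ← mul_neg]
      congr 1
      field_simp [hx.card_ne_zero]
      ring
    rw [e, x.theta_swap β h.1 h.2.1, hξ]
    linear_combination -theta_add' h.1 h.2.1 ε

lemma part_le_eigenspace (f : Label) :
    x.part f ≤ Module.End.eigenspace (mul P x.elt) (x.eigenvalue f) := by
  rcases f with _ | _ | _ | _ | ⟨p, ε⟩
  · refine (Submodule.span_singleton_le_iff_mem _ _).2 (Module.End.mem_eigenspace_iff.2 ?_)
    rw [hx.elt_mul_self, eigenvalue, one_smul]
  · refine Submodule.span_le.2 ?_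
    rintro v (⟨i, hi, rfl⟩ | ⟨γ, hγ, rfl⟩)
    · refine Module.End.mem_eigenspace_iff.2 ?_
      rw [hx.elt_mul_tor, if_neg (not_not.2 hi), eigenvalue, zero_smul]
    · refine Module.End.mem_eigenspace_iff.2 ?_
      rw [hx.elt_mul_compl hγ, eigenvalue, zero_smul]
  · refine Submodule.span_le.2 ?_
    rintro v ⟨j, k, hj, hk, rfl⟩
    refine Module.End.mem_eigenspace_iff.2 ?_
    rw [map_sub, hx.elt_mul_tor, hx.elt_mul_tor, if_pos hj, if_pos hk, eigenvalue, smul_sub]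
    abel
  · refine (Submodule.span_singleton_le_iff_mem _ _).2 (Module.End.mem_eigenspace_iff.2 ?_)
    exact hx.elt_mul_halfVec
  · refine Submodule.span_le.2 ?_
    rintro v ⟨β, γ, hβ, hγ, rfl⟩
    refine Module.End.mem_eigenspace_iff.2 ?_
    rw [hx.eigenvalue_nu hβ]
    exact hx.elt_mul_nuVec hβ.1 hβ.2.1 hγ ε

lemma torSum_eq : x.torSum = (CodeAlg.lam a x.word + 2 * x.μ ^ 2 * c x.word)⁻¹ •
    (x.elt + x.μ • x.halfVec) := by
  rw [eq_inv_smul_iff₀ hx.det_ne_zero, elt, halfVec]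
  module

lemma cw_word_eq : cw F x.word = (CodeAlg.lam a x.word + 2 * x.μ ^ 2 * c x.word)⁻¹ •
    ((2 * x.μ * c x.word) • x.elt - CodeAlg.lam a x.word • x.halfVec) := by
  rw [eq_inv_smul_iff₀ hx.det_ne_zero, elt, halfVec]
  module

lemma torSum_mem {S : Submodule F (Alg F C)} (h1 : x.elt ∈ S) (h2 : x.halfVec ∈ S) :
    x.torSum ∈ S := by
  rw [hx.torSum_eq]
  exact S.smul_mem _ (S.add_mem h1 (S.smul_mem _ h2))

lemma cw_word_mem {S : Submodule F (Alg F C)} (h1 : x.elt ∈ S) (h2 : x.halfVec ∈ S) :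
    cw F x.word ∈ S := by
  rw [hx.cw_word_eq]
  exact S.smul_mem _ (S.sub_mem (S.smul_mem _ h1) (S.smul_mem _ h2))

/-- Averaging: `|α| t_i` is `t_α` plus the differences `t_i - t_j`, and `|α|` is invertible. -/
lemma tor_mem {S : Submodule F (Alg F C)} (h1 : x.torSum ∈ S)
    (h2 : x.part Label.lam ≤ S) {i : Fin n} (hi : x.word.1 i ≠ 0) : tor F C i ∈ S := by
  have h : (hammingNorm x.word.1 : F) • tor F C i = x.torSum +
      ∑ j ∈ Finset.univ.filter (fun i => x.word.1 i ≠ 0), (tor F C i - tor F C j) := by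
    rw [Finset.sum_sub_distrib, Finset.sum_const, Nat.cast_smul_eq_nsmul, torSum, hammingNorm]
    abel
  rw [← inv_smul_smul₀ hx.card_ne_zero (tor F C i), h]
  exact S.smul_mem _ (S.add_mem h1 (S.sum_mem fun j hj =>
    h2 (tor_sub_tor_mem hi (Finset.mem_filter.1 hj).2)))

omit hx in
-- The vectors for `ε = 1` and `ε = -1` differ by `(θ_+ - θ_-) e^β`.
lemma cw_mem {S : Submodule F (Alg F C)} {β γ : Cstar C} (h : β.1 ≠ x.word.1)
    (h' : β.1 ≠ 1 + x.word.1) (h1 : ∀ ε, x.nuVec β γ ε ∈ S) : cw F β ∈ S := by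
  have h2 := sub_ne_zero.2 (x.theta_ne β h h')
  have : cw F β = (x.θ (interCard x.word.1 β.1) 1 - x.θ (interCard x.word.1 β.1) (-1))⁻¹ •
      (x.nuVec β γ 1 - x.nuVec β γ (-1)) := by
    rw [eq_inv_smul_iff₀ h2, nuVec, nuVec]
    module
  rw [this]
  exact S.smul_mem _ (S.sub_mem (h1 _) (h1 _))

omit hx in
lemma cw_mem_of_part_le {S : Submodule F (Alg F C)} {p : Sym2 ℕ} {β : Cstar C}
    (h : InPartition x.word p β) (hS : ∀ ε, x.part (Label.nu p ε) ≤ S) : cw F β ∈ S := by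
  obtain ⟨γ, hγ⟩ := h.exists_translate
  exact cw_mem h.1 h.2.1 (γ := γ) fun ε => hS ε (nuVec_mem h hγ ε)

lemma iSup_part : ⨆ f, x.part f = ⊤ := by
  have hle : ∀ f, x.part f ≤ ⨆ f, x.part f := le_iSup x.part
  have he := hle _ (elt_mem (x := x))
  have hh := hle _ (halfVec_mem (x := x))
  refine eq_top_of_basis_mem _ (fun i => ?_) fun β => ?_
  · by_cases hi : x.word.1 i = 0
    · exact hle _ (tor_mem_zero hi)
    · exact hx.tor_mem (hx.torSum_mem he hh) (hle _) hi
  · by_cases h : β.1 = x.word.1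
    · rw [Cstar.ext h]
      exact hx.cw_word_mem he hh
    · by_cases h' : β.1 = 1 + x.word.1
      · exact hle _ (compl_mem_zero h')
      · exact cw_mem_of_part_le ⟨h, h', rfl⟩ fun ε => hle _

/-! ### Coordinates of the elements of the parts -/

omit hx

lemma torSum_inl (i : Fin n) : x.torSum (Sum.inl i) = if x.word.1 i ≠ 0 then 1 else 0 := by
  simp only [torSum, Finsupp.finsetSum_apply, tor, Finsupp.single_apply, Sum.inl.injEq]
  rw [Finset.sum_ite_eq']
  simp

lemma torSum_inr (β : Cstar C) : x.torSum (Sum.inr β) = 0 := by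
  simp [torSum, Finsupp.finsetSum_apply, tor]

lemma coord_zero {v : Alg F C} (hv : v ∈ x.part Label.zero) :
    (∀ i, x.word.1 i ≠ 0 → v (Sum.inl i) = 0) ∧
      ∀ β : Cstar C, β.1 ≠ 1 + x.word.1 → v (Sum.inr β) = 0 := by
  induction hv using Submodule.span_induction with
  | mem v h =>
    rcases h with ⟨i, hi, rfl⟩ | ⟨γ, hγ, rfl⟩
    · refine ⟨fun j hj => ?_, fun β _ => by simp [tor]⟩
      have : i ≠ j := fun e => hj (e ▸ hi)
      simp [tor, this]
    · refine ⟨fun j hj => by simp [cw], fun β hβ => ?_⟩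
      have : γ ≠ β := fun e => hβ (e ▸ hγ)
      simp [cw, this]
  | zero => simp
  | add u v _ _ hu hv => exact ⟨fun i hi => by simp [hu.1 i hi, hv.1 i hi],
      fun β hβ => by simp [hu.2 β hβ, hv.2 β hβ]⟩
  | smul r v _ hv => exact ⟨fun i hi => by simp [hv.1 i hi], fun β hβ => by simp [hv.2 β hβ]⟩

lemma coord_lam {v : Alg F C} (hv : v ∈ x.part Label.lam) :
    (∀ i, x.word.1 i = 0 → v (Sum.inl i) = 0) ∧ (∀ β : Cstar C, v (Sum.inr β) = 0) ∧
      ∑ i ∈ Finset.univ.filter (fun i => x.word.1 i ≠ 0), v (Sum.inl i) = 0 := by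
  induction hv using Submodule.span_induction with
  | mem v h =>
    obtain ⟨j, k, hj, hk, rfl⟩ := h
    refine ⟨fun i hi => ?_, fun β => by simp [tor], ?_⟩
    · have h1 : j ≠ i := fun e => hj (e ▸ hi)
      have h2 : k ≠ i := fun e => hk (e ▸ hi)
      simp [tor, h1, h2]
    · simp [tor, Finsupp.single_apply, Finset.sum_ite_eq, hj, hk]
  | zero => simp
  | add u v _ _ hu hv =>
    refine ⟨fun i hi => by simp [hu.1 i hi, hv.1 i hi], fun β => by simp [hu.2.1 β, hv.2.1 β], ?_⟩
    simp [Finset.sum_add_distrib, hu.2.2, hv.2.2]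
  | smul r v _ hv =>
    refine ⟨fun i hi => by simp [hv.1 i hi], fun β => by simp [hv.2.1 β], ?_⟩
    simp [← Finset.mul_sum, hv.2.2]

/-- The relation can be imposed at both `β` and `α + β` because `θ^{α+β}_ε = -θ^β_{-ε}` is the
inverse of `θ^β_ε`. -/
lemma coord_nu {p : Sym2 ℕ} {ε : ℤˣ} {v : Alg F C} (hv : v ∈ x.part (Label.nu p ε)) :
    (∀ i, v (Sum.inl i) = 0) ∧ (∀ β, ¬InPartition x.word p β → v (Sum.inr β) = 0) ∧
      ∀ β γ : Cstar C, InPartition x.word p β → γ.1 = x.word.1 + β.1 →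
        v (Sum.inr β) = x.θ (interCard x.word.1 β.1) ε * v (Sum.inr γ) := by
  induction hv using Submodule.span_induction with
  | mem v h =>
    obtain ⟨β, γ, hβ, hγ, rfl⟩ := h
    have hβγ : β ≠ γ := fun e => by
      have := congr_arg Subtype.val e
      rw [hγ] at this
      exact x.word.2.2.1 (by simpa using this)
    refine ⟨fun i => by simp [cw], fun δ hδ => ?_, fun β' γ' hβ' hγ' => ?_⟩
    · have h1 : β ≠ δ := fun e => hδ (e ▸ hβ)
      have h2 : γ ≠ δ := fun e => hδ (e ▸ hβ.self_add hγ)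
      simp [cw, h1, h2]
    · by_cases h1 : β' = β
      · subst h1
        obtain rfl : γ' = γ := Cstar.ext (hγ'.trans hγ.symm)
        simp [cw, hβγ, Ne.symm hβγ]
      · by_cases h2 : β' = γ
        · subst h2
          -- The generator is read from its other end; the ratio of its coordinates is inverted,
          -- which matches the swapped root.
          obtain rfl : γ' = β := Cstar.ext (by rw [hγ', hγ, word_add_cancel])
          have := theta_mul' (x := x) hβ.1 hβ.2.1 ε
          have h3 := x.theta_swap γ' hβ.1 hβ.2.1 ε
          rw [← hγ] at h3
          simp only [cw, Finsupp.add_apply, Finsupp.smul_apply, Finsupp.single_apply,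
            Sum.inr.injEq, if_neg hβγ, if_neg (Ne.symm hβγ), if_true, smul_eq_mul, h3]
          linear_combination this
        · have h3 : γ' ≠ β := by
            rintro rfl
            exact h2 (Cstar.ext (by rw [hγ, hγ', word_add_cancel]))
          have h4 : γ' ≠ γ := by
            rintro rfl
            exact h1 (Cstar.ext (add_left_cancel (hγ'.symm.trans hγ)))
          simp [cw, Ne.symm h1, Ne.symm h2, Ne.symm h3, Ne.symm h4]
  | zero => simp
  | add u v _ _ hu hv =>
    refine ⟨fun i => by simp [hu.1 i, hv.1 i], fun β h => by simp [hu.2.1 β h, hv.2.1 β h], ?_⟩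
    intro β γ h h'
    rw [Finsupp.add_apply, Finsupp.add_apply, hu.2.2 β γ h h', hv.2.2 β γ h h', mul_add]
  | smul r v _ hv =>
    refine ⟨fun i => by simp [hv.1 i], fun β h => by simp [hv.2.1 β h], ?_⟩
    intro β γ h h'
    rw [Finsupp.smul_apply, Finsupp.smul_apply, hv.2.2 β γ h h', smul_eq_mul, smul_eq_mul,
      mul_left_comm]

end IsRegular

end SmallIdem

end idem

/-! ### Independence of the parts. -/

section idem

variable {F : Type*} [Field F] {n : ℕ} {C : Submodule (ZMod 2) (Fin n → ZMod 2)}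
  {P : Params F C} {a : F} {c : Cstar C → F}

namespace SmallIdem

lemma word_ne_compl (α : Cstar C) : α.1 ≠ 1 + α.1 := by
  obtain ⟨i, -⟩ := α.exists_ne_zero
  intro h
  exact one_ne_zero (right_eq_add.1 (congr_fun h i))

/-- The sum of the coordinates at the toral elements in the support of the word. -/
def torCoord (x : SmallIdem P a c) (v : Alg F C) : F :=
  ∑ i ∈ Finset.univ.filter (fun i => x.word.1 i ≠ 0), v (Sum.inl i)

lemma torCoord_add (x : SmallIdem P a c) (u v : Alg F C) :
    x.torCoord (u + v) = x.torCoord u + x.torCoord v := by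
  simp [torCoord, Finset.sum_add_distrib]

lemma torCoord_smul (x : SmallIdem P a c) (r : F) (v : Alg F C) :
    x.torCoord (r • v) = r * x.torCoord v := by
  simp [torCoord, Finset.mul_sum]

lemma torCoord_eq_zero (x : SmallIdem P a c) {v : Alg F C}
    (h : ∀ i, x.word.1 i ≠ 0 → v (Sum.inl i) = 0) : x.torCoord v = 0 :=
  Finset.sum_eq_zero fun i hi => h i (Finset.mem_filter.1 hi).2

/-- Linear conditions satisfied by all the parts except for the one with the given label. -/
def complPart (x : SmallIdem P a c) : Label → Submodule F (Alg F C)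
  | Label.one =>
    { carrier := {v | x.torCoord v + 2 * x.μ * c x.word * (hammingNorm x.word.1 : F) *
        v (Sum.inr x.word) = 0}
      add_mem' := fun {u v} hu hv => by
        simp only [Set.mem_ofPred_eq, torCoord_add, Finsupp.add_apply] at *
        linear_combination hu + hv
      zero_mem' := by simp [torCoord]
      smul_mem' := fun r v hv => by
        simp only [Set.mem_ofPred_eq, torCoord_smul, Finsupp.smul_apply, smul_eq_mul] at *
        linear_combination r * hv }
  | Label.zero =>
    { carrier := {v | (∀ i, x.word.1 i = 0 → v (Sum.inl i) = 0) ∧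
        ∀ β : Cstar C, β.1 = 1 + x.word.1 → v (Sum.inr β) = 0}
      add_mem' := fun {u v} hu hv => ⟨fun i hi => by simp [hu.1 i hi, hv.1 i hi],
        fun β hβ => by simp [hu.2 β hβ, hv.2 β hβ]⟩
      zero_mem' := by simp
      smul_mem' := fun r v hv => ⟨fun i hi => by simp [hv.1 i hi],
        fun β hβ => by simp [hv.2 β hβ]⟩ }
  | Label.lam =>
    { carrier := {v | ∀ i j, x.word.1 i ≠ 0 → x.word.1 j ≠ 0 → v (Sum.inl i) = v (Sum.inl j)}
      add_mem' := fun {u v} hu hv i j hi hj => by simp [hu i j hi hj, hv i j hi hj]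
      zero_mem' := by simp
      smul_mem' := fun r v hv i j hi hj => by simp [hv i j hi hj] }
  | Label.lamHalf =>
    { carrier := {v | x.μ * x.torCoord v = CodeAlg.lam a x.word * (hammingNorm x.word.1 : F) *
        v (Sum.inr x.word)}
      add_mem' := fun {u v} hu hv => by
        simp only [Set.mem_ofPred_eq, torCoord_add, Finsupp.add_apply] at *
        linear_combination hu + hv
      zero_mem' := by simp [torCoord]
      smul_mem' := fun r v hv => by
        simp only [Set.mem_ofPred_eq, torCoord_smul, Finsupp.smul_apply, smul_eq_mul] at *
        linear_combination r * hv }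
  | Label.nu p ε =>
    { carrier := {v | ∀ β γ : Cstar C, InPartition x.word p β → γ.1 = x.word.1 + β.1 →
        v (Sum.inr β) = x.θ (interCard x.word.1 β.1) (-ε) * v (Sum.inr γ)}
      add_mem' := fun {u v} hu hv β γ h h' => by
        rw [Finsupp.add_apply, Finsupp.add_apply, hu β γ h h', hv β γ h h', mul_add]
      zero_mem' := by simp
      smul_mem' := fun r v hv β γ h h' => by
        rw [Finsupp.smul_apply, Finsupp.smul_apply, hv β γ h h', smul_eq_mul, smul_eq_mul,
          mul_left_comm] }

namespace IsRegular

variable {x : SmallIdem P a c}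

lemma coord_one {v : Alg F C} (hv : v ∈ x.part Label.one) : ∃ r : F,
    (∀ i, v (Sum.inl i) = if x.word.1 i ≠ 0 then r * CodeAlg.lam a x.word else 0) ∧
      (∀ β, v (Sum.inr β) = if x.word = β then r * x.μ else 0) ∧ v = r • x.elt := by
  obtain ⟨r, rfl⟩ := Submodule.mem_span_singleton.1 hv
  refine ⟨r, fun i => ?_, fun β => ?_, rfl⟩
  · simp [elt, cw, torSum_inl]
  · simp only [elt, cw, Finsupp.smul_apply, Finsupp.add_apply, torSum_inr, Finsupp.single_apply,
      Sum.inr.injEq, smul_eq_mul]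
    split_ifs <;> ring

lemma coord_half {v : Alg F C} (hv : v ∈ x.part Label.lamHalf) : ∃ r : F,
    (∀ i, v (Sum.inl i) = if x.word.1 i ≠ 0 then r * (2 * x.μ * c x.word) else 0) ∧
      (∀ β, v (Sum.inr β) = if x.word = β then -r else 0) ∧ v = r • x.halfVec := by
  obtain ⟨r, rfl⟩ := Submodule.mem_span_singleton.1 hv
  refine ⟨r, fun i => ?_, fun β => ?_, rfl⟩
  · simp [cw, torSum_inl]
  · simp only [cw, Finsupp.smul_apply, Finsupp.sub_apply, torSum_inr, Finsupp.single_apply,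
      Sum.inr.injEq, smul_eq_mul]
    split_ifs <;> ring

lemma torCoord_const {v : Alg F C} {r : F}
    (h : ∀ i, v (Sum.inl i) = if x.word.1 i ≠ 0 then r else 0) :
    x.torCoord v = (hammingNorm x.word.1 : F) * r := by
  rw [torCoord, Finset.sum_congr rfl fun i hi => (h i).trans (if_pos (Finset.mem_filter.1 hi).2),
    Finset.sum_const, nsmul_eq_mul, hammingNorm]

lemma part_le_complPart {f g : Label} (hgf : g ≠ f) : x.part g ≤ x.complPart f := by
  intro v hv
  rcases g with _ | _ | _ | _ | ⟨q, δ⟩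
  · obtain ⟨r, h1, h2, -⟩ := coord_one hv
    rcases f with _ | _ | _ | _ | ⟨p, ε⟩
    · exact absurd rfl hgf
    · exact ⟨fun i hi => by simp [h1, hi], fun β hβ => by
        rw [h2, if_neg]; rintro rfl; exact word_ne_compl _ hβ⟩
    · exact fun i j hi hj => by simp [h1, hi, hj]
    · show _ = _
      rw [torCoord_const h1, h2, if_pos rfl]
      ring
    · intro β γ h h'
      rw [h2, h2, if_neg, if_neg, mul_zero]
      · rintro rfl; exact (h.self_add h').1 rfl
      · rintro rfl; exact h.1 rfl
  · obtain ⟨h1, h2⟩ := coord_zero hv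
    rcases f with _ | _ | _ | _ | ⟨p, ε⟩
    · show _ = _
      rw [torCoord_eq_zero x h1, h2 _ (word_ne_compl _)]
      ring
    · exact absurd rfl hgf
    · exact fun i j hi hj => by simp [h1, hi, hj]
    · show _ = _
      rw [torCoord_eq_zero x h1, h2 _ (word_ne_compl _)]
      ring
    · intro β γ h h'
      rw [h2 _ h.2.1, h2 _ (h.self_add h').2.1, mul_zero]
  · obtain ⟨h1, h2, h3⟩ := coord_lam hv
    rcases f with _ | _ | _ | _ | ⟨p, ε⟩
    · show _ = _
      rw [torCoord, h3, h2]
      ring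
    · exact ⟨fun i hi => h1 i hi, fun β _ => h2 β⟩
    · exact absurd rfl hgf
    · show _ = _
      rw [torCoord, h3, h2]
      ring
    · intro β γ h h'
      rw [h2, h2, mul_zero]
  · obtain ⟨r, h1, h2, -⟩ := coord_half hv
    rcases f with _ | _ | _ | _ | ⟨p, ε⟩
    · show _ = _
      rw [torCoord_const h1, h2, if_pos rfl]
      ring
    · exact ⟨fun i hi => by simp [h1, hi], fun β hβ => by
        rw [h2, if_neg]; rintro rfl; exact word_ne_compl _ hβ⟩
    · exact fun i j hi hj => by simp [h1, hi, hj]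
    · exact absurd rfl hgf
    · intro β γ h h'
      rw [h2, h2, if_neg, if_neg, mul_zero]
      · rintro rfl; exact (h.self_add h').1 rfl
      · rintro rfl; exact h.1 rfl
  · obtain ⟨h1, h2, h3⟩ := coord_nu hv
    have hw : v (Sum.inr x.word) = 0 := h2 _ fun h => h.1 rfl
    rcases f with _ | _ | _ | _ | ⟨p, ε⟩
    · show _ = _
      rw [torCoord_eq_zero x fun i _ => h1 i, hw]
      ring
    · exact ⟨fun i _ => h1 i, fun β hβ => h2 β fun h => h.2.1 hβ⟩
    · exact fun i j _ _ => by rw [h1, h1]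
    · show _ = _
      rw [torCoord_eq_zero x fun i _ => h1 i, hw]
      ring
    · intro β γ h h'
      by_cases hpq : p = q
      · subst hpq
        have hε : δ = -ε := by
          rcases Int.units_eq_one_or ε with rfl | rfl <;>
            rcases Int.units_eq_one_or δ with rfl | rfl <;> simp_all
        rw [h3 β γ h h', hε]
      · rw [h2 β fun h'' => hpq (h.2.2.symm.trans h''.2.2),
          h2 γ fun h'' => hpq ((h.self_add h').2.2.symm.trans h''.2.2), mul_zero]

variable (hx : x.IsRegular)

include hx

/-- A vector of the part that also satisfies the complementary conditions vanishes because of an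
invertible scalar: `|α|` times the determinant for `e` and `halfVec`, `|α|` for constant vectors of
coordinate sum zero, and `θ_ε - θ_{-ε}` for the `ν`-parts. -/
lemma disjoint_part_complPart (f : Label) : Disjoint (x.part f) (x.complPart f) := by
  rw [Submodule.disjoint_def]
  intro v hv hv'
  have hdet := mul_ne_zero hx.card_ne_zero hx.det_ne_zero
  rcases f with _ | _ | _ | _ | ⟨p, ε⟩
  · obtain ⟨r, h1, h2, h3⟩ := coord_one hv
    replace hv' : _ = _ := hv'
    rw [torCoord_const h1, h2, if_pos rfl] at hv'
    have : ((hammingNorm x.word.1 : F) *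
      (CodeAlg.lam a x.word + 2 * x.μ ^ 2 * c x.word)) * r = 0 := by linear_combination hv'
    rw [h3, (mul_eq_zero.1 this).resolve_left hdet, zero_smul]
  · obtain ⟨h1, h2⟩ := coord_zero hv
    ext (i | β)
    · by_cases hi : x.word.1 i = 0
      · exact hv'.1 i hi
      · exact h1 i hi
    · by_cases hβ : β.1 = 1 + x.word.1
      · exact hv'.2 β hβ
      · exact h2 β hβ
  · obtain ⟨h1, h2, h3⟩ := coord_lam hv
    ext (i | β)
    · by_cases hi : x.word.1 i = 0
      · exact h1 i hi
      · rw [Finset.sum_congr rfl fun j hj => hv' j i (Finset.mem_filter.1 hj).2 hi,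
          Finset.sum_const, nsmul_eq_mul] at h3
        exact (mul_eq_zero.1 h3).resolve_left hx.card_ne_zero
    · exact h2 β
  · obtain ⟨r, h1, h2, h3⟩ := coord_half hv
    replace hv' : _ = _ := hv'
    rw [torCoord_const h1, h2, if_pos rfl] at hv'
    have : ((hammingNorm x.word.1 : F) *
      (CodeAlg.lam a x.word + 2 * x.μ ^ 2 * c x.word)) * r = 0 := by linear_combination hv'
    rw [h3, (mul_eq_zero.1 this).resolve_left hdet, zero_smul]
  · obtain ⟨h1, h2, h3⟩ := coord_nu hv
    ext (i | β)
    · exact h1 i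
    · by_cases h : InPartition x.word p β
      · obtain ⟨γ, hγ⟩ := h.exists_translate
        have e1 := h3 β γ h hγ
        have e2 := hv' β γ h hγ
        have e3 : v (Sum.inr γ) = 0 := by
          have : (x.θ (interCard x.word.1 β.1) ε - x.θ (interCard x.word.1 β.1) (-ε)) *
            v (Sum.inr γ) = 0 := by linear_combination e2 - e1
          exact (mul_eq_zero.1 this).resolve_left (sub_ne_zero.2 (theta_ne' h.1 h.2.1 ε))
        rw [e1, e3, mul_zero]; rfl
      · exact h2 β h

lemma iSupIndep_part : iSupIndep x.part :=
  iSupIndep_of_le_of_disjoint x.complPart (fun _ _ h => part_le_complPart h)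
    hx.disjoint_part_complPart

end IsRegular

end SmallIdem

end idem

section idem

variable {F : Type*} [Field F] {n : ℕ} {C : Submodule (ZMod 2) (Fin n → ZMod 2)}
  {P : Params F C} {a : F} {c : Cstar C → F}

/-! ## Conjugate words -/

lemma hammingNorm_of_mem_conjugates {α v : Fin n → ZMod 2} (h : v ∈ conjugates C α) :
    hammingNorm v = hammingNorm α := by
  obtain ⟨g, -, rfl⟩ := h
  exact hammingNorm_comp α g

lemma IsCodeAut.symm {g : Equiv.Perm (Fin n)} (h : IsCodeAut C g) : IsCodeAut C g.symm := by
  intro v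
  rw [← h (v ∘ g.symm)]
  simp [Function.comp_assoc]

/-- The coordinate permutation is packaged as an additive bijection of words; intersection numbers,
partitions and parities at a conjugate are all read off at `α` through it. -/
lemma exists_interCard_eq_of_mem_conjugates {α v : Fin n → ZMod 2} (h : v ∈ conjugates C α) :
    ∃ φ : (Fin n → ZMod 2) ≃+ (Fin n → ZMod 2), (∀ u, φ u ∈ C ↔ u ∈ C) ∧ φ v = α ∧ φ 1 = 1 ∧
      ∀ u, interCard α (φ u) = interCard v u := by
  obtain ⟨g, hg, rfl⟩ := h
  refine ⟨(LinearEquiv.funCongrLeft (ZMod 2) (ZMod 2) g.symm).toAddEquiv, fun u => ?_, ?_, rfl,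
    fun u => ?_⟩
  · exact hg.symm u
  · show (α ∘ g) ∘ g.symm = α
    simp [Function.comp_assoc]
  · show interCard α (u ∘ g.symm) = _
    rw [← interCard_comp α _ g]
    simp [Function.comp_assoc]

/-- Consequently the same labels occur for all members of `X`. -/
lemma InPartition.exists_of_mem_conjugates {α α' : Cstar C} (h : α'.1 ∈ conjugates C α.1)
    {p : Sym2 ℕ} : (∃ β, InPartition α' p β) ↔ ∃ β, InPartition α p β := by
  obtain ⟨φ, h1, h2, h3, h4⟩ := exists_interCard_eq_of_mem_conjugates h
  have hw := hammingNorm_of_mem_conjugates h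
  have key : ∀ u, (φ u ≠ α.1 ∧ φ u ≠ 1 + α.1 ∧ weightPartition α.1 (φ u) = p) ↔
      (u ≠ α'.1 ∧ u ≠ 1 + α'.1 ∧ weightPartition α'.1 u = p) := fun u => by
    have h5 : φ (1 + α'.1) = 1 + α.1 := by rw [map_add, h3, h2]
    rw [weightPartition_eq, weightPartition_eq, h4, hw, ← h5, φ.injective.ne_iff, ← h2,
      φ.injective.ne_iff]
  have h0 : ∀ u, (φ u ∈ C ∧ φ u ≠ 0 ∧ φ u ≠ 1) ↔ (u ∈ C ∧ u ≠ 0 ∧ u ≠ 1) := fun u => by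
    conv_lhs => rw [← h3]
    rw [h1, φ.injective.ne_iff, map_ne_zero_iff _ φ.injective]
  constructor
  · rintro ⟨β, hβ⟩
    exact ⟨⟨φ β.1, (h0 _).2 β.2⟩, (key _).2 hβ⟩
  · rintro ⟨β, hβ⟩
    obtain ⟨u, hu⟩ := φ.surjective β.1
    refine ⟨⟨u, (h0 u).1 ?_⟩, (key u).1 ?_⟩
    · rw [hu]; exact β.2
    · rw [hu]; exact hβ

namespace SmallIdem

lemma isRegular_of_mem_conjugates {α : Cstar C} (h2 : (2 : F) ≠ 0)
    (hchar : (hammingNorm α.1 : F) ≠ 0) (hP : IsNondegenerate P) (hreg : ParamsRegular P α a c)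
    (ha2 : a ≠ 1 / (2 * (hammingNorm α.1 : F))) (ha3 : 3 * (hammingNorm α.1 : F) * a ≠ 1)
    (x : SmallIdem P a c) (hx : x.word.1 ∈ conjugates C α.1) : x.IsRegular := by
  have hw := hammingNorm_of_mem_conjugates hx
  obtain ⟨-, -, hac, hb⟩ := hP
  obtain ⟨ra, rc, rb, rb'⟩ := hreg
  refine ⟨h2, by rwa [hw], ra, rc, fun p β γ => rb _ _ hx hx p β γ,
    fun p β γ δ hδ => rb' _ _ hx hx δ δ hδ hδ p β γ, ?_, fun β => ?_, hb, fun h => ha2 ?_,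
    fun h => ha3 ?_⟩
  · obtain ⟨i, hi⟩ := α.exists_ne_zero
    rw [← ra i α hi]
    exact (hac i α hi).1
  · obtain ⟨i, hi⟩ := β.exists_ne_zero
    rw [← rc i β hi]
    exact (hac i β hi).2
  · rw [hw] at h
    rw [eq_div_iff (mul_ne_zero h2 hchar)]
    linear_combination h
  · rw [hw] at h
    linear_combination h

variable {x : SmallIdem P a c}

namespace IsRegular

lemma halfVec_ne_zero : x.halfVec ≠ 0 := by
  intro h
  have := DFunLike.congr_fun h (Sum.inr x.word)
  rw [halfVec, Finsupp.sub_apply, Finsupp.smul_apply, torSum_inr, cw, Finsupp.single_eq_same] at this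
  simp at this

lemma nuVec_ne_zero {β γ : Cstar C} (hγ : γ.1 = x.word.1 + β.1) (ε : ℤˣ) :
    x.nuVec β γ ε ≠ 0 := by
  intro h
  have := DFunLike.congr_fun h (Sum.inr γ)
  have hβγ : β ≠ γ := fun e => by
    have := congr_arg Subtype.val e
    rw [hγ] at this
    exact x.word.2.2.1 (by simpa using this)
  simp [nuVec, cw, hβγ] at this

lemma part_nu_ne_bot_iff {p : Sym2 ℕ} {ε : ℤˣ} :
    x.part (Label.nu p ε) ≠ ⊥ ↔ ∃ β, InPartition x.word p β := by
  constructor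
  · intro h
    by_contra! hcon
    refine h (eq_bot_iff.2 (Submodule.span_le.2 ?_))
    rintro v ⟨β, γ, hβ, -⟩
    exact absurd hβ (hcon β)
  · rintro ⟨β, hβ⟩ h
    obtain ⟨γ, hγ⟩ := hβ.exists_translate
    have := nuVec_mem hβ hγ ε
    rw [h] at this
    exact nuVec_ne_zero hγ ε ((Submodule.mem_bot F).1 this)

lemma part_lamHalf_ne_bot : x.part Label.lamHalf ≠ ⊥ := fun h =>
  halfVec_ne_zero (x := x) ((Submodule.mem_bot F).1 (h ▸ halfVec_mem))

lemma part_zero_ne_bot : x.part Label.zero ≠ ⊥ := fun h => by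
  obtain ⟨i, hi⟩ := x.word.exists_eq_zero
  exact tor_ne_zero i ((Submodule.mem_bot F).1 (h ▸ tor_mem_zero (P := P) (x := x) hi))

lemma elt_ne_zero (hx : x.IsRegular) : x.elt ≠ 0 := by
  intro h
  have := DFunLike.congr_fun h (Sum.inr x.word)
  simp [elt, cw, torSum_inr, hx.mu_ne_zero] at this

lemma part_one_ne_bot (hx : x.IsRegular) : x.part Label.one ≠ ⊥ := fun h =>
  hx.elt_ne_zero ((Submodule.mem_bot F).1 (h ▸ elt_mem))

lemma tor_sub_tor_ne_zero {i j : Fin n} (h : i ≠ j) : tor F C i - tor F C j ≠ 0 := by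
  intro h'
  have := DFunLike.congr_fun h' (Sum.inl i)
  simp [tor, Ne.symm h] at this

lemma part_lam_ne_bot_iff : x.part Label.lam ≠ ⊥ ↔ 2 ≤ hammingNorm x.word.1 := by
  constructor
  · intro h
    by_contra hlt
    refine h (eq_bot_iff.2 (Submodule.span_le.2 ?_))
    rintro v ⟨j, k, hj, hk, rfl⟩
    have : (Finset.univ.filter fun i => x.word.1 i ≠ 0).card ≤ 1 := by
      rw [hammingNorm] at hlt; omega
    have := Finset.card_le_one.1 this j (by simpa using hj) k (by simpa using hk)
    subst this
    simp
  · intro h hbot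
    obtain ⟨j, hj, k, hk, hjk⟩ := Finset.one_lt_card.1 (show 1 <
      (Finset.univ.filter fun i => x.word.1 i ≠ 0).card from h)
    have := tor_sub_tor_mem (P := P) (x := x) (Finset.mem_filter.1 hj).2 (Finset.mem_filter.1 hk).2
    rw [hbot] at this
    exact tor_sub_tor_ne_zero hjk ((Submodule.mem_bot F).1 this)

end IsRegular

end SmallIdem

/-! ## Gradings by signs -/

/-- The words `0`, `1`, `α` and `1 + α`. -/
def IsTrivialWord (α v : Fin n → ZMod 2) : Prop := v = 0 ∨ v = 1 ∨ v = α ∨ v = 1 + α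

/-- The words declared to be even by a set of weight partitions. -/
def IsEvenWord (R : Set (Sym2 ℕ)) (α v : Fin n → ZMod 2) : Prop :=
  IsTrivialWord α v ∨ weightPartition α v ∈ R

/-- The sign of a label, where a set of weight partitions is declared to be even. -/
def Label.sign (R : Set (Sym2 ℕ)) : Label → ℤˣ
  | Label.nu p _ => if p ∈ R then 1 else -1
  | _ => 1

/-- The sign of a basis element. -/
def basisSign (R : Set (Sym2 ℕ)) (α : Fin n → ZMod 2) : Fin n ⊕ Cstar C → ℤˣ
  | Sum.inl _ => 1
  | Sum.inr β => if IsEvenWord R α β.1 then 1 else -1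

/-- The span of the basis elements with a given sign. -/
def signPart (F : Type*) [Field F] (C : Submodule (ZMod 2) (Fin n → ZMod 2)) (R : Set (Sym2 ℕ))
    (α : Fin n → ZMod 2) (s : ℤˣ) : Submodule F (Alg F C) :=
  Submodule.span F {v | ∃ i, basisSign R α i = s ∧ v = Finsupp.single i 1}

lemma tor_mem_signPart (R : Set (Sym2 ℕ)) (α : Fin n → ZMod 2) (i : Fin n) :
    tor F C i ∈ signPart F C R α 1 := Submodule.subset_span ⟨Sum.inl i, rfl, rfl⟩

lemma cw_mem_signPart (R : Set (Sym2 ℕ)) (α : Fin n → ZMod 2) (β : Cstar C) :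
    cw F β ∈ signPart F C R α (basisSign R α (Sum.inr β)) :=
  Submodule.subset_span ⟨Sum.inr β, rfl, rfl⟩

/-- The nonzero products of basis elements multiply signs: `t_i` fixes the line of `e^β`, the square
of `e^β` is a combination of the even elements `t_i`, and for `e^β e^γ` additivity of parity on `C`
is exactly what is needed. -/
lemma mul_mem_signPart {R : Set (Sym2 ℕ)} {α : Fin n → ZMod 2}
    (hG : ∀ β ∈ C, ∀ γ ∈ C, (IsEvenWord R α (β + γ) ↔ (IsEvenWord R α β ↔ IsEvenWord R α γ)))
    (s t : ℤˣ) {u v : Alg F C} (hu : u ∈ signPart F C R α s) (hv : v ∈ signPart F C R α t) :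
    mul P u v ∈ signPart F C R α (s * t) := by
  refine LinearMap.BilinMap.apply_apply_mem_of_mem_span _ _ _ (mul P) ?_ u v hu hv
  rintro _ ⟨i, rfl, rfl⟩ _ ⟨j, rfl, rfl⟩
  rw [mul_single]
  rcases i with i | β <;> rcases j with j | γ
  · simp only [basisMul]
    split_ifs
    · exact tor_mem_signPart R α i
    · exact zero_mem _
  · simp only [basisMul]
    split_ifs
    · exact Submodule.smul_mem _ _ ((one_mul (basisSign R α (Sum.inr γ))).symm ▸
        cw_mem_signPart R α γ)
    · exact zero_mem _
  · simp only [basisMul]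
    split_ifs
    · exact Submodule.smul_mem _ _ ((mul_one (basisSign R α (Sum.inr β))).symm ▸
        cw_mem_signPart R α β)
    · exact zero_mem _
  · simp only [basisMul]
    split_ifs with h h'
    · refine Submodule.smul_mem _ _ ?_
      have h1 := cw_mem_signPart (F := F) R α (⟨β.1 + γ.1, C.add_mem β.2.1 γ.2.1, h⟩ : Cstar C)
      convert h1 using 1
      have h2 := hG β.1 β.2.1 γ.1 γ.2.1
      simp only [basisSign]
      by_cases h3 : IsEvenWord R α β.1 <;> by_cases h4 : IsEvenWord R α γ.1 <;>
        simp [h2, h3, h4]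
    · subst h'
      rw [Int.units_mul_self]
      exact Submodule.sum_mem _ fun i _ => Submodule.smul_mem _ _ (tor_mem_signPart R α i)
    · exact zero_mem _

lemma basisSign_of_trivial {R : Set (Sym2 ℕ)} {α : Fin n → ZMod 2} {β : Cstar C}
    (h : IsTrivialWord α β.1) : basisSign R α (Sum.inr β) = 1 := if_pos (Or.inl h)

lemma basisSign_of_inPartition {R : Set (Sym2 ℕ)} {α β : Cstar C} {p : Sym2 ℕ}
    (h : InPartition α p β) (ε : ℤˣ) :
    basisSign R α.1 (Sum.inr β) = Label.sign R (Label.nu p ε) := by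
  have h' : ¬IsTrivialWord α.1 β.1 := by
    rintro (h' | h' | h' | h')
    · exact β.2.2.1 h'
    · exact β.2.2.2 h'
    · exact h.1 h'
    · exact h.2.1 h'
  simp [basisSign, Label.sign, IsEvenWord, h', h.2.2]

namespace SmallIdem

variable {x : SmallIdem P a c}

lemma part_le_signPart (R : Set (Sym2 ℕ)) (f : Label) :
    x.part f ≤ signPart F C R x.word.1 (Label.sign R f) := by
  have hw : cw F x.word ∈ signPart F C R x.word.1 1 := by
    have := cw_mem_signPart (F := F) R x.word.1 x.word
    rwa [basisSign_of_trivial (Or.inr (Or.inr (Or.inl rfl)))] at this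
  have ht : x.torSum ∈ signPart F C R x.word.1 1 :=
    Submodule.sum_mem _ fun i _ => tor_mem_signPart R x.word.1 i
  rcases f with _ | _ | _ | _ | ⟨p, ε⟩
  · exact (Submodule.span_singleton_le_iff_mem _ _).2 (Submodule.add_mem _
      (Submodule.smul_mem _ _ ht) (Submodule.smul_mem _ _ hw))
  · refine Submodule.span_le.2 ?_
    rintro v (⟨i, hi, rfl⟩ | ⟨γ, hγ, rfl⟩)
    · exact tor_mem_signPart R x.word.1 i
    · have := cw_mem_signPart (F := F) R x.word.1 γ
      rwa [basisSign_of_trivial (Or.inr (Or.inr (Or.inr hγ)))] at this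
  · refine Submodule.span_le.2 ?_
    rintro v ⟨j, k, hj, hk, rfl⟩
    exact Submodule.sub_mem _ (tor_mem_signPart R x.word.1 j) (tor_mem_signPart R x.word.1 k)
  · exact (Submodule.span_singleton_le_iff_mem _ _).2 (Submodule.sub_mem _
      (Submodule.smul_mem _ _ ht) hw)
  · refine Submodule.span_le.2 ?_
    rintro v ⟨β, γ, hβ, hγ, rfl⟩
    have h1 := cw_mem_signPart (F := F) R x.word.1 β
    have h2 := cw_mem_signPart (F := F) R x.word.1 γ
    rw [basisSign_of_inPartition hβ ε] at h1
    rw [basisSign_of_inPartition (hβ.self_add hγ) ε] at h2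
    exact Submodule.add_mem _ (Submodule.smul_mem _ _ h1) h2

/-- The change back from eigenvectors to basis elements happens inside the blocks, and each block
lies in one sign: `β` and `α + β` have the same partition, and everything built from the `t_i`,
`e^α` and `e^{α^c}` is even. -/
lemma IsRegular.signPart_le (hx : x.IsRegular) (R : Set (Sym2 ℕ)) (s : ℤˣ) :
    signPart F C R x.word.1 s ≤ ⨆ f ∈ {f | Label.sign R f = s}, x.part f := by
  have hle : ∀ f, Label.sign R f = s → x.part f ≤ ⨆ f ∈ {f | Label.sign R f = s}, x.part f :=
    fun f hf => le_iSup₂ (f := fun f (_ : f ∈ {f | Label.sign R f = s}) => x.part f) f hf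
  refine Submodule.span_le.2 ?_
  rintro _ ⟨i | β, rfl, rfl⟩
  · have he := hle _ rfl (IsRegular.elt_mem (x := x))
    have hh := hle _ rfl (IsRegular.halfVec_mem (x := x))
    by_cases hi : x.word.1 i = 0
    · exact hle _ rfl (IsRegular.tor_mem_zero hi)
    · exact hx.tor_mem (hx.torSum_mem he hh) (hle _ rfl) hi
  · by_cases h : β.1 = x.word.1
    · obtain rfl := Cstar.ext h
      have h1 := basisSign_of_trivial (R := R) (α := x.word.1) (β := x.word)
        (Or.inr (Or.inr (Or.inl rfl)))
      exact hx.cw_word_mem (hle Label.one h1.symm IsRegular.elt_mem)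
        (hle Label.lamHalf h1.symm IsRegular.halfVec_mem)
    · by_cases h' : β.1 = 1 + x.word.1
      · have h1 := basisSign_of_trivial (R := R) (α := x.word.1) (β := β)
          (Or.inr (Or.inr (Or.inr h')))
        exact hle Label.zero h1.symm (IsRegular.compl_mem_zero h')
      · have h0 : InPartition x.word _ β := ⟨h, h', rfl⟩
        exact IsRegular.cw_mem_of_part_le h0 fun ε => hle _ (basisSign_of_inPartition h0 ε).symm

end SmallIdem

open SmallIdem

lemma idemLaw_carrier_inter (X : Set (SmallIdem P a c)) {x : SmallIdem P a c} (hx : x ∈ X)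
    (Q : Set Label) : x.sumPart ((idemLaw X).carrier ∩ Q) = x.sumPart Q :=
  iSup_inter_carrier (mul P) (fun x : X => x.1.part) ⟨x, hx⟩ Q

lemma isGrading_sign (X : Set (SmallIdem P a c)) (hX : ∀ x ∈ X, x.IsRegular) (R : Set (Sym2 ℕ))
    (hG : ∀ x ∈ X, ∀ β ∈ C, ∀ γ ∈ C, (IsEvenWord R x.word.1 (β + γ) ↔
      (IsEvenWord R x.word.1 β ↔ IsEvenWord R x.word.1 γ))) :
    (idemLaw X).IsGrading fun s => (idemLaw X).carrier ∩ {f | Label.sign R f = s} := by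
  refine isGrading_of_subspaces (mul P) (fun x : X => x.1.part) _ (fun x f _ => ⟨_, rfl⟩) ?_
    (fun x s => signPart F C R x.1.word.1 s) ?_ ?_ ?_
  · intro s t hst
    rw [Set.disjoint_left]
    exact fun f (hs : _ = _) (ht : _ = _) => hst (hs.symm.trans ht)
  · rintro x s f (rfl : _ = _)
    exact part_le_signPart R f
  · exact fun x s => (hX x.1 x.2).signPart_le R s
  · exact fun x s t u hu v hv => mul_mem_signPart (hG x.1 x.2) s t hu hv

lemma sumPart_sign_one (x : SmallIdem P a c) (R : Set (Sym2 ℕ)) :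
    x.sumPart {f | Label.sign R f = 1} = x.part Label.one ⊔ x.part Label.zero ⊔ x.part Label.lam ⊔
      x.part Label.lamHalf ⊔ ⨆ p ∈ R, ⨆ ε : ℤˣ, x.part (Label.nu p ε) := by
  refine le_antisymm (iSup₂_le ?_) (sup_le (sup_le (sup_le (sup_le ?_ ?_) ?_) ?_)
    (iSup₂_le fun p hp => iSup_le fun ε => ?_))
  · rintro (_ | _ | _ | _ | ⟨p, ε⟩) hf
    · exact le_sup_of_le_left (le_sup_of_le_left (le_sup_of_le_left le_sup_left))
    · exact le_sup_of_le_left (le_sup_of_le_left (le_sup_of_le_left le_sup_right))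
    · exact le_sup_of_le_left (le_sup_of_le_left le_sup_right)
    · exact le_sup_of_le_left le_sup_right
    · have hp : p ∈ R := by
        by_contra h
        have hf' : Label.sign R (Label.nu p ε) = 1 := hf
        simp [Label.sign, h] at hf'
      exact le_sup_of_le_right (le_iSup₂_of_le p hp (le_iSup_of_le ε le_rfl))
  · exact le_iSup₂_of_le Label.one rfl le_rfl
  · exact le_iSup₂_of_le Label.zero rfl le_rfl
  · exact le_iSup₂_of_le Label.lam rfl le_rfl
  · exact le_iSup₂_of_le Label.lamHalf rfl le_rfl
  · exact le_iSup₂_of_le (Label.nu p ε) (if_pos hp) le_rfl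

lemma sumPart_sign_neg_one (x : SmallIdem P a c) (R : Set (Sym2 ℕ)) :
    x.sumPart {f | Label.sign R f = -1} = ⨆ p ∈ Rᶜ, ⨆ ε : ℤˣ, x.part (Label.nu p ε) := by
  refine le_antisymm (iSup₂_le ?_) (iSup₂_le fun p hp => iSup_le fun ε => ?_)
  · rintro (_ | _ | _ | _ | ⟨p, ε⟩) hf
    · exact absurd (show (1 : ℤˣ) = -1 from hf) (by decide)
    · exact absurd (show (1 : ℤˣ) = -1 from hf) (by decide)
    · exact absurd (show (1 : ℤˣ) = -1 from hf) (by decide)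
    · exact absurd (show (1 : ℤˣ) = -1 from hf) (by decide)
    · have hp : p ∈ Rᶜ := by
        intro h
        have hf' : Label.sign R (Label.nu p ε) = -1 := hf
        simp [Label.sign, h] at hf'
      exact le_iSup₂_of_le p hp (le_iSup_of_le ε le_rfl)
  · exact le_iSup₂_of_le (Label.nu p ε) (if_neg hp) le_rfl

end idem

/-! ### Which parts a sign grading forces to be even. -/

section idem

variable {F : Type*} [Field F] {n : ℕ} {C : Submodule (ZMod 2) (Fin n → ZMod 2)}
  {P : Params F C} {a : F} {c : Cstar C → F}

namespace SmallIdem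

/-- Two independent subspaces which multiply like signs, and of which one contains any given
part. -/
structure IsSignGrading (x : SmallIdem P a c) (S : ℤˣ → Submodule F (Alg F C)) : Prop where
  disjoint : Disjoint (S 1) (S (-1))
  mul_mem : ∀ s t, ∀ u ∈ S s, ∀ v ∈ S t, mul P u v ∈ S (s * t)
  part_le : ∀ f, ∃ s, x.part f ≤ S s

lemma isSignGrading_of_isGrading {X : Set (SmallIdem P a c)} (hX : ∀ x ∈ X, x.IsRegular)
    {p : ℤˣ → Set Label} (hp : (idemLaw X).IsGrading p) {x : SmallIdem P a c} (hx : x ∈ X) :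
    x.IsSignGrading fun s => x.sumPart (p s) := by
  have h := (isGrading_iff (mul P) (fun x : X => x.1.part)
    (fun x => (hX x.1 x.2).iSupIndep_part) (fun x => (hX x.1 x.2).iSup_part) p).1 hp
  refine ⟨disjoint_iSup_of_disjoint (hX x hx).iSupIndep_part (h.2.1 1 (-1) (by decide)),
    fun s t => h.2.2 ⟨x, hx⟩ s t, fun f => ?_⟩
  by_cases hf : x.part f = ⊥
  · exact ⟨1, hf ▸ bot_le⟩
  · have : f ∈ ⋃ t, p t := by rw [h.1]; exact ⟨⟨x, hx⟩, hf⟩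
    obtain ⟨s, hs⟩ := Set.mem_iUnion.1 this
    exact ⟨s, le_iSup₂ (f := fun f (_ : f ∈ p s) => x.part f) f hs⟩

namespace IsSignGrading

variable {x : SmallIdem P a c} {S : ℤˣ → Submodule F (Alg F C)} (h : x.IsSignGrading S)

include h

lemma sign_unique {v : Alg F C} (hv : v ≠ 0) {s t : ℤˣ} (hs : v ∈ S s) (ht : v ∈ S t) :
    s = t := by
  by_contra hst
  apply hv
  rcases Int.units_eq_one_or s with rfl | rfl <;> rcases Int.units_eq_one_or t with rfl | rfl
  · exact absurd rfl hst
  · exact Submodule.disjoint_def.1 h.disjoint v hs ht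
  · exact Submodule.disjoint_def.1 h.disjoint v ht hs
  · exact absurd rfl hst

lemma mul_mem_one {s : ℤˣ} {u v : Alg F C} (hu : u ∈ S s) (hv : v ∈ S s) : mul P u v ∈ S 1 := by
  have := h.mul_mem s s u hu v hv
  rwa [Int.units_mul_self] at this

lemma part_le_of_mem {f : Label} {v : Alg F C} (hv : v ≠ 0) (hvf : v ∈ x.part f) {s : ℤˣ}
    (hs : v ∈ S s) : x.part f ≤ S s := by
  obtain ⟨t, ht⟩ := h.part_le f
  rwa [h.sign_unique hv hs (ht hvf)]

/-- A homogeneous idempotent equals its own square, which is even. -/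
lemma elt_mem (hx : x.IsRegular) : x.elt ∈ S 1 := by
  obtain ⟨s, hs⟩ := h.part_le Label.one
  have := h.mul_mem_one (hs IsRegular.elt_mem) (hs IsRegular.elt_mem)
  rwa [hx.elt_mul_self] at this

/-- As `α ≠ 1`, this part contains a nonzero idempotent `t_i`. -/
lemma part_zero_le : x.part Label.zero ≤ S 1 := by
  obtain ⟨s, hs⟩ := h.part_le Label.zero
  obtain ⟨i, hi⟩ := x.word.exists_eq_zero
  have h1 := IsRegular.tor_mem_zero (P := P) hi
  have h2 := h.mul_mem_one (hs h1) (hs h1)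
  rw [mul_tor_tor, if_pos rfl] at h2
  exact h.part_le_of_mem (tor_ne_zero i) h1 h2

/-- With three points in the support, `(t_i - t_j)(t_i - t_k) = t_i` is a product of two vectors of
the same sign, hence even; so are differences of such elements. -/
lemma part_lam_le (hw : 3 ≤ hammingNorm x.word.1) : x.part Label.lam ≤ S 1 := by
  obtain ⟨s, hs⟩ := h.part_le Label.lam
  obtain ⟨i, hi, j, hj, k, hk, hij, hik, hjk⟩ := Finset.two_lt_card.1 (show 2 <
      (Finset.univ.filter fun i => x.word.1 i ≠ 0).card from hw)
  simp only [Finset.mem_filter, Finset.mem_univ, true_and] at hi hj hk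
  have key : ∀ {i j k : Fin n}, x.word.1 i ≠ 0 → x.word.1 j ≠ 0 → x.word.1 k ≠ 0 → i ≠ j → i ≠ k →
      j ≠ k → tor F C i ∈ S 1 := fun {i j k} hi hj hk hij hik hjk => by
    have := h.mul_mem_one (hs (IsRegular.tor_sub_tor_mem hi hj))
      (hs (IsRegular.tor_sub_tor_mem hi hk))
    simpa [mul_tor_tor, hij, hik, hjk, hij.symm] using this
  exact h.part_le_of_mem (IsRegular.tor_sub_tor_ne_zero hij) (IsRegular.tor_sub_tor_mem hi hj)
    (Submodule.sub_mem _ (key hi hj hk hij hik hjk) (key hj hi hk hij.symm hjk hik))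

/-- In the product of `halfVec` with `t_j - t_k` the contributions of `e^α` cancel, and `t_α` acts
as the identity. So `halfVec` maps a nonzero homogeneous vector to a nonzero multiple of itself. -/
lemma part_lamHalf_le (hx : x.IsRegular) (hw : 2 ≤ hammingNorm x.word.1) :
    x.part Label.lamHalf ≤ S 1 := by
  obtain ⟨s, hs⟩ := h.part_le Label.lamHalf
  obtain ⟨t, ht⟩ := h.part_le Label.lam
  obtain ⟨j, hj, k, hk, hjk⟩ := Finset.one_lt_card.1 (show 1 <
      (Finset.univ.filter fun i => x.word.1 i ≠ 0).card from hw)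
  simp only [Finset.mem_filter, Finset.mem_univ, true_and] at hj hk
  have h1 := ht (IsRegular.tor_sub_tor_mem hj hk)
  have h2 := h.mul_mem _ _ _ (hs IsRegular.halfVec_mem) _ h1
  have h3 : mul P x.halfVec (tor F C j - tor F C k) =
      (2 * x.μ * c x.word) • (tor F C j - tor F C k) := by
    simp only [halfVec, map_sub, map_smul, LinearMap.sub_apply, LinearMap.smul_apply,
      IsRegular.torSum_mul_tor, mul_comm' P (cw F x.word), hx.tor_mul_cw, if_pos hj, if_pos hk,
      smul_sub]
    abel
  have h4 : 2 * x.μ * c x.word ≠ 0 :=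
    mul_ne_zero (mul_ne_zero hx.two_ne_zero hx.mu_ne_zero) (hx.c_ne_zero _)
  rw [h3, Submodule.smul_mem_iff _ h4] at h2
  have h5 := h.sign_unique (IsRegular.tor_sub_tor_ne_zero hjk) h1 h2
  have h6 : s = 1 := right_eq_mul.1 h5
  rwa [h6] at hs

omit h in
lemma halfVec_mul_self (hx : x.IsRegular) : mul P x.halfVec x.halfVec =
    (c x.word * (4 * x.μ ^ 2 * c x.word + 1)) • x.torSum -
      (4 * x.μ * c x.word * a * (hammingNorm x.word.1 : F)) • cw F x.word := by
  simp only [halfVec, map_sub, map_smul, LinearMap.sub_apply, LinearMap.smul_apply,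
    IsRegular.torSum_mul_torSum, hx.torSum_mul_cw_word, hx.cw_word_mul_torSum, hx.cw_word_mul_self]
  module

/-- The square of `halfVec` is even and `e` is even, so if `halfVec` is odd, its coefficient in its
own square must vanish. This is an equation for `λ` whose only admissible root is `-1/2`. -/
lemma card_eq_of_halfVec_mem (hx : x.IsRegular) (hf : x.halfVec ∈ S (-1)) :
    a * (hammingNorm x.word.1 : F) = -1 := by
  have h1 := h.mul_mem_one hf hf
  have he := h.elt_mem hx
  rw [halfVec_mul_self hx, hx.torSum_eq, hx.cw_word_eq] at h1
  set A := c x.word * (4 * x.μ ^ 2 * c x.word + 1)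
  set B := 4 * x.μ * c x.word * a * (hammingNorm x.word.1 : F)
  set D := CodeAlg.lam a x.word + 2 * x.μ ^ 2 * c x.word
  -- Removing the `e`-component leaves the multiple of `halfVec` in its square.
  have h2 : (A * D⁻¹ * x.μ + B * D⁻¹ * CodeAlg.lam a x.word) • x.halfVec ∈ S 1 := by
    have := Submodule.sub_mem _ h1
      (Submodule.smul_mem _ (A * D⁻¹ - B * D⁻¹ * (2 * x.μ * c x.word)) he)
    convert this using 1
    module
  have h3 : A * D⁻¹ * x.μ + B * D⁻¹ * CodeAlg.lam a x.word = 0 := by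
    by_contra h0
    rw [Submodule.smul_mem_iff _ h0] at h2
    exact absurd (h.sign_unique IsRegular.halfVec_ne_zero h2 hf) (by decide)
  have h4 : D⁻¹ * (c x.word * (x.μ * (4 * x.μ ^ 2 * c x.word + 1 +
      4 * a * (hammingNorm x.word.1 : F) * CodeAlg.lam a x.word))) = 0 := by
    linear_combination h3
  have h5 := (mul_eq_zero.1 ((mul_eq_zero.1 ((mul_eq_zero.1 h4).resolve_left
    (inv_ne_zero hx.det_ne_zero))).resolve_left (hx.c_ne_zero _))).resolve_left hx.mu_ne_zero
  have h6 := hx.lam_mul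
  have h7 := hx.mu_sq_mul
  -- The remaining factor is `4(λ - λ²) + 3 = (3 - 2λ)(1 + 2λ)`, and `D = λ(3 - 2λ)`.
  have h8 : D * (1 + 2 * CodeAlg.lam a x.word) = 0 := by
    linear_combination CodeAlg.lam a x.word * h5 + (2 * (1 + 2 * CodeAlg.lam a x.word) -
      4 * CodeAlg.lam a x.word) * h7 - 2 * CodeAlg.lam a x.word * h6
  have h9 := (mul_eq_zero.1 h8).resolve_left hx.det_ne_zero
  linear_combination a * (hammingNorm x.word.1 : F) * h9 - h6

/-- For `i` in the support of `α`, exactly one of `β` and `α + β` contains `i`, so the even element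
`t_i` isolates one of the two terms of the eigenvector. A single `ν^p_ε` already determines the sign
of all `e^β` with partition `p`, so `ν^p_+` and `ν^p_-` get the same sign. -/
lemma cw_mem_of_part_nu_le (hx : x.IsRegular) {i : Fin n} (hi : x.word.1 i ≠ 0)
    (ht : tor F C i ∈ S 1) {p : Sym2 ℕ} {ε s : ℤˣ} (hs : x.part (Label.nu p ε) ≤ S s)
    {β : Cstar C} (hβ : InPartition x.word p β) : cw F β ∈ S s := by
  obtain ⟨γ, hγ⟩ := hβ.exists_translate
  have h1 := hs (IsRegular.nuVec_mem hβ hγ ε)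
  have h2 := h.mul_mem _ _ _ ht _ h1
  have hθ := IsRegular.theta_ne_zero (x := x) hβ.1 hβ.2.1 ε
  rw [one_mul, nuVec, map_add, map_smul, hx.tor_mul_cw, hx.tor_mul_cw, hγ] at h2
  have h3 : (x.word.1 + β.1) i ≠ 0 ↔ β.1 i = 0 := zmod_two_add_ne_zero hi
  by_cases hb : β.1 i = 0
  · rw [if_neg (not_not.2 hb), if_pos (h3.2 hb), smul_zero, zero_add,
      Submodule.smul_mem_iff _ hx.a_ne_zero] at h2
    have h4 := Submodule.sub_mem _ h1 h2
    rwa [nuVec, add_sub_cancel_right, Submodule.smul_mem_iff _ hθ] at h4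
  · rw [if_pos hb, if_neg (fun h' => hb (h3.1 h')), add_zero, Submodule.smul_mem_iff _ hθ,
      Submodule.smul_mem_iff _ hx.a_ne_zero] at h2
    exact h2

/-- Here `A_λ` is zero and the argument with `t_j - t_k` is not available. If `halfVec` were odd, it
would reverse the signs of both `ν_+` and `ν_-`; whether these signs agree or differ, comparing
coefficients of `e^β` and `e^γ` gives a contradiction. -/
lemma halfVec_mem_one (hx : x.IsRegular) (hw : hammingNorm x.word.1 = 1) {p : Sym2 ℕ}
    {β₀ : Cstar C} (hβ₀ : InPartition x.word p β₀) : x.part Label.lamHalf ≤ S 1 := by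
  obtain ⟨t, ht⟩ := h.part_le Label.lamHalf
  rcases Int.units_eq_one_or t with rfl | rfl
  · exact ht
  exfalso
  have hf := ht IsRegular.halfVec_mem
  -- Since `|α| = 1`, exactly one word of the pair is disjoint from `α`; it is called `β`.
  obtain ⟨β, γ, hβ, hγ, hk, hk'⟩ : ∃ β γ : Cstar C, InPartition x.word p β ∧
      γ.1 = x.word.1 + β.1 ∧ interCard x.word.1 β.1 = 0 ∧ interCard x.word.1 γ.1 = 1 := by
    obtain ⟨γ₀, hγ₀⟩ := hβ₀.exists_translate
    have h1 := interCard_add x.word.1 β₀.1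
    rw [← hγ₀, hw] at h1
    by_cases h0 : interCard x.word.1 β₀.1 = 0
    · exact ⟨β₀, γ₀, hβ₀, hγ₀, h0, by omega⟩
    · exact ⟨γ₀, β₀, hβ₀.self_add hγ₀, by rw [hγ₀, word_add_cancel], by omega, by omega⟩
  have hβγ : β.1 = x.word.1 + γ.1 := by rw [hγ, word_add_cancel]
  have hb := hx.b_word_ne_zero hβ.1 hβ.2.1
  have hmul : ∀ ε, mul P x.halfVec (x.nuVec β γ ε) = (2 * x.μ * c x.word * a) • cw F γ -
      P.b x.word β • (x.θ (interCard x.word.1 β.1) ε • cw F γ + cw F β) := fun ε => by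
    simp only [halfVec, nuVec, map_sub, map_add, map_smul, LinearMap.sub_apply,
      LinearMap.smul_apply, hx.torSum_mul_cw, mul_cw_cw P hγ, mul_cw_cw P hβγ,
      hx.b_translate hβ.1 hβ.2.1 hγ, hk, hk']
    push_cast
    module
  choose s hs using fun ε => h.part_le (Label.nu p ε)
  have hv : ∀ ε, x.nuVec β γ ε ∈ S (s ε) := fun ε => hs ε (IsRegular.nuVec_mem hβ hγ ε)
  have hm : ∀ ε, mul P x.halfVec (x.nuVec β γ ε) ∈ S (-s ε) := fun ε => by
    have := h.mul_mem _ _ _ hf _ (hv ε)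
    rwa [neg_one_mul] at this
  -- If `ν_{-ε}` and `e^γ` both lie in the sign opposite to that of `ν_ε`, then so does `e^β`, and
  -- therefore `ν_ε` itself.
  have hγ0 : ∀ ε, cw F γ ∈ S (-s ε) → s (-ε) = -s ε → False := fun ε hγS he => by
    have h1 := hv (-ε)
    rw [he] at h1
    have h2 := Submodule.sub_mem _ h1 hγS
    rw [nuVec, add_sub_cancel_right,
      Submodule.smul_mem_iff _ (IsRegular.theta_ne_zero hβ.1 hβ.2.1 _)] at h2
    have h3 : x.nuVec β γ ε ∈ S (-s ε) := Submodule.add_mem _ (Submodule.smul_mem _ _ h2) hγS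
    have h4 := h.sign_unique (IsRegular.nuVec_ne_zero hγ ε) (hv ε) h3
    exact absurd h4 (units_ne_neg_self _)
  by_cases he : s (-1) = s 1
  · have hall : ∀ ε, x.nuVec β γ ε ∈ S (s 1) := fun ε => by
      rcases Int.units_eq_one_or ε with rfl | rfl
      · exact hv 1
      · exact he ▸ hv (-1)
    have hβS : cw F β ∈ S (s 1) := IsRegular.cw_mem hβ.1 hβ.2.1 hall
    have hγS : cw F γ ∈ S (s 1) := by
      have := Submodule.sub_mem _ (hv 1)
        (Submodule.smul_mem _ (x.θ (interCard x.word.1 β.1) 1) hβS)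
      rwa [nuVec, add_sub_cancel_left] at this
    have h1 : mul P x.halfVec (x.nuVec β γ 1) ∈ S (s 1) := by
      rw [hmul]
      exact Submodule.sub_mem _ (Submodule.smul_mem _ _ hγS) (Submodule.smul_mem _ _
        (Submodule.add_mem _ (Submodule.smul_mem _ _ hγS) hβS))
    -- With equal signs the product lies in `S (s 1)` and in the opposite component, so it is zero;
    -- but its `e^β` coefficient is `-b`.
    have h2 : mul P x.halfVec (x.nuVec β γ 1) = 0 := by
      by_contra h0
      exact units_ne_neg_self _ (h.sign_unique h0 h1 (hm 1))
    rw [hmul] at h2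
    have h3 := DFunLike.congr_fun h2 (Sum.inr β)
    have h4 : γ ≠ β := fun e => by rw [e, hk] at hk'; exact zero_ne_one hk'
    simp [cw, h4, hb] at h3
  · have he' : ∀ ε, s (-ε) = -s ε := fun ε => by
      rcases Int.units_eq_one_or ε with rfl | rfl
      · exact Int.units_ne_iff_eq_neg.1 he
      · rw [neg_neg]; exact Int.units_ne_iff_eq_neg.1 (Ne.symm he)
    -- With opposite signs, the product with `ν_ε` lies in the component of `ν_{-ε}`. Subtracting
    -- `bθ_ε ν_{-ε}` removes `e^β` because `θ_ε θ_{-ε} = -1`, and leaves `2(μca - bθ_ε) e^γ`, which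
    -- must be zero. This cannot hold for two different roots.
    have hzero : ∀ ε, x.μ * c x.word * a = P.b x.word β * x.θ (interCard x.word.1 β.1) ε := by
      intro ε
      by_contra h0
      refine hγ0 ε ?_ (he' ε)
      have hθ := IsRegular.theta_mul' (x := x) hβ.1 hβ.2.1 ε
      have h1 := hv (-ε)
      rw [he'] at h1
      have h2 := Submodule.sub_mem _ (hm ε) (Submodule.smul_mem _
        (P.b x.word β * x.θ (interCard x.word.1 β.1) ε) h1)
      have h3 : mul P x.halfVec (x.nuVec β γ ε) -
          (P.b x.word β * x.θ (interCard x.word.1 β.1) ε) • x.nuVec β γ (-ε) =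
          (2 * (x.μ * c x.word * a - P.b x.word β * x.θ (interCard x.word.1 β.1) ε)) •
            cw F γ := by
        rw [hmul, nuVec]
        linear_combination (norm := module) (-P.b x.word β * hθ) • cw F β
      rwa [h3, Submodule.smul_mem_iff _ (mul_ne_zero hx.two_ne_zero (sub_ne_zero.2 h0))] at h2
    have h1 := (hzero 1).symm.trans (hzero (-1))
    exact x.theta_ne β hβ.1 hβ.2.1 (mul_left_cancel₀ hb h1)

end IsSignGrading

end SmallIdem

end idem

section idem

variable {F : Type*} [Field F] {n : ℕ} {C : Submodule (ZMod 2) (Fin n → ZMod 2)}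
  {P : Params F C} {a : F} {c : Cstar C → F}

/-! ## Even words -/

lemma IsTrivialWord.add {α u v : Fin n → ZMod 2} (hu : IsTrivialWord α u)
    (hv : IsTrivialWord α v) : IsTrivialWord α (u + v) := by
  have h1 : α + (1 + α) = 1 := by rw [add_comm, add_assoc, word_add_self, add_zero]
  have h2 : 1 + α + α = 1 := by rw [add_assoc, word_add_self, add_zero]
  have h3 : 1 + α + 1 = α := by rw [add_comm, word_add_cancel]
  unfold IsTrivialWord at *
  rcases hu with hu | hu | hu | hu <;> rcases hv with hv | hv | hv | hv <;>
    simp [hu, hv, word_add_self, h1, h2, h3, add_comm α 1, word_add_cancel]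

lemma weightPartition_add_of_trivial {α u : Fin n → ZMod 2} (hu : IsTrivialWord α u)
    (v : Fin n → ZMod 2) : weightPartition α (u + v) = weightPartition α v := by
  rcases hu with rfl | rfl | rfl | rfl
  · rw [zero_add]
  · exact weightPartition_one_add α v
  · exact weightPartition_self_add _ v
  · rw [add_assoc, weightPartition_one_add, weightPartition_self_add]

lemma isEvenWord_add_of_trivial {R : Set (Sym2 ℕ)} {α u : Fin n → ZMod 2}
    (hu : IsTrivialWord α u) (v : Fin n → ZMod 2) :
    IsEvenWord R α (u + v) ↔ IsEvenWord R α v := by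
  unfold IsEvenWord
  rw [weightPartition_add_of_trivial hu]
  refine or_congr ⟨fun h => ?_, fun h => hu.add h⟩ Iff.rfl
  have := hu.add h
  rwa [word_add_cancel] at this

/-- The even words of the code form a subgroup of index at most two. -/
def IsEvenSplit (C : Submodule (ZMod 2) (Fin n → ZMod 2)) (R : Set (Sym2 ℕ))
    (α : Fin n → ZMod 2) : Prop :=
  ∀ β ∈ C, ∀ γ ∈ C, (IsEvenWord R α (β + γ) ↔ (IsEvenWord R α β ↔ IsEvenWord R α γ))

/-- Products in the algebra carry information only for nontrivial words whose sum is neither `0` nor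
`1`. The remaining cases are automatic, as adding a trivial word does not change parity. -/
lemma isEvenSplit_of_nontrivial {R : Set (Sym2 ℕ)} {α : Fin n → ZMod 2}
    (h : ∀ β ∈ C, ∀ γ ∈ C, ¬IsTrivialWord α β → ¬IsTrivialWord α γ → β + γ ≠ 0 → β + γ ≠ 1 →
      (IsEvenWord R α (β + γ) ↔ (IsEvenWord R α β ↔ IsEvenWord R α γ))) :
    IsEvenSplit C R α := by
  intro β hβ γ hγ
  by_cases h1 : IsTrivialWord α β
  · rw [isEvenWord_add_of_trivial h1]
    exact (iff_true_left (Or.inl h1)).symm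
  by_cases h2 : IsTrivialWord α γ
  · rw [add_comm, isEvenWord_add_of_trivial h2]
    exact (iff_true_right (Or.inl h2)).symm
  have key : ∀ u : Fin n → ZMod 2, IsTrivialWord α u → β + γ = u →
      (IsEvenWord R α (β + γ) ↔ (IsEvenWord R α β ↔ IsEvenWord R α γ)) := by
    rintro u hu rfl
    have h3 : IsEvenWord R α (β + γ) := Or.inl hu
    have h4 := isEvenWord_add_of_trivial (R := R) hu γ
    rw [add_assoc, word_add_self, add_zero] at h4
    exact iff_of_true h3 h4
  by_cases h3 : β + γ = 0
  · exact key 0 (Or.inl rfl) h3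
  by_cases h4 : β + γ = 1
  · exact key 1 (Or.inr (Or.inl rfl)) h4
  exact h β hβ γ hγ h1 h2 h3 h4

lemma isEvenWord_comap {R : Set (Sym2 ℕ)} {α v : Fin n → ZMod 2}
    {φ : (Fin n → ZMod 2) ≃+ (Fin n → ZMod 2)} (hw : hammingNorm v = hammingNorm α)
    (h2 : φ v = α) (h3 : φ 1 = 1) (h4 : ∀ u, interCard α (φ u) = interCard v u)
    (u : Fin n → ZMod 2) : IsEvenWord R α (φ u) ↔ IsEvenWord R v u := by
  have h5 : φ (1 + v) = 1 + α := by rw [map_add, h3, h2]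
  unfold IsEvenWord IsTrivialWord
  have h6 : φ u = α ↔ u = v := by rw [← h2, φ.injective.eq_iff]
  have h7 : φ u = 1 ↔ u = 1 := by conv_lhs => rw [← h3, φ.injective.eq_iff]
  rw [weightPartition_eq, weightPartition_eq, h4, hw, ← h5, φ.injective.eq_iff, h6, h7,
    map_eq_zero_iff φ φ.injective]

/-- Parity is defined through `α`, `1` and intersection numbers, all of which are transported by a
code automorphism. -/
lemma isEvenSplit_conjugate_iff {R : Set (Sym2 ℕ)} {α v : Fin n → ZMod 2}
    (h : v ∈ conjugates C α) : IsEvenSplit C R v ↔ IsEvenSplit C R α := by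
  obtain ⟨φ, h1, h2, h3, h4⟩ := exists_interCard_eq_of_mem_conjugates h
  have key := isEvenWord_comap (R := R) (hammingNorm_of_mem_conjugates h) h2 h3 h4
  constructor
  · intro hs β hβ γ hγ
    obtain ⟨u, rfl⟩ := φ.surjective β
    obtain ⟨w, rfl⟩ := φ.surjective γ
    rw [← map_add, key, key, key]
    exact hs u ((h1 u).1 hβ) w ((h1 w).1 hγ)
  · intro hs β hβ γ hγ
    rw [← key, ← key, ← key, map_add]
    exact hs _ ((h1 β).2 hβ) _ ((h1 γ).2 hγ)

lemma not_isTrivialWord {α β : Cstar C} {p : Sym2 ℕ} (h : InPartition α p β) :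
    ¬IsTrivialWord α.1 β.1 := by
  rintro (h' | h' | h' | h')
  · exact β.2.2.1 h'
  · exact β.2.2.2 h'
  · exact h.1 h'
  · exact h.2.1 h'

namespace SmallIdem

lemma part_ne_bot_of_conjugate {α : Cstar C} {x y : SmallIdem P a c} (hx : x.IsRegular)
    (hxα : x.word.1 ∈ conjugates C α.1) (hyα : y.word.1 ∈ conjugates C α.1) {f : Label}
    (hf : y.part f ≠ ⊥) : x.part f ≠ ⊥ := by
  rcases f with _ | _ | _ | _ | ⟨p, ε⟩
  · exact hx.part_one_ne_bot
  · exact IsRegular.part_zero_ne_bot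
  · rw [IsRegular.part_lam_ne_bot_iff, hammingNorm_of_mem_conjugates] at *
    · exact hf
    · exact hyα
    · exact hxα
  · exact IsRegular.part_lamHalf_ne_bot
  · rw [IsRegular.part_nu_ne_bot_iff, InPartition.exists_of_mem_conjugates] at *
    · exact hf
    · exact hyα
    · exact hxα

/-- The two hypotheses make every `t_i` even, so each `e^β` becomes homogeneous; nonvanishing of `b`
then turns multiplicativity of signs into additivity of parity. -/
lemma IsSignGrading.exists_isEvenSplit {x : SmallIdem P a c} {S : ℤˣ → Submodule F (Alg F C)}
    (h : x.IsSignGrading S) (hx : x.IsRegular) (hlam : x.part Label.lam ≤ S 1)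
    (hhalf : x.part Label.lamHalf ≤ S 1) :
    ∃ R, IsEvenSplit C R x.word.1 ∧ ∀ s, signPart F C R x.word.1 s ≤ S s := by
  have he := h.elt_mem hx
  have hh := hhalf IsRegular.halfVec_mem
  have hzero := h.part_zero_le
  have ht : ∀ i, tor F C i ∈ S 1 := fun i => by
    by_cases hi : x.word.1 i = 0
    · exact hzero (IsRegular.tor_mem_zero hi)
    · exact hx.tor_mem (hx.torSum_mem he hh) hlam hi
  obtain ⟨i, hi⟩ := x.word.exists_ne_zero
  -- One even `e^β` with partition `p` suffices for membership, since all of them share the sign of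
  -- the `ν^p`-parts.
  let R : Set (Sym2 ℕ) := {p | ∃ β, InPartition x.word p β ∧ cw F β ∈ S 1}
  have hcw : ∀ β : Cstar C, cw F β ∈ S (basisSign R x.word.1 (Sum.inr β)) := fun β => by
    by_cases h1 : β.1 = x.word.1
    · rw [basisSign_of_trivial (Or.inr (Or.inr (Or.inl h1))), Cstar.ext h1]
      exact hx.cw_word_mem he hh
    by_cases h2 : β.1 = 1 + x.word.1
    · rw [basisSign_of_trivial (Or.inr (Or.inr (Or.inr h2)))]
      exact hzero (IsRegular.compl_mem_zero h2)
    have hβ : InPartition x.word _ β := ⟨h1, h2, rfl⟩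
    rw [basisSign_of_inPartition hβ 1]
    obtain ⟨s, hs⟩ := h.part_le (Label.nu (weightPartition x.word.1 β.1) 1)
    have h3 : ∀ γ, InPartition x.word (weightPartition x.word.1 β.1) γ → cw F γ ∈ S s :=
      fun γ hγ => h.cw_mem_of_part_nu_le hx hi (ht i) hs hγ
    by_cases hR : weightPartition x.word.1 β.1 ∈ R
    · obtain ⟨γ, hγ, hγS⟩ := hR
      have hs1 := h.sign_unique (cw_ne_zero γ) (h3 γ hγ) hγS
      rw [Label.sign, if_pos ⟨γ, hγ, hγS⟩, ← hs1]
      exact h3 β hβ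
    · rw [Label.sign, if_neg hR]
      rcases Int.units_eq_one_or s with rfl | rfl
      · exact absurd ⟨β, hβ, h3 β hβ⟩ hR
      · exact h3 β hβ
  refine ⟨R, isEvenSplit_of_nontrivial fun β hβ γ hγ hβ' hγ' h0 h1 => ?_, fun s => ?_⟩
  · let β' : Cstar C := ⟨β, hβ, fun e => hβ' (Or.inl e), fun e => hβ' (Or.inr (Or.inl e))⟩
    let γ' : Cstar C := ⟨γ, hγ, fun e => hγ' (Or.inl e), fun e => hγ' (Or.inr (Or.inl e))⟩
    let δ : Cstar C := ⟨β + γ, C.add_mem hβ hγ, h0, h1⟩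
    have h2 := h.mul_mem _ _ _ (hcw β') _ (hcw γ')
    have hb : P.b β' γ' ≠ 0 := hx.b_ne_zero _ _ (fun e => h0 (word_add_eq_zero.2 e))
      (fun e => h1 (word_add_eq_iff.2 e))
    rw [mul_cw_cw P (δ := δ) rfl, Submodule.smul_mem_iff _ hb] at h2
    have h3 := h.sign_unique (cw_ne_zero δ) h2 (hcw δ)
    simp only [basisSign, β', γ', δ] at h3
    by_cases e1 : IsEvenWord R x.word.1 β <;> by_cases e2 : IsEvenWord R x.word.1 γ <;>
      by_cases e3 : IsEvenWord R x.word.1 (β + γ) <;> simp [e1, e2, e3] at h3 ⊢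
  · refine Submodule.span_le.2 ?_
    rintro _ ⟨j | β, rfl, rfl⟩
    · exact ht j
    · exact hcw β

end SmallIdem

open SmallIdem

/-- A label occurring for some member of `X` has nonzero part at every conjugate, so its sign can be
read at the single member `x`. -/
lemma eq_sign_of_isGrading {α : Cstar C} {X : Set (SmallIdem P a c)} (hX : ∀ x ∈ X, x.IsRegular)
    (hXS : ∀ x ∈ X, x.word.1 ∈ conjugates C α.1) {p : ℤˣ → Set Label}
    (hp : (idemLaw X).IsGrading p) {x : SmallIdem P a c} (hx : x ∈ X)
    (hlam : x.part Label.lam ≤ x.sumPart (p 1))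
    (hhalf : x.part Label.lamHalf ≤ x.sumPart (p 1)) :
    ∃ R, IsEvenSplit C R α.1 ∧
      ∀ s, p s = (idemLaw X).carrier ∩ {f | Label.sign R f = s} := by
  have h := isSignGrading_of_isGrading hX hp hx
  obtain ⟨R, hR, hS⟩ := h.exists_isEvenSplit (hX x hx) hlam hhalf
  have key : ∀ s f, f ∈ p s → f ∈ (idemLaw X).carrier ∧ Label.sign R f = s := fun s f hf => by
    have hc : f ∈ (idemLaw X).carrier := hp.1 ▸ Set.mem_iUnion.2 ⟨s, hf⟩
    refine ⟨hc, ?_⟩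
    obtain ⟨y, hy⟩ := hc
    have hxf := part_ne_bot_of_conjugate (hX x hx) (hXS x hx) (hXS y.1 y.2) hy
    obtain ⟨v, hv, hv0⟩ := (Submodule.ne_bot_iff _).1 hxf
    exact h.sign_unique hv0 (hS _ (part_le_signPart R f hv))
      (Submodule.mem_iSup_of_mem f (Submodule.mem_iSup_of_mem hf hv))
  refine ⟨R, (isEvenSplit_conjugate_iff (hXS x hx)).1 hR, fun s => ?_⟩
  ext f
  refine ⟨fun hf => key s f hf, ?_⟩
  rintro ⟨hc, rfl⟩
  rw [← hp.1] at hc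
  obtain ⟨t, ht⟩ := Set.mem_iUnion.1 hc
  rwa [(key t f ht).2]

lemma isGrading_sign_of_isEvenSplit {α : Cstar C} {X : Set (SmallIdem P a c)}
    (hX : ∀ x ∈ X, x.IsRegular) (hXS : ∀ x ∈ X, x.word.1 ∈ conjugates C α.1)
    {R : Set (Sym2 ℕ)} (hR : IsEvenSplit C R α.1) :
    (idemLaw X).IsGrading fun s => (idemLaw X).carrier ∩ {f | Label.sign R f = s} :=
  isGrading_sign X hX R fun x hx => (isEvenSplit_conjugate_iff (hXS x hx)).2 hR

/-- The labels of negative sign which occur. -/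
lemma nonempty_neg_iff {α : Cstar C} {X : Set (SmallIdem P a c)} (hne : X.Nonempty)
    (hXS : ∀ x ∈ X, x.word.1 ∈ conjugates C α.1) (R : Set (Sym2 ℕ)) :
    ((idemLaw X).carrier ∩ {f | Label.sign R f = -1}).Nonempty ↔
      ∃ v ∈ C, ¬IsEvenWord R α.1 v := by
  constructor
  · rintro ⟨f, ⟨y, hy⟩, hf⟩
    rcases f with _ | _ | _ | _ | ⟨p, ε⟩
    · exact absurd (show (1 : ℤˣ) = -1 from hf) (by decide)
    · exact absurd (show (1 : ℤˣ) = -1 from hf) (by decide)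
    · exact absurd (show (1 : ℤˣ) = -1 from hf) (by decide)
    · exact absurd (show (1 : ℤˣ) = -1 from hf) (by decide)
    · obtain ⟨β, hβ⟩ := (InPartition.exists_of_mem_conjugates (hXS y.1 y.2)).1
        (IsRegular.part_nu_ne_bot_iff.1 hy)
      refine ⟨β.1, β.2.1, fun hev => ?_⟩
      have h1 := basisSign_of_inPartition (R := R) hβ ε
      rw [show Label.sign R (Label.nu p ε) = -1 from hf] at h1
      simp [basisSign, hev] at h1
  · rintro ⟨v, hv, hodd⟩
    have htriv : ¬IsTrivialWord α.1 v := fun h => hodd (Or.inl h)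
    obtain ⟨x, hx⟩ := hne
    let β : Cstar C := ⟨v, hv, fun e => htriv (Or.inl e), fun e => htriv (Or.inr (Or.inl e))⟩
    have hβ : InPartition α (weightPartition α.1 v) β := ⟨fun e => htriv (Or.inr (Or.inr (Or.inl e))),
      fun e => htriv (Or.inr (Or.inr (Or.inr e))), rfl⟩
    refine ⟨Label.nu (weightPartition α.1 v) 1, ⟨⟨x, hx⟩, ?_⟩, ?_⟩
    · exact IsRegular.part_nu_ne_bot_iff.2
        ((InPartition.exists_of_mem_conjugates (hXS x hx)).2 ⟨β, hβ⟩)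
    · exact if_neg fun h => hodd (Or.inr h)

end idem

/-! ## Subcodes of codimension one -/

section codim

variable {ι : Type*} [Fintype ι] {D E : Submodule (ZMod 2) (ι → ZMod 2)}

lemma zmod_two_eq_zero_or_one (r : ZMod 2) : r = 0 ∨ r = 1 := by revert r; decide

omit [Fintype ι] in
lemma mem_sup_span_singleton_iff {u v : ι → ZMod 2} :
    v ∈ E ⊔ Submodule.span (ZMod 2) {u} ↔ v ∈ E ∨ u + v ∈ E := by
  constructor
  · intro h
    obtain ⟨e, he, y, hy, rfl⟩ := Submodule.mem_sup.1 h
    obtain ⟨r, rfl⟩ := Submodule.mem_span_singleton.1 hy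
    rcases zmod_two_eq_zero_or_one r with rfl | rfl
    · left; rwa [zero_smul, add_zero]
    · right; rwa [one_smul, add_comm e, word_add_cancel]
  · rintro (h | h)
    · exact Submodule.mem_sup_left h
    · rw [← word_add_cancel u v]
      exact Submodule.add_mem _ (Submodule.mem_sup_right (Submodule.mem_span_singleton_self u))
        (Submodule.mem_sup_left h)

lemma add_mem_of_finrank_eq (hle : E ≤ D)
    (h : Module.finrank (ZMod 2) D = Module.finrank (ZMod 2) E + 1) {u v : ι → ZMod 2}
    (hu : u ∈ D) (hv : v ∈ D) (huE : u ∉ E) (hvE : v ∉ E) : u + v ∈ E := by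
  have h1 : E ⊔ Submodule.span (ZMod 2) {u} ≤ D :=
    sup_le hle ((Submodule.span_singleton_le_iff_mem _ _).2 hu)
  have h2 : E < E ⊔ Submodule.span (ZMod 2) {u} := by
    refine lt_of_le_of_ne le_sup_left fun e => huE ?_
    rw [e]
    exact Submodule.mem_sup_right (Submodule.mem_span_singleton_self u)
  have h3 := Submodule.finrank_lt_finrank_of_lt h2
  have h4 : E ⊔ Submodule.span (ZMod 2) {u} = D :=
    Submodule.eq_of_le_of_finrank_le h1 (by omega)
  rw [← h4] at hv
  exact (mem_sup_span_singleton_iff.1 hv).resolve_left hvE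

lemma finrank_eq_of_add_mem (hle : E ≤ D) {u : ι → ZMod 2} (hu : u ∈ D) (huE : u ∉ E)
    (h : ∀ v ∈ D, v ∉ E → u + v ∈ E) :
    Module.finrank (ZMod 2) D = Module.finrank (ZMod 2) E + 1 := by
  have h1 : E ⊔ Submodule.span (ZMod 2) {u} = D := by
    refine le_antisymm (sup_le hle ((Submodule.span_singleton_le_iff_mem _ _).2 hu)) fun v hv => ?_
    rw [mem_sup_span_singleton_iff]
    by_cases hvE : v ∈ E
    · exact Or.inl hvE
    · exact Or.inr (h v hv hvE)
  have h2 : E ⊓ Submodule.span (ZMod 2) {u} = ⊥ := by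
    rw [eq_bot_iff]
    rintro v ⟨hv, hv'⟩
    obtain ⟨r, rfl⟩ := Submodule.mem_span_singleton.1 hv'
    rcases zmod_two_eq_zero_or_one r with rfl | rfl
    · rw [zero_smul]; exact Submodule.zero_mem _
    · rw [one_smul] at hv; exact absurd hv huE
  have h3 := Submodule.finrank_sup_add_finrank_inf_eq E (Submodule.span (ZMod 2) {u})
  have hu0 : u ≠ 0 := fun e => huE (e ▸ E.zero_mem)
  rwa [h1, h2, finrank_bot, add_zero, finrank_span_singleton hu0] at h3

lemma IsUnionOfWeightSets.mem_iff (h : IsUnionOfWeightSets D E) {v : ι → ZMod 2} (hv : v ∈ D) :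
    v ∈ E ↔ hammingNorm v ∈ weights E := by
  refine ⟨fun h => ⟨v, h, rfl⟩, ?_⟩
  rintro ⟨u, hu, he⟩
  obtain ⟨W, hW⟩ := h
  exact (hW v).2 ⟨hv, he ▸ ((hW u).1 hu).2⟩

end codim

/-! ### Projection to the support of a word: even words versus subcodes. -/

section proj

variable {n : ℕ} {C : Submodule (ZMod 2) (Fin n → ZMod 2)}

/-- The restriction of a word to the support of `α`. -/
def restrict (α : Fin n → ZMod 2) :
    (Fin n → ZMod 2) →ₗ[ZMod 2] ({i : Fin n // α i ≠ 0} → ZMod 2) :=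
  LinearMap.funLeft (ZMod 2) (ZMod 2) Subtype.val

lemma hammingNorm_restrict (α v : Fin n → ZMod 2) :
    hammingNorm (restrict α v) = interCard α v := by
  unfold hammingNorm interCard
  refine Finset.card_bij (fun i _ => i.1) ?_ (fun i _ j _ h => Subtype.ext h) ?_
  · intro i hi
    simp only [Finset.mem_filter, Finset.mem_univ, true_and] at hi ⊢
    exact ⟨i.2, hi⟩
  · intro i hi
    simp only [Finset.mem_filter, Finset.mem_univ, true_and] at hi
    exact ⟨⟨i, hi.1⟩, Finset.mem_filter.2 ⟨Finset.mem_univ _, hi.2⟩, rfl⟩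

lemma restrict_self (α : Fin n → ZMod 2) : restrict α α = 1 :=
  funext fun i => zmod_two_eq_one i.2

lemma mem_weights_proj_iff {α : Fin n → ZMod 2} {m : ℕ} :
    m ∈ weights (proj C α) ↔ ∃ v ∈ C, interCard α v = m := by
  constructor
  · rintro ⟨_, ⟨u, hu, rfl⟩, rfl⟩
    exact ⟨u, hu, (hammingNorm_restrict α u).symm⟩
  · rintro ⟨u, hu, rfl⟩
    exact ⟨_, ⟨u, hu, rfl⟩, hammingNorm_restrict α u⟩

/-- Two coordinates equal on all of `C` would give a dual word of weight two. -/
lemma exists_ne_of_isProjective (hC : IsProjective C) {i j : Fin n} (hij : i ≠ j) :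
    ∃ v ∈ C, v i ≠ v j := by
  by_contra! hcon
  have h1 := hC (Pi.single i 1 + Pi.single j 1) (fun w hw => by
    rw [add_dotProduct, single_dotProduct, single_dotProduct, one_mul, one_mul, hcon w hw]
    exact CharTwo.add_self_eq_zero _) (fun h => by
      have := congr_fun h i
      simp [hij] at this)
  have h2 : hammingNorm (Pi.single i 1 + Pi.single j 1 : Fin n → ZMod 2) ≤ 2 := by
    unfold hammingNorm
    refine (Finset.card_le_card (t := {i, j}) fun k hk => ?_).trans Finset.card_le_two
    by_contra hk'
    simp only [Finset.mem_insert, Finset.mem_singleton, not_or] at hk'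
    simp [hk'.1, hk'.2] at hk
  omega

/-- A dual word of weight one is excluded by `α`, which restricts to the all-ones word, and one of
weight two by a word of `C` separating its two points. -/
lemma isProjective_proj (hC : IsProjective C) {α : Fin n → ZMod 2} (hα : α ∈ C) :
    IsProjective (proj C α) := by
  intro v hv hv0
  by_contra hlt
  have hcard : (Finset.univ.filter fun i => v i ≠ 0).card ≤ 2 := by
    have : hammingNorm v < 3 := not_le.1 hlt
    rw [hammingNorm] at this
    omega
  obtain ⟨i, hi⟩ := Function.ne_iff.1 hv0
  have hv' : ∀ w ∈ C, ∑ j, v j * w j.1 = 0 := fun w hw => hv _ ⟨w, hw, rfl⟩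
  by_cases hex : ∃ j, j ≠ i ∧ v j ≠ 0
  · obtain ⟨j, hji, hj⟩ := hex
    obtain ⟨w, hw, hne⟩ := exists_ne_of_isProjective hC
      (i := i.1) (j := j.1) (fun e => hji (Subtype.ext e.symm))
    have h1 := hv' w hw
    rw [← Finset.sum_subset (Finset.subset_univ {i, j}), Finset.sum_pair hji.symm,
      zmod_two_eq_one hi, zmod_two_eq_one hj, one_mul, one_mul] at h1
    · exact hne (CharTwo.add_eq_zero.1 h1)
    · intro k _ hk
      have : v k = 0 := by
        by_contra hk0
        simp only [Finset.mem_insert, Finset.mem_singleton, not_or] at hk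
        have h3 : 2 < (Finset.univ.filter fun i => v i ≠ 0).card :=
          Finset.two_lt_card.2 ⟨i, by simpa using hi, j, by simpa using hj, k, by simpa using hk0,
            hji.symm, Ne.symm hk.1, Ne.symm hk.2⟩
        omega
      rw [this, zero_mul]
  · push Not at hex
    have h1 := hv' α hα
    rw [Finset.sum_eq_single i (fun j _ hj => by rw [hex j hj, zero_mul]) (by simp),
      zmod_two_eq_one hi, zmod_two_eq_one i.2] at h1
    exact one_ne_zero h1

/-- Weight partitions of the words with weights in a set. -/
def partitionsOfWeights (w : ℕ) (W : Set ℕ) : Set (Sym2 ℕ) := (fun m => s(m, w - m)) '' W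

variable {α : Fin n → ZMod 2} {E : Submodule (ZMod 2) ({i : Fin n // α i ≠ 0} → ZMod 2)}

namespace IsPlusSubcode

variable (h : IsPlusSubcode (proj C α) E)

include h

lemma restrict_mem_iff {v : Fin n → ZMod 2} (hv : v ∈ C) :
    restrict α v ∈ E ↔ interCard α v ∈ weights E := by
  rw [← hammingNorm_restrict]
  exact h.2.2.2.mem_iff ⟨v, hv, rfl⟩

/-- The all-ones word lies in `E`, so `E` is closed under complements in the support of `α`. This
makes a set of weights compatible with unordered partitions. -/
lemma sub_mem_weights (hα : α ∈ C) {m : ℕ} (hm : m ∈ weights E) :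
    hammingNorm α - m ∈ weights E := by
  obtain ⟨v, hv, rfl⟩ := hm
  obtain ⟨u, hu, rfl⟩ := h.1 hv
  change restrict α u ∈ E at hv
  change hammingNorm α - hammingNorm (restrict α u) ∈ _
  rw [hammingNorm_restrict, ← interCard_self_add, ← h.restrict_mem_iff (C.add_mem hα hu), map_add,
    restrict_self]
  exact E.add_mem h.2.2.1 hv

lemma mem_partitions_iff (hα : α ∈ C) {m : ℕ} (hm : m ≤ hammingNorm α) :
    s(m, hammingNorm α - m) ∈ partitionsOfWeights (hammingNorm α) (weights E) ↔
      m ∈ weights E := by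
  refine ⟨?_, fun h => ⟨m, h, rfl⟩⟩
  rintro ⟨k, hk, he⟩
  rcases Sym2.eq_iff.1 he with ⟨e, -⟩ | ⟨e, -⟩
  · rwa [← e]
  · have h1 : m = hammingNorm α - k := by omega
    rw [h1]
    exact h.sub_mem_weights hα hk

lemma isEvenWord_iff (hα : α ∈ C) {v : Fin n → ZMod 2} (hv : v ∈ C) :
    IsEvenWord (partitionsOfWeights (hammingNorm α) (weights E)) α v ↔ restrict α v ∈ E := by
  unfold IsEvenWord
  rw [weightPartition_eq, h.mem_partitions_iff hα (interCard_le α v), h.restrict_mem_iff hv]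
  refine or_iff_right_of_imp fun ht => ?_
  have h1 : (1 : {i : Fin n // α i ≠ 0} → ZMod 2) ∈ E := h.2.2.1
  have h1' : restrict α 1 = 1 := rfl
  rw [← h.restrict_mem_iff hv]
  rcases ht with rfl | rfl | rfl | rfl
  · rw [map_zero]; exact E.zero_mem
  · rwa [h1']
  · rwa [restrict_self]
  · rw [map_add, restrict_self, h1']; exact E.add_mem h1 h1

lemma isEvenSplit (hα : α ∈ C) :
    IsEvenSplit C (partitionsOfWeights (hammingNorm α) (weights E)) α := by
  intro β hβ γ hγ
  rw [h.isEvenWord_iff hα hβ, h.isEvenWord_iff hα hγ, h.isEvenWord_iff hα (C.add_mem hβ hγ),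
    map_add]
  by_cases h1 : restrict α β ∈ E
  · rw [iff_true_left h1]
    exact Submodule.add_mem_iff_right _ h1
  · by_cases h2 : restrict α γ ∈ E
    · rw [iff_true_right h2]
      exact Submodule.add_mem_iff_left _ h2
    · exact iff_of_true (add_mem_of_finrank_eq h.1 h.2.1 ⟨β, hβ, rfl⟩ ⟨γ, hγ, rfl⟩ h1 h2)
        (iff_of_false h1 h2)

lemma exists_odd (hα : α ∈ C) :
    ∃ v ∈ C, ¬IsEvenWord (partitionsOfWeights (hammingNorm α) (weights E)) α v := by
  by_contra! hcon
  have : proj C α ≤ E := by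
    rintro _ ⟨v, hv, rfl⟩
    exact (h.isEvenWord_iff hα hv).1 (hcon v hv)
  have h1 := h.2.1
  rw [le_antisymm this h.1] at h1
  omega

end IsPlusSubcode

/-- Choose `δ` in `C` separating two points of the support of `α`. Then `δ` and `v + δ` are
nontrivial and agree on that support, so they have the same partition and the same parity;
additivity makes `v` even. -/
lemma IsEvenSplit.isEvenWord_of_interCard_eq_zero (hC : IsProjective C) {R : Set (Sym2 ℕ)}
    (hR : IsEvenSplit C R α) (hw : 2 ≤ hammingNorm α) {v : Fin n → ZMod 2} (hv : v ∈ C)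
    (h0 : interCard α v = 0) : IsEvenWord R α v := by
  obtain ⟨i, hi, j, hj, hij⟩ := Finset.one_lt_card.1 (show 1 <
      (Finset.univ.filter fun i => α i ≠ 0).card from hw)
  simp only [Finset.mem_filter, Finset.mem_univ, true_and] at hi hj
  obtain ⟨δ, hδ, hne⟩ := exists_ne_of_isProjective hC hij
  have hv0 : ∀ k, α k ≠ 0 → v k = 0 := fun k hk => by
    by_contra hvk
    have := Finset.card_eq_zero.1 h0
    exact Finset.notMem_empty k (this ▸ Finset.mem_filter.2 ⟨Finset.mem_univ k, hk, hvk⟩)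
  have hnt : ∀ u : Fin n → ZMod 2, u i ≠ u j → ¬IsTrivialWord α u := by
    rintro u hu (rfl | rfl | rfl | rfl)
    · exact hu rfl
    · exact hu rfl
    · exact hu (by rw [zmod_two_eq_one hi, zmod_two_eq_one hj])
    · exact hu (by simp [zmod_two_eq_one hi, zmod_two_eq_one hj])
  have h1 : IsEvenWord R α (v + δ) ↔ IsEvenWord R α δ := by
    unfold IsEvenWord
    have e1 : ¬IsTrivialWord α (v + δ) := hnt _ (by simpa [hv0 i hi, hv0 j hj] using hne)
    have e2 : interCard α (v + δ) = interCard α δ := by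
      unfold interCard
      congr 1
      ext k
      simp only [Finset.mem_filter, Finset.mem_univ, true_and, Pi.add_apply]
      exact and_congr_right fun hk => by rw [hv0 k hk, zero_add]
    rw [weightPartition_eq, weightPartition_eq, e2]
    simp only [e1, hnt δ hne, false_or]
  have h2 := hR v hv δ hδ
  rw [h1] at h2
  by_contra h3
  by_cases h4 : IsEvenWord R α δ <;> simp [h3, h4] at h2

/-- The subcode is the image of the even words. Words with the same restriction differ by one
vanishing on the support of `α`, which is even, so parity descends to the projection. -/
lemma IsEvenSplit.exists_isPlusSubcode (hC : IsProjective C) (hα : α ∈ C) {R : Set (Sym2 ℕ)}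
    (hR : IsEvenSplit C R α) (hw : 2 ≤ hammingNorm α) (hodd : ∃ v ∈ C, ¬IsEvenWord R α v) :
    ∃ E, IsPlusSubcode (proj C α) E ∧ ∀ v ∈ C, restrict α v ∈ E ↔ IsEvenWord R α v := by
  have h0 : IsEvenWord R α 0 := Or.inl (Or.inl rfl)
  let G : Submodule (ZMod 2) (Fin n → ZMod 2) :=
    { carrier := {v | v ∈ C ∧ IsEvenWord R α v}
      add_mem' := fun {u v} hu hv =>
        ⟨C.add_mem hu.1 hv.1, (hR u hu.1 v hv.1).2 (iff_of_true hu.2 hv.2)⟩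
      zero_mem' := ⟨C.zero_mem, h0⟩
      smul_mem' := fun r v hv => by
        rcases zmod_two_eq_zero_or_one r with rfl | rfl
        · rw [zero_smul]; exact ⟨C.zero_mem, h0⟩
        · rwa [one_smul] }
  have key : ∀ v ∈ C, restrict α v ∈ G.map (restrict α) ↔ IsEvenWord R α v := by
    refine fun v hv => ⟨?_, fun h => ⟨v, ⟨hv, h⟩, rfl⟩⟩
    rintro ⟨u, hu, he⟩
    have h1 : interCard α (u + v) = 0 := by
      rw [← hammingNorm_restrict, map_add, he, word_add_self, hammingNorm_zero]
    have h2 := hR.isEvenWord_of_interCard_eq_zero hC hw (C.add_mem hu.1 hv) h1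
    exact ((hR u hu.1 v hv).1 h2).1 hu.2
  obtain ⟨u, hu, huo⟩ := hodd
  have hle : G.map (restrict α) ≤ proj C α := Submodule.map_mono fun v hv => hv.1
  refine ⟨G.map (restrict α), ⟨hle, ?_, ?_, weights (G.map (restrict α)), ?_⟩, key⟩
  · refine finrank_eq_of_add_mem hle ⟨u, hu, rfl⟩ (fun h => huo ((key u hu).1 h)) ?_
    rintro _ ⟨v, hv, rfl⟩ hvE
    change restrict α v ∉ _ at hvE
    change restrict α u + restrict α v ∈ _
    rw [key v hv] at hvE
    rw [← map_add, key _ (C.add_mem hu hv), hR u hu v hv]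
    exact iff_of_false huo hvE
  · exact ⟨α, ⟨hα, Or.inl (Or.inr (Or.inr (Or.inl rfl)))⟩, restrict_self α⟩
  · refine fun v => ⟨fun h => ⟨hle h, v, h, rfl⟩, ?_⟩
    rintro ⟨⟨v, hv, rfl⟩, _, ⟨g, hg, rfl⟩, he⟩
    change restrict α v ∈ _
    rw [key v hv]
    change hammingNorm (restrict α g) = hammingNorm (restrict α v) at he
    rw [hammingNorm_restrict, hammingNorm_restrict] at he
    -- Trivial words are even by definition, although their partition need not be in `R`. Hence
    -- words of intersection number `0` or `|α|` need a separate argument: they, or their sums with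
    -- `α`, vanish on the support.
    have htriv : ∀ u ∈ C, IsTrivialWord α u → ∀ w ∈ C, interCard α w = interCard α u →
        IsEvenWord R α w := by
      intro u hu htr w hw' hwu
      have h1 : interCard α w = 0 ∨ interCard α (α + w) = 0 := by
        have h2 := interCard_add α w
        have h3 : interCard α u = 0 ∨ interCard α u = hammingNorm α := by
          rcases htr with rfl | rfl | rfl | rfl
          · exact Or.inl (interCard_zero α)
          · exact Or.inr (interCard_one α)
          · exact Or.inr (interCard_self u)
          · rw [interCard_one_add, word_add_self, interCard_zero]; exact Or.inl rfl
        omega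
      rcases h1 with h1 | h1
      · exact hR.isEvenWord_of_interCard_eq_zero hC hw hw' h1
      · have h2 := hR.isEvenWord_of_interCard_eq_zero hC hw (C.add_mem hα hw') h1
        rwa [isEvenWord_add_of_trivial (Or.inr (Or.inr (Or.inl rfl)))] at h2
    by_cases h1 : IsTrivialWord α g
    · exact htriv g hg.1 h1 v hv he.symm
    · right
      rw [(weightPartition_eq_iff α v g).2 (Or.inl he.symm)]
      exact hg.2.resolve_left h1

end proj

section idem

variable {F : Type*} [Field F] {n : ℕ} {C : Submodule (ZMod 2) (Fin n → ZMod 2)}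
  {P : Params F C} {a : F} {c : Cstar C → F}

open SmallIdem

/-! ## Words of weight greater than two -/

lemma sumPart_sign_one_of_isPlusSubcode {α : Cstar C} (x : SmallIdem P a c)
    (E : Submodule (ZMod 2) ({i : Fin n // α.1 i ≠ 0} → ZMod 2)) :
    x.sumPart {f | Label.sign (partitionsOfWeights (hammingNorm α.1) (weights E)) f = 1} =
      x.part Label.one ⊔ x.part Label.zero ⊔ x.part Label.lam ⊔ x.part Label.lamHalf ⊔
        ⨆ m ∈ weights E, ⨆ ε : ℤˣ, x.part (Label.nu s(m, hammingNorm α.1 - m) ε) := by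
  rw [sumPart_sign_one, partitionsOfWeights, iSup_image]

lemma sumPart_sign_neg_one_of_isPlusSubcode {α : Cstar C} {x : SmallIdem P a c}
    (hx : x.word.1 ∈ conjugates C α.1)
    {E : Submodule (ZMod 2) ({i : Fin n // α.1 i ≠ 0} → ZMod 2)}
    (hE : IsPlusSubcode (proj C α.1) E) :
    x.sumPart {f | Label.sign (partitionsOfWeights (hammingNorm α.1) (weights E)) f = -1} =
      ⨆ m ∈ weights (proj C α.1) \ weights E, ⨆ ε : ℤˣ,
        x.part (Label.nu s(m, hammingNorm α.1 - m) ε) := by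
  rw [sumPart_sign_neg_one]
  refine le_antisymm (iSup₂_le fun p hp => iSup_le fun ε => ?_)
    (iSup₂_le fun m hm => iSup_le fun ε => ?_)
  · by_cases hbot : x.part (Label.nu p ε) = ⊥
    · rw [hbot]; exact bot_le
    obtain ⟨β, hβ⟩ := (InPartition.exists_of_mem_conjugates hx).1
      (IsRegular.part_nu_ne_bot_iff.1 hbot)
    have h1 := hβ.2.2
    rw [weightPartition_eq] at h1
    subst h1
    refine le_iSup₂_of_le (interCard α.1 β.1)
      ⟨mem_weights_proj_iff.2 ⟨β.1, β.2.1, rfl⟩, fun h => hp ⟨_, h, rfl⟩⟩ (le_iSup_of_le ε le_rfl)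
  · refine le_iSup₂_of_le (s(m, hammingNorm α.1 - m)) (fun h => hm.2 ?_) (le_iSup_of_le ε le_rfl)
    refine (hE.mem_partitions_iff α.2.1 ?_).1 h
    obtain ⟨v, -, rfl⟩ := mem_weights_proj_iff.1 hm.1
    exact interCard_le _ _

lemma exists_isZ2Grading_of_isPlusSubcode {α : Cstar C} {X : Set (SmallIdem P a c)}
    (hne : X.Nonempty) (hX : ∀ x ∈ X, x.IsRegular)
    (hXS : ∀ x ∈ X, x.word.1 ∈ conjugates C α.1)
    {E : Submodule (ZMod 2) ({i : Fin n // α.1 i ≠ 0} → ZMod 2)}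
    (hE : IsPlusSubcode (proj C α.1) E) :
    ∃ p, (idemLaw X).IsZ2Grading p ∧ ∀ x ∈ X,
      x.sumPart (p 1) = x.part Label.one ⊔ x.part Label.zero ⊔ x.part Label.lam ⊔
        x.part Label.lamHalf ⊔
        ⨆ m ∈ weights E, ⨆ ε : ℤˣ, x.part (Label.nu s(m, hammingNorm α.1 - m) ε) ∧
      x.sumPart (p (-1)) = ⨆ m ∈ weights (proj C α.1) \ weights E, ⨆ ε : ℤˣ,
        x.part (Label.nu s(m, hammingNorm α.1 - m) ε) := by
  refine ⟨_, ⟨isGrading_sign_of_isEvenSplit hX hXS (hE.isEvenSplit α.2.1),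
    (nonempty_neg_iff hne hXS _).2 (hE.exists_odd α.2.1)⟩, fun x hx => ⟨?_, ?_⟩⟩
  · rw [idemLaw_carrier_inter X hx, sumPart_sign_one_of_isPlusSubcode]
  · rw [idemLaw_carrier_inter X hx, sumPart_sign_neg_one_of_isPlusSubcode (hXS x hx) hE]

lemma exists_isPlusSubcode_of_isZ2Grading (hC : IsProjective C) {α : Cstar C}
    {X : Set (SmallIdem P a c)} (hne : X.Nonempty) (hX : ∀ x ∈ X, x.IsRegular)
    (hXS : ∀ x ∈ X, x.word.1 ∈ conjugates C α.1) (hw : 2 < hammingNorm α.1)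
    {p : ℤˣ → Set Label} (hp : (idemLaw X).IsZ2Grading p) :
    ∃ E, IsPlusSubcode (proj C α.1) E ∧ ∀ x ∈ X,
      x.sumPart (p 1) = x.part Label.one ⊔ x.part Label.zero ⊔ x.part Label.lam ⊔
        x.part Label.lamHalf ⊔
        ⨆ m ∈ weights E, ⨆ ε : ℤˣ, x.part (Label.nu s(m, hammingNorm α.1 - m) ε) ∧
      x.sumPart (p (-1)) = ⨆ m ∈ weights (proj C α.1) \ weights E, ⨆ ε : ℤˣ,
        x.part (Label.nu s(m, hammingNorm α.1 - m) ε) := by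
  obtain ⟨x₀, hx₀⟩ := hne
  have hS := isSignGrading_of_isGrading hX hp.1 hx₀
  have hw₀ : 2 < hammingNorm x₀.word.1 := by
    rwa [hammingNorm_of_mem_conjugates (hXS x₀ hx₀)]
  obtain ⟨R, hR, hpR⟩ := eq_sign_of_isGrading hX hXS hp.1 hx₀ (hS.part_lam_le hw₀)
    (hS.part_lamHalf_le (hX x₀ hx₀) hw₀.le)
  have hodd := (nonempty_neg_iff ⟨x₀, hx₀⟩ hXS R).1 (hpR (-1) ▸ hp.2)
  obtain ⟨E, hE, hER⟩ := hR.exists_isPlusSubcode hC α.2.1 hw.le hodd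
  -- The set `R` and the set of partitions built from `E` can differ on partitions that do not
  -- occur; they only need to agree on the carrier.
  have hsign : ∀ f ∈ (idemLaw X).carrier, Label.sign R f =
      Label.sign (partitionsOfWeights (hammingNorm α.1) (weights E)) f := by
    rintro f ⟨y, hy⟩
    rcases f with _ | _ | _ | _ | ⟨q, ε⟩
    · rfl
    · rfl
    · rfl
    · rfl
    · obtain ⟨β, hβ⟩ := (InPartition.exists_of_mem_conjugates (hXS y.1 y.2)).1
        (IsRegular.part_nu_ne_bot_iff.1 hy)
      rw [← basisSign_of_inPartition hβ ε, ← basisSign_of_inPartition hβ ε]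
      have h1 := hE.isEvenWord_iff α.2.1 β.2.1
      rw [hER β.1 β.2.1] at h1
      simp only [basisSign, h1]
  have hpE : ∀ s, p s = (idemLaw X).carrier ∩
      {f | Label.sign (partitionsOfWeights (hammingNorm α.1) (weights E)) f = s} := fun s => by
    rw [hpR s]
    ext f
    exact and_congr_right fun hf => by
      show _ = _ ↔ _ = _
      rw [hsign f hf]
  refine ⟨E, hE, fun x hx => ⟨?_, ?_⟩⟩
  · rw [hpE, idemLaw_carrier_inter X hx, sumPart_sign_one_of_isPlusSubcode]
  · rw [hpE, idemLaw_carrier_inter X hx, sumPart_sign_neg_one_of_isPlusSubcode (hXS x hx) hE]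

/-! ## Words of weight two -/

/-- The support of `α` consists of the different points `i` and `j`. -/
def IsPair (α : Fin n → ZMod 2) (i j : Fin n) : Prop := i ≠ j ∧ ∀ k, α k ≠ 0 ↔ k = i ∨ k = j

lemma exists_isPair {α : Fin n → ZMod 2} (hw : hammingNorm α = 2) : ∃ i j, IsPair α i j := by
  obtain ⟨i, j, hij, h⟩ := Finset.card_eq_two.1 hw
  refine ⟨i, j, hij, fun k => ?_⟩
  have : k ∈ Finset.univ.filter (fun k => α k ≠ 0) ↔ k ∈ ({i, j} : Finset (Fin n)) := by rw [h]
  simpa using this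

namespace IsPair

variable {α : Fin n → ZMod 2} {i j : Fin n} (h : IsPair α i j)

include h

lemma interCard_eq (v : Fin n → ZMod 2) :
    interCard α v = (if v i ≠ 0 then 1 else 0) + if v j ≠ 0 then 1 else 0 := by
  have h1 : (Finset.univ.filter fun k => α k ≠ 0 ∧ v k ≠ 0) =
      ({i, j} : Finset (Fin n)).filter fun k => v k ≠ 0 := by
    ext k
    simp [← h.2 k]
  rw [interCard, h1, Finset.card_filter, Finset.sum_pair h.1]

lemma hammingNorm_eq : hammingNorm α = 2 := by
  have h1 := (h.2 i).2 (Or.inl rfl)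
  have h2 := (h.2 j).2 (Or.inr rfl)
  rw [← interCard_self, h.interCard_eq, if_pos h1, if_pos h2]

lemma interCard_eq_one_iff (v : Fin n → ZMod 2) : interCard α v = 1 ↔ v i ≠ v j := by
  rw [h.interCard_eq]
  generalize v i = r, v j = s
  revert r s
  decide

lemma apply_left : α i = 1 := zmod_two_eq_one ((h.2 i).2 (Or.inl rfl))

lemma apply_right : α j = 1 := zmod_two_eq_one ((h.2 j).2 (Or.inr rfl))

lemma weightPartition_eq_iff_ne (v : Fin n → ZMod 2) :
    weightPartition α v = s(1, 1) ↔ v i ≠ v j := by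
  rw [← h.interCard_eq_one_iff, weightPartition_eq, h.hammingNorm_eq, Sym2.eq_iff]
  omega

lemma weightPartition_eq_iff_eq (v : Fin n → ZMod 2) :
    weightPartition α v = s(0, 2) ↔ v i = v j := by
  rw [← not_ne_iff (a := v i), ← h.interCard_eq_one_iff, weightPartition_eq, h.hammingNorm_eq,
    Sym2.eq_iff]
  have := interCard_le α v
  rw [h.hammingNorm_eq] at this
  omega

lemma isEvenWord_iff (v : Fin n → ZMod 2) : IsEvenWord {s(1, 1)}ᶜ α v ↔ v i = v j := by
  have h1 : weightPartition α v ∈ ({s(1, 1)}ᶜ : Set (Sym2 ℕ)) ↔ v i = v j := by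
    rw [← not_ne_iff (a := v i), ← h.weightPartition_eq_iff_ne]
    rfl
  unfold IsEvenWord
  rw [h1]
  refine or_iff_right_of_imp ?_
  rintro (rfl | rfl | rfl | rfl)
  · rfl
  · rfl
  · rw [h.apply_left, h.apply_right]
  · rw [Pi.add_apply, Pi.add_apply, h.apply_left, h.apply_right]; rfl

/-- A word is even precisely when `v i + v j = 0`, a linear condition, so no further hypothesis on
the code is needed. -/
lemma isEvenSplit : IsEvenSplit C {s(1, 1)}ᶜ α := by
  intro β _ γ _
  rw [h.isEvenWord_iff, h.isEvenWord_iff, h.isEvenWord_iff, Pi.add_apply, Pi.add_apply]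
  generalize β i = r, β j = s, γ i = t, γ j = u
  revert r s t u
  decide

lemma exists_odd (hC : IsProjective C) : ∃ v ∈ C, ¬IsEvenWord {s(1, 1)}ᶜ α v := by
  obtain ⟨v, hv, hne⟩ := exists_ne_of_isProjective hC h.1
  exact ⟨v, hv, fun hev => hne ((h.isEvenWord_iff v).1 hev)⟩

end IsPair

lemma eq_of_part_nu_ne_bot {α : Cstar C} (hw : hammingNorm α.1 = 2) {x : SmallIdem P a c}
    (hx : x.word.1 ∈ conjugates C α.1) {p : Sym2 ℕ} {ε : ℤˣ}
    (h : x.part (Label.nu p ε) ≠ ⊥) : p = s(0, 2) ∨ p = s(1, 1) := by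
  obtain ⟨i, j, hij⟩ := exists_isPair hw
  obtain ⟨β, hβ⟩ := (InPartition.exists_of_mem_conjugates hx).1
    (IsRegular.part_nu_ne_bot_iff.1 h)
  rw [← hβ.2.2, hij.weightPartition_eq_iff_eq, hij.weightPartition_eq_iff_ne]
  exact em _

lemma exists_isZ2Grading_of_weight_two (hC : IsProjective C) {α : Cstar C}
    {X : Set (SmallIdem P a c)} (hne : X.Nonempty) (hX : ∀ x ∈ X, x.IsRegular)
    (hXS : ∀ x ∈ X, x.word.1 ∈ conjugates C α.1) (hw : hammingNorm α.1 = 2) :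
    ∃ p, (idemLaw X).IsZ2Grading p ∧ ∀ x ∈ X,
      x.sumPart (p 1) = x.part Label.one ⊔ x.part Label.zero ⊔ x.part Label.lam ⊔
        x.part Label.lamHalf ⊔ ⨆ ε : ℤˣ, x.part (Label.nu s(0, 2) ε) ∧
      x.sumPart (p (-1)) = ⨆ ε : ℤˣ, x.part (Label.nu s(1, 1) ε) := by
  obtain ⟨i, j, hij⟩ := exists_isPair hw
  refine ⟨_, ⟨isGrading_sign_of_isEvenSplit hX hXS hij.isEvenSplit,
    (nonempty_neg_iff hne hXS _).2 (hij.exists_odd hC)⟩, fun x hx => ⟨?_, ?_⟩⟩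
  · rw [idemLaw_carrier_inter X hx, sumPart_sign_one]
    congr 1
    refine le_antisymm (iSup₂_le fun p hp => iSup_le fun ε => ?_) (iSup_le fun ε => ?_)
    · by_cases hbot : x.part (Label.nu p ε) = ⊥
      · rw [hbot]; exact bot_le
      rw [(eq_of_part_nu_ne_bot hw (hXS x hx) hbot).resolve_right hp]
      exact le_iSup_of_le ε le_rfl
    · exact le_iSup₂_of_le (s(0, 2)) (by simp) (le_iSup_of_le ε le_rfl)
  · rw [idemLaw_carrier_inter X hx, sumPart_sign_neg_one, compl_compl, iSup_singleton]

end idem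

/-! ## Codes generated by words of weight two -/

section pairs

variable {n : ℕ} {C : Submodule (ZMod 2) (Fin n → ZMod 2)}

/-- The word with support `{i, j}`, or zero if `i = j`. -/
def pairWord (i j : Fin n) : Fin n → ZMod 2 := Pi.single i 1 + Pi.single j 1

lemma pairWord_apply (i j k : Fin n) :
    pairWord i j k = (if k = i then 1 else 0) + if k = j then 1 else 0 := by
  simp [pairWord, Pi.single_apply]

lemma IsPair.eq_pairWord {α : Fin n → ZMod 2} {i j : Fin n} (h : IsPair α i j) :
    α = pairWord i j := by
  funext k
  rw [pairWord_apply]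
  by_cases hi : k = i
  · subst hi; rw [if_pos rfl, if_neg h.1, h.apply_left, add_zero]
  · by_cases hj : k = j
    · subst hj; rw [if_pos rfl, if_neg hi, h.apply_right, zero_add]
    · rw [if_neg hi, if_neg hj, add_zero]
      by_contra hk
      rcases (h.2 k).1 hk with e | e
      · exact hi e
      · exact hj e

/-- Coordinates are related if they are equal or form the support of a codeword. -/
def pairSetoid (C : Submodule (ZMod 2) (Fin n → ZMod 2)) : Setoid (Fin n) where
  r i j := pairWord i j ∈ C
  iseqv :=
    { refl := fun i => by rw [pairWord, word_add_self]; exact C.zero_mem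
      symm := fun {i j} h => by rw [pairWord, add_comm]; exact h
      trans := fun {i j k} h h' => by
        have := C.add_mem h h'
        rwa [pairWord, pairWord, add_assoc, word_add_cancel] at this }

lemma sum_eq_card_filter (s : Finset (Fin n)) (v : Fin n → ZMod 2) :
    ∑ i ∈ s, v i = ((s.filter fun i => v i ≠ 0).card : ZMod 2) := by
  rw [Finset.card_filter, Nat.cast_sum]
  refine Finset.sum_congr rfl fun i _ => ?_
  generalize v i = r
  revert r
  decide

/-- The sum of the coordinates over a class of related coordinates. -/
def blockSum (C : Submodule (ZMod 2) (Fin n → ZMod 2)) (q : Quotient (pairSetoid C)) :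
    (Fin n → ZMod 2) →ₗ[ZMod 2] ZMod 2 :=
  ∑ i ∈ Finset.univ.filter (fun i => (⟦i⟧ : Quotient (pairSetoid C)) = q), LinearMap.proj i

lemma blockSum_apply (q : Quotient (pairSetoid C)) (v : Fin n → ZMod 2) :
    blockSum C q v =
      ∑ i ∈ Finset.univ.filter (fun i => (⟦i⟧ : Quotient (pairSetoid C)) = q), v i := by
  simp [blockSum]

lemma blockSum_pairWord {i j : Fin n} (h : pairWord i j ∈ C) (q : Quotient (pairSetoid C)) :
    blockSum C q (pairWord i j) = 0 := by
  have e : (⟦i⟧ : Quotient (pairSetoid C)) = ⟦j⟧ := Quotient.sound h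
  rw [blockSum_apply]
  simp only [pairWord_apply, Finset.sum_add_distrib, Finset.sum_ite_eq', Finset.mem_filter,
    Finset.mem_univ, true_and, e]
  exact CharTwo.add_self_eq_zero _

/-- Induction on the weight: adding a pair word with both points in the support and in one class
lowers the weight, stays in the coset of `C`, and keeps all class sums zero. -/
lemma mem_of_blockSum_eq_zero {v : Fin n → ZMod 2} (h : ∀ q, blockSum C q v = 0) : v ∈ C := by
  induction hk : hammingNorm v using Nat.strong_induction_on generalizing v with
  | _ k ih =>
  subst hk
  by_cases hv : v = 0
  · rw [hv]; exact C.zero_mem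
  obtain ⟨i, hi⟩ := Function.ne_iff.1 hv
  -- If `i` were the only support point in its class, the class sum would be `v i`.
  obtain ⟨j, hij, hj, hr⟩ : ∃ j, j ≠ i ∧ v j ≠ 0 ∧ pairWord i j ∈ C := by
    by_contra! hcon
    have h1 := h ⟦i⟧
    rw [blockSum_apply, Finset.sum_eq_single i] at h1
    · exact hi h1
    · intro j hj hji
      by_contra hvj
      refine hcon j hji hvj ?_
      have h2 : pairWord j i ∈ C := Quotient.exact (Finset.mem_filter.1 hj).2
      rwa [pairWord, add_comm] at h2
    · intro h2
      simp at h2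
  have h1 : hammingNorm (v + pairWord i j) < hammingNorm v := by
    refine Finset.card_lt_card ⟨fun k hk => ?_, fun hsub => ?_⟩
    · simp only [Finset.mem_filter, Finset.mem_univ, true_and, Pi.add_apply, pairWord_apply] at hk ⊢
      intro h0
      by_cases e1 : k = i
      · exact hi (e1 ▸ h0)
      · by_cases e2 : k = j
        · exact hj (e2 ▸ h0)
        · simp [h0, e1, e2] at hk
    · have := hsub (Finset.mem_filter.2 ⟨Finset.mem_univ i, hi⟩)
      simp only [Finset.mem_filter, Finset.mem_univ, true_and, Pi.add_apply, pairWord_apply,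
        if_neg (Ne.symm hij), zmod_two_eq_one hi] at this
      exact this (by simpa using CharTwo.add_self_eq_zero (1 : ZMod 2))
  have h2 := ih _ h1 (v := v + pairWord i j)
    (fun q => by rw [map_add, h, blockSum_pairWord hr, add_zero]) rfl
  have h3 := C.add_mem h2 hr
  rwa [add_assoc, word_add_self, add_zero] at h3

lemma mem_iff_blockSum_eq_zero {S : Set (Fin n → ZMod 2)} (hS : Submodule.span (ZMod 2) S = C)
    (hpair : ∀ v ∈ S, ∃ i j, v = pairWord i j) (v : Fin n → ZMod 2) :
    v ∈ C ↔ ∀ q, blockSum C q v = 0 := by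
  refine ⟨fun hv q => ?_, mem_of_blockSum_eq_zero⟩
  have h1 : C ≤ LinearMap.ker (blockSum C q) := by
    conv_lhs => rw [← hS]
    refine Submodule.span_le.2 fun w hw => ?_
    obtain ⟨i, j, rfl⟩ := hpair w hw
    exact blockSum_pairWord (hS ▸ Submodule.subset_span hw) q
  exact h1 hv

lemma IsPair.comp {α : Fin n → ZMod 2} {i j : Fin n} (h : IsPair α i j)
    (g : Equiv.Perm (Fin n)) : IsPair (α ∘ g) (g.symm i) (g.symm j) := by
  refine ⟨g.symm.injective.ne h.1, fun k => ?_⟩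
  rw [Function.comp_apply, h.2, Equiv.eq_symm_apply, Equiv.eq_symm_apply]

/-- Otherwise all conjugates, and so all of `C`, would vanish at `i`. This is the transitivity
available from the generation hypothesis. -/
lemma exists_conjugate_apply_ne_zero {α : Cstar C}
    (hgen : Submodule.span (ZMod 2) (conjugates C α.1) = C) (hsupp : ∀ i, ∃ v ∈ C, v i ≠ 0)
    (i : Fin n) : ∃ g, IsCodeAut C g ∧ α.1 (g i) ≠ 0 := by
  by_contra! hcon
  obtain ⟨v, hv, hvi⟩ := hsupp i
  have h1 : C ≤ LinearMap.ker (LinearMap.proj i : (Fin n → ZMod 2) →ₗ[ZMod 2] ZMod 2) := by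
    conv_lhs => rw [← hgen]
    refine Submodule.span_le.2 ?_
    rintro w ⟨g, hg, rfl⟩
    exact hcon g hg
  exact hvi (h1 hv)

/-- An automorphism maps pair words of `C` to pair words of `C`, so it permutes the classes. -/
lemma card_block_comp {g : Equiv.Perm (Fin n)} (hg : IsCodeAut C g) (i : Fin n) :
    (Finset.univ.filter fun k => (⟦k⟧ : Quotient (pairSetoid C)) = ⟦i⟧).card =
      (Finset.univ.filter fun k => (⟦k⟧ : Quotient (pairSetoid C)) = ⟦g i⟧).card := by
  have key : ∀ k, (⟦k⟧ : Quotient (pairSetoid C)) = ⟦i⟧ ↔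
      (⟦g k⟧ : Quotient (pairSetoid C)) = ⟦g i⟧ := fun k => by
    rw [Quotient.eq, Quotient.eq]
    show pairWord k i ∈ C ↔ pairWord (g k) (g i) ∈ C
    rw [← hg (pairWord (g k) (g i))]
    have : pairWord (g k) (g i) ∘ g = pairWord k i := by
      funext l
      simp [pairWord_apply]
    rw [this]
  refine Finset.card_bij (fun k _ => g k) ?_ (fun _ _ _ _ h => g.injective h) ?_
  · intro k hk
    exact Finset.mem_filter.2 ⟨Finset.mem_univ _, (key k).1 (Finset.mem_filter.1 hk).2⟩
  · intro k hk
    refine ⟨g.symm k, Finset.mem_filter.2 ⟨Finset.mem_univ _, (key _).2 ?_⟩, g.apply_symm_apply k⟩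
    rw [g.apply_symm_apply]
    exact (Finset.mem_filter.1 hk).2

/-- The blocks are the classes of related coordinates. Both points of `α` lie in one class and some
automorphism carries any given coordinate to one of them, so all classes have the same size. -/
lemma exists_isSumOfEvenWeightCodes (hC : IsProjective C) {α : Cstar C}
    (hgen : Submodule.span (ZMod 2) (conjugates C α.1) = C) (hsupp : ∀ i, ∃ v ∈ C, v i ≠ 0)
    (hw : hammingNorm α.1 = 2) : ∃ m, 3 ≤ m ∧ IsSumOfEvenWeightCodes C m := by
  obtain ⟨i, j, hij⟩ := exists_isPair hw
  have hpair : ∀ v ∈ conjugates C α.1, ∃ i j, v = pairWord i j := by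
    rintro v ⟨g, -, rfl⟩
    exact ⟨_, _, (hij.comp g).eq_pairWord⟩
  have hmem := mem_iff_blockSum_eq_zero hgen hpair
  have hr : (⟦j⟧ : Quotient (pairSetoid C)) = ⟦i⟧ := by
    refine (Quotient.sound ?_ : (⟦i⟧ : Quotient (pairSetoid C)) = ⟦j⟧).symm
    show pairWord i j ∈ C
    rw [← hij.eq_pairWord]
    exact α.2.1
  set m := (Finset.univ.filter fun k => (⟦k⟧ : Quotient (pairSetoid C)) = ⟦i⟧).card with hm
  have hcard : ∀ q : Quotient (pairSetoid C),
      (Finset.univ.filter fun k => (⟦k⟧ : Quotient (pairSetoid C)) = q).card = m := by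
    intro q
    obtain ⟨k, rfl⟩ := Quotient.exists_rep q
    obtain ⟨g, hg, hgk⟩ := exists_conjugate_apply_ne_zero hgen hsupp k
    rw [card_block_comp hg]
    rcases (hij.2 _).1 hgk with e | e
    · rw [e]
    · rw [e, hr]
  refine ⟨m, ?_, Fintype.card (Quotient (pairSetoid C)),
    fun k => Fintype.equivFin _ (⟦k⟧ : Quotient (pairSetoid C)), fun q => ?_, fun v => ?_⟩
  -- A class of size two would be `{i, j}`, and its zero sum would force `v i = v j` for all of `C`,
  -- against projectivity.
  · by_contra hlt
    have hsub : ({i, j} : Finset (Fin n)) ⊆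
        Finset.univ.filter fun k => (⟦k⟧ : Quotient (pairSetoid C)) = ⟦i⟧ := by
      intro k hk
      rcases Finset.mem_insert.1 hk with rfl | hk
      · simp
      · rw [Finset.mem_singleton.1 hk]; simpa using hr
    have heq := Finset.eq_of_subset_of_card_le hsub (by
      rw [Finset.card_pair hij.1, ← hm]; omega)
    obtain ⟨v, hv, hne⟩ := exists_ne_of_isProjective hC hij.1
    have h1 := (hmem v).1 hv ⟦i⟧
    rw [blockSum_apply, ← heq, Finset.sum_pair hij.1] at h1
    exact hne (CharTwo.add_eq_zero.1 h1)
  · rw [← hcard ((Fintype.equivFin _).symm q)]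
    congr 1
    ext k
    simp only [Finset.mem_filter, Finset.mem_univ, true_and]
    exact (Equiv.eq_symm_apply _).symm
  · rw [hmem v]
    refine (Fintype.equivFin (Quotient (pairSetoid C))).forall_congr fun {q} => ?_
    rw [blockSum_apply, sum_eq_card_filter, ZMod.natCast_eq_zero_iff_even, Finset.filter_filter]
    simp only [EmbeddingLike.apply_eq_iff_eq]

end pairs

section idem

variable {F : Type*} [Field F] {n : ℕ} {C : Submodule (ZMod 2) (Fin n → ZMod 2)}
  {P : Params F C} {a : F} {c : Cstar C → F}

open SmallIdem

/-! ## Words of weight one -/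

/-- The support of `α` consists of the point `i`. -/
lemma exists_eq_single {α : Fin n → ZMod 2} (hw : hammingNorm α = 1) :
    ∃ i, α = Pi.single i 1 := by
  obtain ⟨i, hi⟩ := Finset.card_eq_one.1 hw
  have hmem : ∀ k, α k ≠ 0 ↔ k = i := fun k => by
    have : k ∈ Finset.univ.filter (fun k => α k ≠ 0) ↔ k ∈ ({i} : Finset (Fin n)) := by rw [hi]
    simpa using this
  refine ⟨i, funext fun k => ?_⟩
  by_cases hk : k = i
  · subst hk; rw [Pi.single_eq_same, zmod_two_eq_one ((hmem k).2 rfl)]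
  · rw [Pi.single_eq_of_ne hk]
    by_contra h
    exact hk ((hmem k).1 h)

/-- Every coordinate is reached by a conjugate of a unit vector, so all unit vectors lie in `C`. -/
lemma eq_top_of_weight_one {α : Cstar C}
    (hgen : Submodule.span (ZMod 2) (conjugates C α.1) = C) (hsupp : ∀ i, ∃ v ∈ C, v i ≠ 0)
    (hw : hammingNorm α.1 = 1) : C = ⊤ := by
  obtain ⟨j, hj⟩ := exists_eq_single hw
  have hsingle : ∀ i, (Pi.single i 1 : Fin n → ZMod 2) ∈ C := by
    intro i
    obtain ⟨g, hg, hgi⟩ := exists_conjugate_apply_ne_zero hgen hsupp i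
    have hmem := (hg α.1).2 α.2.1
    have hgj : g i = j := by
      by_contra h
      rw [hj, Pi.single_eq_of_ne h] at hgi
      exact hgi rfl
    have : α.1 ∘ g = Pi.single i 1 := by
      rw [hj, ← hgj]
      funext k
      simp [Pi.single_apply]
    rwa [this] at hmem
  rw [eq_top_iff]
  intro v _
  rw [pi_eq_sum_univ' v]
  exact C.sum_mem fun i _ => C.smul_mem _ (hsingle i)

lemma card_eq_two_or_two_lt (α : Cstar C) : n = 2 ∨ 2 < n := by
  obtain ⟨i, hi⟩ := α.exists_ne_zero
  obtain ⟨j, hj⟩ := α.exists_eq_zero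
  have hij : i ≠ j := by rintro rfl; exact hi hj
  have := i.2
  have := j.2
  have : i.1 ≠ j.1 := fun e => hij (Fin.ext e)
  omega

lemma word_eq_of_single {i j : Fin n} (hij : i ≠ j) (h2 : n = 2) (v : Fin n → ZMod 2) :
    IsTrivialWord (Pi.single i 1) v := by
  have hk : ∀ k, k = i ∨ k = j := fun k => by
    have := i.2
    have := j.2
    have := k.2
    have : i.1 ≠ j.1 := fun e => hij (Fin.ext e)
    by_contra! h
    have h3 : k.1 ≠ i.1 := fun e => h.1 (Fin.ext e)
    have h4 : k.1 ≠ j.1 := fun e => h.2 (Fin.ext e)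
    omega
  have key : ∀ w : Fin n → ZMod 2, v = w ↔ v i = w i ∧ v j = w j := fun w => by
    refine ⟨fun h => by rw [h]; exact ⟨rfl, rfl⟩, fun h => funext fun k => ?_⟩
    rcases hk k with rfl | rfl
    · exact h.1
    · exact h.2
  unfold IsTrivialWord
  simp only [key, Pi.add_apply, Pi.one_apply, Pi.zero_apply, Pi.single_eq_same,
    Pi.single_eq_of_ne hij.symm]
  generalize v i = r, v j = s
  revert r s
  decide

lemma exists_inPartition_of_two_lt {α : Cstar C} (hw : hammingNorm α.1 = 1) (hC : C = ⊤)
    (hn : 2 < n) : ∃ β, InPartition α s(0, 1) β := by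
  obtain ⟨i, hi⟩ := exists_eq_single hw
  obtain ⟨j, hij⟩ : ∃ j, j ≠ i := by
    by_contra! h
    have : Fintype.card (Fin n) ≤ 1 := Fintype.card_le_one_iff.2 fun a b => by rw [h a, h b]
    rw [Fintype.card_fin] at this
    omega
  obtain ⟨k, hki, hkj⟩ : ∃ k, k ≠ i ∧ k ≠ j := by
    by_contra! h
    have h1 : (Finset.univ : Finset (Fin n)) ⊆ {i, j} := fun k _ => by
      by_cases hk : k = i
      · simp [hk]
      · simp [h k hk]
    have h2 := (Finset.card_le_card h1).trans Finset.card_le_two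
    rw [Finset.card_univ, Fintype.card_fin] at h2
    omega
  have e : ∀ v : Fin n → ZMod 2, (Pi.single j 1 : Fin n → ZMod 2) = v →
      v i = 0 ∧ v j = 1 ∧ v k = 0 := by
    rintro _ rfl
    simp [hij.symm, hkj]
  refine ⟨⟨Pi.single j 1, hC ▸ Submodule.mem_top, fun h => ?_, fun h => ?_⟩, fun h => ?_,
    fun h => ?_, ?_⟩
  · exact zero_ne_one (e _ h).2.1
  · exact one_ne_zero (e _ h).1
  · have := (e _ h).1; rw [hi] at this; simp at this
  · have := (e _ h).2.2; rw [hi] at this; simp [hki] at this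
  · have h1 : interCard α.1 (Pi.single j 1 : Fin n → ZMod 2) = 0 := by
      refine Finset.card_eq_zero.2 (Finset.filter_eq_empty_iff.2 fun l _ => ?_)
      rintro ⟨hl, hl'⟩
      rw [hi] at hl
      by_cases h1 : l = i
      · subst h1; exact hl' (by simp [hij.symm])
      · exact hl (by simp [h1])
    show weightPartition α.1 (Pi.single j 1 : Fin n → ZMod 2) = _
    rw [weightPartition_eq, h1, hw]

lemma weightPartition_of_weight_one {α : Fin n → ZMod 2} (hw : hammingNorm α = 1)
    (v : Fin n → ZMod 2) : weightPartition α v = s(0, 1) := by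
  rw [weightPartition_eq, hw, Sym2.eq_iff]
  have := interCard_le α v
  omega

lemma isEvenSplit_of_three {α : Fin n → ZMod 2} (hw : hammingNorm α = 1) (hn : n = 3) :
    IsEvenSplit C ∅ α := by
  subst hn
  obtain ⟨i, rfl⟩ := exists_eq_single hw
  -- The four trivial words are those that agree at the two coordinates other than `i`, which are `i
  -- + 1` and `i + 2` modulo three.
  have h : ∀ v, IsEvenWord ∅ (Pi.single i 1 : Fin 3 → ZMod 2) v ↔ v (i + 1) = v (i + 2) := by
    intro v
    unfold IsEvenWord IsTrivialWord
    simp only [Set.mem_empty_iff_false, or_false]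
    revert v
    revert i
    decide
  intro β _ γ _
  rw [h, h, h, Pi.add_apply, Pi.add_apply]
  generalize β (i + 1) = r, β (i + 2) = s, γ (i + 1) = t, γ (i + 2) = u
  revert r s t u
  decide

/-- All words have partition `(0,1)`, so an odd word forces the even words to be exactly the four
trivial ones. For `n ≥ 4`, the unit vectors at `j` and `k` and their sum are then all odd. -/
lemma eq_three_of_isEvenSplit {α : Cstar C} (hw : hammingNorm α.1 = 1) (hC : C = ⊤) (hn : 2 < n)
    {R : Set (Sym2 ℕ)} (hR : IsEvenSplit C R α.1) (hodd : ∃ v ∈ C, ¬IsEvenWord R α.1 v) :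
    n = 3 := by
  by_contra h3
  obtain ⟨i, hi⟩ := exists_eq_single hw
  have hmem : ∀ v, v ∈ C := fun v => hC ▸ Submodule.mem_top
  have hR0 : s(0, 1) ∉ R := fun h0 => by
    obtain ⟨v, -, hv⟩ := hodd
    exact hv (Or.inr (by rwa [weightPartition_of_weight_one hw]))
  have hev : ∀ v, IsEvenWord R α.1 v ↔ IsTrivialWord α.1 v := fun v => by
    unfold IsEvenWord
    rw [weightPartition_of_weight_one hw]
    exact or_iff_left hR0
  have hcard : 3 < (Finset.univ : Finset (Fin n)).card := by
    rw [Finset.card_univ, Fintype.card_fin]; omega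
  -- The third point `l` only serves as a zero coordinate, to tell the words used from `1 + α`.
  obtain ⟨T, hT⟩ : ∃ T : Finset (Fin n), T.card = 3 ∧ i ∉ T := by
    obtain ⟨T, hT, hT'⟩ := Finset.exists_subset_card_eq (s := Finset.univ.erase i) (n := 3)
      (by rw [Finset.card_erase_of_mem (Finset.mem_univ i)]; omega)
    exact ⟨T, hT', fun h => by simpa using hT h⟩
  obtain ⟨j, k, l, hjk, hjl, hkl, rfl⟩ := Finset.card_eq_three.1 hT.1
  have hT2 := hT.2
  simp only [Finset.mem_insert, Finset.mem_singleton, not_or] at hT2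
  obtain ⟨hij, hik, hil⟩ := hT2
  have hnt : ∀ v : Fin n → ZMod 2, v i = 0 → ∀ x y, x ≠ i → y ≠ i → v x = 0 → v y = 1 →
      ¬IsTrivialWord α.1 v := by
    intro v hvi x y hx hy hvx hvy ht
    rw [hi] at ht
    rcases ht with rfl | rfl | rfl | rfl
    · exact zero_ne_one hvy
    · exact one_ne_zero hvi
    · rw [Pi.single_eq_same] at hvi; exact one_ne_zero hvi
    · rw [Pi.add_apply, Pi.single_eq_of_ne hx] at hvx
      exact one_ne_zero hvx
  have h1 := hR (Pi.single j 1) (hmem _) (Pi.single k 1) (hmem _)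
  rw [hev, hev, hev] at h1
  have e1 := hnt (Pi.single j 1) (by simp [hij]) l j (Ne.symm hil) (Ne.symm hij)
    (by simp [hjl.symm]) (by simp)
  have e2 := hnt (Pi.single k 1) (by simp [hik]) l k (Ne.symm hil) (Ne.symm hik)
    (by simp [hkl.symm]) (by simp)
  have e3 := hnt (Pi.single j 1 + Pi.single k 1) (by simp [hij, hik]) l j (Ne.symm hil)
    (Ne.symm hij) (by simp [hjl.symm, hkl.symm]) (by simp [hjk])
  exact e3 (h1.2 (iff_of_false e1 e2))

lemma part_lam_eq_bot {x : SmallIdem P a c} (hw : hammingNorm x.word.1 = 1) :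
    x.part Label.lam = ⊥ := by
  by_contra h
  have := IsRegular.part_lam_ne_bot_iff.1 h
  omega

/-! ### Length two -/

/-- The signs of the labels for codes of length two. -/
def Label.halfSign : Label → ℤˣ
  | Label.lamHalf => -1
  | _ => 1

lemma part_nu_eq_bot {α : Cstar C} (hw : hammingNorm α.1 = 1) (hn : n = 2)
    {x : SmallIdem P a c} (hx : x.word.1 ∈ conjugates C α.1) (q : Sym2 ℕ) (ε : ℤˣ) :
    x.part (Label.nu q ε) = ⊥ := by
  by_contra h
  obtain ⟨β, hβ⟩ := (InPartition.exists_of_mem_conjugates hx).1 (IsRegular.part_nu_ne_bot_iff.1 h)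
  obtain ⟨i, hi⟩ := exists_eq_single hw
  obtain ⟨j, hj⟩ := α.exists_eq_zero
  have hij : i ≠ j := by rintro rfl; rw [hi, Pi.single_eq_same] at hj; exact one_ne_zero hj
  exact not_isTrivialWord hβ (hi ▸ word_eq_of_single hij hn β.1)

lemma sumPart_halfSign_one {x : SmallIdem P a c} (hlam : x.part Label.lam = ⊥)
    (hnu : ∀ q ε, x.part (Label.nu q ε) = ⊥) :
    x.sumPart {f | Label.halfSign f = 1} = x.part Label.one ⊔ x.part Label.zero := by
  refine le_antisymm (iSup₂_le ?_) (sup_le ?_ ?_)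
  · rintro (_ | _ | _ | _ | ⟨q, ε⟩) hf
    · exact le_sup_left
    · exact le_sup_right
    · rw [hlam]; exact bot_le
    · exact absurd (show (-1 : ℤˣ) = 1 from hf) (by decide)
    · rw [hnu]; exact bot_le
  · exact le_iSup₂_of_le Label.one rfl le_rfl
  · exact le_iSup₂_of_le Label.zero rfl le_rfl

lemma sumPart_halfSign_neg_one {x : SmallIdem P a c} :
    x.sumPart {f | Label.halfSign f = -1} = x.part Label.lamHalf := by
  refine le_antisymm (iSup₂_le ?_) ?_
  · rintro (_ | _ | _ | _ | ⟨q, ε⟩) hf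
    · exact absurd (show (1 : ℤˣ) = -1 from hf) (by decide)
    · exact absurd (show (1 : ℤˣ) = -1 from hf) (by decide)
    · exact absurd (show (1 : ℤˣ) = -1 from hf) (by decide)
    · exact le_rfl
    · exact absurd (show (1 : ℤˣ) = -1 from hf) (by decide)
  · exact le_iSup₂_of_le Label.lamHalf rfl le_rfl

namespace SmallIdem

namespace IsRegular

variable {x : SmallIdem P a c} (hx : x.IsRegular)

include hx

lemma mul_mem_part_zero {u v : Alg F C} (hu : u ∈ x.part Label.zero)
    (hv : v ∈ x.part Label.zero) : mul P u v ∈ x.part Label.zero := by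
  refine LinearMap.BilinMap.apply_apply_mem_of_mem_span _ _ _ (mul P) ?_ u v hu hv
  have key : ∀ i (γ : Cstar C), x.word.1 i = 0 → γ.1 = 1 + x.word.1 →
      mul P (tor F C i) (cw F γ) ∈ x.part Label.zero := fun i γ hi hγ => by
    rw [hx.tor_mul_cw]
    split_ifs
    · exact Submodule.smul_mem _ _ (compl_mem_zero hγ)
    · exact Submodule.zero_mem _
  rintro _ (⟨i, hi, rfl⟩ | ⟨γ, hγ, rfl⟩) _ (⟨j, hj, rfl⟩ | ⟨δ, hδ, rfl⟩)
  · rw [mul_tor_tor]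
    split_ifs
    · exact tor_mem_zero hi
    · exact Submodule.zero_mem _
  · exact key i δ hi hδ
  · rw [mul_comm']
    exact key j γ hj hγ
  · obtain rfl : γ = δ := Cstar.ext (hγ.trans hδ.symm)
    rw [hx.cw_mul_self]
    refine Submodule.smul_mem _ _ (Submodule.sum_mem _ fun i hi => tor_mem_zero ?_)
    have h1 := (Finset.mem_filter.1 hi).2
    rw [hγ] at h1
    by_contra h2
    exact h1 (by rw [Pi.add_apply, Pi.one_apply, zmod_two_eq_one h2]; rfl)

lemma elt_mul_part_zero {v : Alg F C} (hv : v ∈ x.part Label.zero) : mul P x.elt v = 0 := by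
  have := Module.End.mem_eigenspace_iff.1 (hx.part_le_eigenspace _ hv)
  rwa [eigenvalue, zero_smul] at this

lemma halfVec_mul_part_zero {v : Alg F C} (hv : v ∈ x.part Label.zero) :
    mul P x.halfVec v = 0 := by
  have hle : x.part Label.zero ≤ LinearMap.ker (mul P x.halfVec) := by
    refine Submodule.span_le.2 ?_
    rintro _ (⟨i, hi, rfl⟩ | ⟨γ, hγ, rfl⟩)
    · show mul P x.halfVec _ = 0
      rw [halfVec, map_sub, map_smul, LinearMap.sub_apply, LinearMap.smul_apply, torSum_mul_tor,
        mul_comm' P (cw F x.word), hx.tor_mul_cw, if_neg (not_not.2 hi), if_neg (not_not.2 hi),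
        smul_zero, sub_zero]
    · show mul P x.halfVec _ = 0
      have h1 : interCard x.word.1 γ.1 = 0 := by
        rw [hγ, interCard_one_add, word_add_self, interCard_zero]
      simp [halfVec, hx.torSum_mul_cw, mul_cw_compl P hγ, h1]
  exact hle hv

/-- Converse of `card_eq_of_halfVec_mem`: the condition means `λ = -1/2`, and then the coefficient
of `halfVec` in its square vanishes. -/
lemma halfVec_mul_self_mem (ha : a * (hammingNorm x.word.1 : F) = -1) :
    mul P x.halfVec x.halfVec ∈ x.part Label.one := by
  have h6 := hx.lam_mul
  have h7 := hx.mu_sq_mul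
  have h9 : 2 * CodeAlg.lam a x.word = -1 := by
    linear_combination -h6 + 2 * CodeAlg.lam a x.word * ha
  rw [IsSignGrading.halfVec_mul_self hx, hx.torSum_eq, hx.cw_word_eq]
  set A := c x.word * (4 * x.μ ^ 2 * c x.word + 1)
  set B := 4 * x.μ * c x.word * a * (hammingNorm x.word.1 : F)
  set D := CodeAlg.lam a x.word + 2 * x.μ ^ 2 * c x.word
  have h1 : A * x.μ + B * CodeAlg.lam a x.word = 0 := by
    linear_combination c x.word * x.μ * (4 * h7 + 4 * CodeAlg.lam a x.word * ha +
      (1 - 2 * CodeAlg.lam a x.word) * h9)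
  refine Submodule.mem_span_singleton.2 ⟨A * D⁻¹ - B * D⁻¹ * (2 * x.μ * c x.word), ?_⟩
  linear_combination (norm := module) (-D⁻¹ * h1) • x.halfVec

end IsRegular

end SmallIdem

lemma isGrading_halfSign {α : Cstar C} {X : Set (SmallIdem P a c)} (hX : ∀ x ∈ X, x.IsRegular)
    (hXS : ∀ x ∈ X, x.word.1 ∈ conjugates C α.1) (hw : hammingNorm α.1 = 1) (hn : n = 2)
    (ha : a = -1) :
    (idemLaw X).IsGrading fun s => (idemLaw X).carrier ∩ {f | Label.halfSign f = s} := by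
  refine isGrading_of_subspaces (mul P) (fun x : X => x.1.part) _ (fun x f _ => ⟨_, rfl⟩) ?_
    (fun x s => x.1.sumPart {f | Label.halfSign f = s}) ?_ (fun x s => le_rfl) ?_
  · intro s t hst
    rw [Set.disjoint_left]
    exact fun f (hs : _ = _) (ht : _ = _) => hst (hs.symm.trans ht)
  · intro x s f hf
    exact le_iSup₂ (f := fun f (_ : f ∈ {f | Label.halfSign f = s}) => x.1.part f) f hf
  · rintro ⟨x, hxX⟩ s t u hu v hv
    have hx := hX x hxX
    have hwx : hammingNorm x.word.1 = 1 := by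
      rwa [hammingNorm_of_mem_conjugates (hXS x hxX)]
    have h1 := sumPart_halfSign_one (part_lam_eq_bot hwx) (part_nu_eq_bot hw hn (hXS x hxX))
    have h2 := sumPart_halfSign_neg_one (x := x)
    have hodd : ∀ u ∈ x.part Label.one ⊔ x.part Label.zero, ∀ v ∈ x.part Label.lamHalf,
        mul P u v ∈ x.part Label.lamHalf := by
      intro u hu v hv
      obtain ⟨y, hy, z, hz, rfl⟩ := Submodule.mem_sup.1 hu
      obtain ⟨r, rfl⟩ := Submodule.mem_span_singleton.1 hy
      obtain ⟨q, rfl⟩ := Submodule.mem_span_singleton.1 hv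
      change mul P (r • x.elt + z) (q • x.halfVec) ∈ _
      rw [map_smul, map_add, LinearMap.add_apply, map_smul, LinearMap.smul_apply,
        hx.elt_mul_halfVec, mul_comm' P z, hx.halfVec_mul_part_zero hz, add_zero]
      exact Submodule.smul_mem _ _ (Submodule.smul_mem _ _ (Submodule.smul_mem _ _
        IsRegular.halfVec_mem))
    rcases Int.units_eq_one_or s with rfl | rfl <;> rcases Int.units_eq_one_or t with rfl | rfl
    · simp only [mul_one, h1] at hu hv ⊢
      obtain ⟨y, hy, z, hz, rfl⟩ := Submodule.mem_sup.1 hu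
      obtain ⟨y', hy', z', hz', rfl⟩ := Submodule.mem_sup.1 hv
      obtain ⟨r, rfl⟩ := Submodule.mem_span_singleton.1 hy
      obtain ⟨q, rfl⟩ := Submodule.mem_span_singleton.1 hy'
      simp only [map_add, map_smul, LinearMap.add_apply, LinearMap.smul_apply, hx.elt_mul_self,
        hx.elt_mul_part_zero hz', mul_comm' P z x.elt, hx.elt_mul_part_zero hz, smul_zero,
        add_zero, zero_add]
      exact Submodule.add_mem _ (Submodule.mem_sup_left (Submodule.smul_mem _ _
        (Submodule.smul_mem _ _ IsRegular.elt_mem)))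
        (Submodule.mem_sup_right (hx.mul_mem_part_zero hz hz'))
    · simp only [one_mul, h1, h2] at hu hv ⊢
      exact hodd u hu v hv
    · simp only [mul_one, h1, h2] at hu hv ⊢
      rw [mul_comm']
      exact hodd v hv u hu
    · simp only [neg_mul, one_mul, neg_neg, h1, h2] at hu hv ⊢
      obtain ⟨r, rfl⟩ := Submodule.mem_span_singleton.1 hu
      obtain ⟨q, rfl⟩ := Submodule.mem_span_singleton.1 hv
      change mul P (r • x.halfVec) (q • x.halfVec) ∈ _
      rw [map_smul, map_smul, LinearMap.smul_apply]
      refine Submodule.mem_sup_left (Submodule.smul_mem _ _ (Submodule.smul_mem _ _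
        (hx.halfVec_mul_self_mem ?_)))
      rw [hwx, ha, Nat.cast_one, mul_one]

/-- For `n = 2` there are no `ν`-parts and `A_λ` is zero, while `A_1` and `A_0` are even. So the
only possible odd label is `λ - 1/2`. -/
lemma halfSign_of_isZ2Grading {α : Cstar C} {X : Set (SmallIdem P a c)}
    (hX : ∀ x ∈ X, x.IsRegular) (hXS : ∀ x ∈ X, x.word.1 ∈ conjugates C α.1)
    (hw : hammingNorm α.1 = 1) (hn : n = 2) {p : ℤˣ → Set Label}
    (hp : (idemLaw X).IsZ2Grading p) {x : SmallIdem P a c} (hx : x ∈ X) :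
    a = -1 ∧ ∀ s, p s = (idemLaw X).carrier ∩ {f | Label.halfSign f = s} := by
  have hS := isSignGrading_of_isGrading hX hp.1 hx
  have hwx : hammingNorm x.word.1 = 1 := by rwa [hammingNorm_of_mem_conjugates (hXS x hx)]
  have hle : ∀ s f, f ∈ p s → x.part f ≤ x.sumPart (p s) := fun s f hf =>
    le_iSup₂ (f := fun f (_ : f ∈ p s) => x.part f) f hf
  have hc : ∀ s f, f ∈ p s → f ∈ (idemLaw X).carrier := fun s f hf =>
    hp.1.1 ▸ Set.mem_iUnion.2 ⟨s, hf⟩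
  have hneg : ∀ f ∈ p (-1), f = Label.lamHalf := by
    intro f hf
    obtain ⟨y, hy⟩ := hc _ f hf
    have hne := part_ne_bot_of_conjugate (hX x hx) (hXS x hx) (hXS y.1 y.2) hy
    have hle' := hle _ f hf
    rcases f with _ | _ | _ | _ | ⟨q, ε⟩
    · exact absurd (hS.sign_unique (hX x hx).elt_ne_zero (hS.elt_mem (hX x hx))
        (hle' IsRegular.elt_mem)) (by decide)
    · obtain ⟨v, hv, hv0⟩ := (Submodule.ne_bot_iff _).1 hne
      exact absurd (hS.sign_unique hv0 (hS.part_zero_le hv) (hle' hv)) (by decide)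
    · exact absurd (part_lam_eq_bot hwx) hne
    · rfl
    · exact absurd (part_nu_eq_bot hw hn (hXS x hx) q ε) hne
  have hhalf : Label.lamHalf ∈ p (-1) := by
    obtain ⟨f, hf⟩ := hp.2
    rwa [← hneg f hf]
  refine ⟨?_, fun s => ?_⟩
  · have := hS.card_eq_of_halfVec_mem (hX x hx) (hle _ _ hhalf IsRegular.halfVec_mem)
    rwa [hwx, Nat.cast_one, mul_one] at this
  · have hone : ∀ f ∈ p 1, Label.halfSign f = 1 := by
      rintro (_ | _ | _ | _ | ⟨q, ε⟩) hf
      · rfl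
      · rfl
      · rfl
      · exact absurd hhalf (Set.disjoint_left.1 (hp.1.2.1 1 (-1) (by decide)) hf)
      · rfl
    have key : ∀ s f, f ∈ p s → Label.halfSign f = s := fun s f hf => by
      rcases Int.units_eq_one_or s with rfl | rfl
      · exact hone f hf
      · rw [hneg f hf]; rfl
    ext f
    refine ⟨fun hf => ⟨hc s f hf, key s f hf⟩, ?_⟩
    rintro ⟨hf, rfl⟩
    rw [← hp.1.1] at hf
    obtain ⟨t, ht⟩ := Set.mem_iUnion.1 hf
    rwa [key t f ht]

/-! ### Length three -/

lemma sumPart_sign_of_weight_one {α : Cstar C} (hw : hammingNorm α.1 = 1)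
    {x : SmallIdem P a c} (hx : x.word.1 ∈ conjugates C α.1) {R : Set (Sym2 ℕ)}
    (hR : s(0, 1) ∉ R) :
    x.sumPart {f | Label.sign R f = 1} =
      x.part Label.one ⊔ x.part Label.zero ⊔ x.part Label.lamHalf ∧
    x.sumPart {f | Label.sign R f = -1} = ⨆ ε : ℤˣ, x.part (Label.nu s(0, 1) ε) := by
  have hwx : hammingNorm x.word.1 = 1 := by rwa [hammingNorm_of_mem_conjugates hx]
  have hq : ∀ q ε, q ≠ s(0, 1) → x.part (Label.nu q ε) = ⊥ := fun q ε hq => by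
    by_contra h
    obtain ⟨β, hβ⟩ := IsRegular.part_nu_ne_bot_iff.1 h
    exact hq (hβ.2.2.symm.trans (weightPartition_of_weight_one hwx _))
  constructor
  · rw [sumPart_sign_one, part_lam_eq_bot hwx, sup_bot_eq, sup_eq_left]
    exact iSup₂_le fun q hqR => iSup_le fun ε => by
      rw [hq q ε (fun e => hR (e ▸ hqR))]; exact bot_le
  · rw [sumPart_sign_neg_one]
    refine le_antisymm (iSup₂_le fun q _ => iSup_le fun ε => ?_)
      (le_iSup₂_of_le (s(0, 1)) hR le_rfl)
    by_cases h : q = s(0, 1)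
    · rw [h]; exact le_iSup_of_le ε le_rfl
    · rw [hq q ε h]; exact bot_le

/-- For `n > 2` a `ν`-part occurs, so `A_{λ-1/2}` is even and the grading comes from a parity on
`C`. -/
lemma sign_of_isZ2Grading_of_weight_one {α : Cstar C} {X : Set (SmallIdem P a c)}
    (hne : X.Nonempty) (hX : ∀ x ∈ X, x.IsRegular)
    (hXS : ∀ x ∈ X, x.word.1 ∈ conjugates C α.1) (hw : hammingNorm α.1 = 1) (hC : C = ⊤)
    (hn : 2 < n) {p : ℤˣ → Set Label} (hp : (idemLaw X).IsZ2Grading p) :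
    n = 3 ∧ ∃ R, s(0, 1) ∉ R ∧ ∀ s, p s = (idemLaw X).carrier ∩ {f | Label.sign R f = s} := by
  obtain ⟨x, hx⟩ := hne
  have hS := isSignGrading_of_isGrading hX hp.1 hx
  have hwx : hammingNorm x.word.1 = 1 := by rwa [hammingNorm_of_mem_conjugates (hXS x hx)]
  obtain ⟨β, hβ⟩ := exists_inPartition_of_two_lt hwx hC hn
  obtain ⟨R, hR, hpR⟩ := eq_sign_of_isGrading hX hXS hp.1 hx
    (by rw [part_lam_eq_bot hwx]; exact bot_le) (hS.halfVec_mem_one (hX x hx) hwx hβ)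
  have hodd := (nonempty_neg_iff ⟨x, hx⟩ hXS R).1 (hpR (-1) ▸ hp.2)
  refine ⟨eq_three_of_isEvenSplit hw hC hn hR hodd, R, fun h0 => ?_, hpR⟩
  obtain ⟨v, -, hv⟩ := hodd
  exact hv (Or.inr (by rwa [weightPartition_of_weight_one hw]))

lemma isZ2Graded_of_three {α : Cstar C} {X : Set (SmallIdem P a c)}
    (hne : X.Nonempty) (hX : ∀ x ∈ X, x.IsRegular)
    (hXS : ∀ x ∈ X, x.word.1 ∈ conjugates C α.1) (hw : hammingNorm α.1 = 1) (hC : C = ⊤)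
    (hn : n = 3) : (idemLaw X).IsZ2Graded := by
  refine ⟨_, isGrading_sign_of_isEvenSplit hX hXS (isEvenSplit_of_three hw hn),
    (nonempty_neg_iff hne hXS ∅).2 ?_⟩
  obtain ⟨β, hβ⟩ := exists_inPartition_of_two_lt hw hC (by omega)
  refine ⟨β.1, β.2.1, ?_⟩
  rintro (h | h)
  · exact not_isTrivialWord hβ h
  · exact h

end idem

section idem

variable {F : Type*} [Field F] {n : ℕ} {C : Submodule (ZMod 2) (Fin n → ZMod 2)}
  {P : Params F C} {a : F} {c : Cstar C → F}

open SmallIdem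

/-! ## The Klein four-group -/

/-- The transposition alters `v` only when `v i ≠ v j`, and then it flips both values, which is
addition of `α`. Hence it preserves any code containing `α`. -/
lemma IsPair.comp_swap {α : Fin n → ZMod 2} {i j : Fin n} (h : IsPair α i j)
    (v : Fin n → ZMod 2) : v ∘ Equiv.swap i j = if v i ≠ v j then α + v else v := by
  funext k
  have h1 : ∀ r s : ZMod 2, r ≠ s → s = 1 + r := by decide
  by_cases hki : k = i
  · subst hki
    by_cases hv : v k = v j
    · rw [if_neg (not_not.2 hv)]; simp [hv]
    · rw [if_pos hv]
      simp [h.apply_left, h1 _ _ hv]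
  · by_cases hkj : k = j
    · subst hkj
      by_cases hv : v i = v k
      · rw [if_neg (not_not.2 hv)]; simp [hv]
      · rw [if_pos hv]
        simp [h.apply_right, h1 _ _ (Ne.symm hv)]
    · have h0 : α k = 0 := by
        by_contra hk
        rcases (h.2 k).1 hk with e | e
        · exact hki e
        · exact hkj e
      rw [Function.comp_apply, Equiv.swap_apply_of_ne_of_ne hki hkj]
      split_ifs
      · rw [Pi.add_apply, h0, zero_add]
      · rfl

lemma IsPair.isCodeAut_swap {α : Fin n → ZMod 2} {i j : Fin n} (h : IsPair α i j) (hα : α ∈ C) :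
    IsCodeAut C (Equiv.swap i j) := by
  intro v
  rw [h.comp_swap]
  split_ifs
  · exact Submodule.add_mem_iff_right _ hα
  · exact Iff.rfl

/-- The action of an automorphism of the code on the nonconstant codewords. -/
def Cstar.perm {g : Equiv.Perm (Fin n)} (hg : IsCodeAut C g) (β : Cstar C) : Cstar C :=
  ⟨β.1 ∘ g, (hg β.1).2 β.2.1,
    fun h => β.2.2.1 (funext fun k => by simpa using congr_fun h (g.symm k)),
    fun h => β.2.2.2 (funext fun k => by simpa using congr_fun h (g.symm k))⟩

/-- The linear map induced by an automorphism of the code. -/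
def permMap (F : Type*) [Field F] {g : Equiv.Perm (Fin n)} (hg : IsCodeAut C g) :
    Alg F C →ₗ[F] Alg F C :=
  Finsupp.lmapDomain F F (Sum.map g.symm (Cstar.perm hg))

section permMap

variable {g : Equiv.Perm (Fin n)} (hg : IsCodeAut C g)

lemma permMap_tor (i : Fin n) : permMap F hg (tor F C i) = tor F C (g.symm i) := by
  simp [permMap, tor, Finsupp.mapDomain_single]

lemma permMap_cw (β : Cstar C) : permMap F hg (cw F β) = cw F (β.perm hg) := by
  simp [permMap, cw, Finsupp.mapDomain_single]

/-- Invariance of `b` is required only where the product is a multiple of a codeword element;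
squares are governed by `c`, and products with complements vanish on both sides. -/
lemma permMap_mul (ha : ∀ i (β : Cstar C), β.1 i ≠ 0 → P.a i β = a)
    (hc : ∀ i (β : Cstar C), β.1 i ≠ 0 → P.c i β = c β)
    (hb' : ∀ β γ : Cstar C, β.1 + γ.1 ≠ 0 → β.1 + γ.1 ≠ 1 →
      P.b (β.perm hg) (γ.perm hg) = P.b β γ)
    (hc' : ∀ β : Cstar C, c (β.perm hg) = c β) (u v : Alg F C) :
    permMap F hg (mul P u v) = mul P (permMap F hg u) (permMap F hg v) := by
  suffices (mul P).compr₂ (permMap F hg) = (mul P).compl₁₂ (permMap F hg) (permMap F hg) from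
    congrArg (fun f => f u v) this
  refine Finsupp.lhom_ext' fun i => LinearMap.ext_ring ?_
  refine Finsupp.lhom_ext' fun j => LinearMap.ext_ring ?_
  simp only [LinearMap.comp_apply, Finsupp.lsingle_apply, LinearMap.compr₂_apply,
    LinearMap.compl₁₂_apply]
  have key : ∀ i (β : Cstar C), permMap F hg (mul P (tor F C i) (cw F β)) =
      mul P (permMap F hg (tor F C i)) (permMap F hg (cw F β)) := fun i β => by
    rw [permMap_tor, permMap_cw, mul_tor_cw, mul_tor_cw]
    have h1 : (β.perm hg).1 (g.symm i) = β.1 i := congrArg β.1 (g.apply_symm_apply i)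
    by_cases h : β.1 i = 0
    · rw [if_neg (not_not.2 h), if_neg (by rw [h1]; exact not_not.2 h), map_zero]
    · rw [if_pos h, if_pos (by rwa [h1]), map_smul, permMap_cw, ha i β h,
        ha _ (β.perm hg) (by rwa [h1])]
  rcases i with i | β <;> rcases j with j | γ
  · show permMap F hg (mul P (tor F C i) (tor F C j)) =
      mul P (permMap F hg (tor F C i)) (permMap F hg (tor F C j))
    rw [permMap_tor, permMap_tor, mul_tor_tor, mul_tor_tor]
    simp only [EmbeddingLike.apply_eq_iff_eq]
    split_ifs
    · exact permMap_tor hg i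
    · exact map_zero _
  · exact key i γ
  · show permMap F hg (mul P (cw F β) (tor F C j)) =
      mul P (permMap F hg (cw F β)) (permMap F hg (tor F C j))
    rw [mul_comm', mul_comm' P (permMap F hg (cw F β))]
    exact key j β
  · show permMap F hg (mul P (cw F β) (cw F γ)) =
      mul P (permMap F hg (cw F β)) (permMap F hg (cw F γ))
    rw [permMap_cw, permMap_cw]
    by_cases h0 : β.1 + γ.1 = 0
    · obtain rfl : β = γ := Cstar.ext (word_add_eq_zero.1 h0)
      have hself : ∀ β : Cstar C, mul P (cw F β) (cw F β) =
          c β • ∑ i ∈ Finset.univ.filter (fun i => β.1 i ≠ 0), tor F C i := fun β => by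
        rw [mul_cw_self, Finset.smul_sum]
        exact Finset.sum_congr rfl fun i hi => by rw [hc i β (Finset.mem_filter.1 hi).2]
      rw [hself, hself, map_smul, hc', map_sum]
      simp only [permMap_tor]
      congr 1
      refine Finset.sum_bij (fun i _ => g.symm i) ?_ (fun _ _ _ _ h => g.symm.injective h) ?_
        fun _ _ => rfl
      · intro i hi
        refine Finset.mem_filter.2 ⟨Finset.mem_univ _, ?_⟩
        have h1 : (β.perm hg).1 (g.symm i) = β.1 i := congrArg β.1 (g.apply_symm_apply i)
        rw [h1]
        exact (Finset.mem_filter.1 hi).2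
      · intro i hi
        exact ⟨g i, Finset.mem_filter.2 ⟨Finset.mem_univ _, (Finset.mem_filter.1 hi).2⟩,
          g.symm_apply_apply i⟩
    by_cases h1 : β.1 + γ.1 = 1
    · have h2 : γ.1 = 1 + β.1 := word_add_eq_iff.1 (by rwa [add_comm])
      rw [mul_cw_compl P h2, map_zero, mul_cw_compl P]
      show γ.1 ∘ g = 1 + β.1 ∘ g
      rw [h2]
      rfl
    · let δ : Cstar C := ⟨β.1 + γ.1, C.add_mem β.2.1 γ.2.1, h0, h1⟩
      rw [mul_cw_cw P (δ := δ) rfl, mul_cw_cw P (δ := δ.perm hg) rfl, map_smul, permMap_cw,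
        hb' β γ h0 h1]

end permMap

/-- The extra conditions on the structure parameters for a word of weight two. -/
def SmallIdem.IsBalanced (x : SmallIdem P a c) : Prop :=
  ∀ β β' : Cstar C, InPartition x.word s(1, 1) β → β'.1 = x.word.1 + β.1 →
    c β = c β' ∧
    (∀ γ : Cstar C, γ.1 ≠ x.word.1 → γ.1 ≠ 1 + x.word.1 → γ.1 ≠ β.1 → γ.1 ≠ 1 + β.1 →
      γ.1 ≠ β'.1 → γ.1 ≠ 1 + β'.1 → P.b β γ = P.b β' γ) ∧
    (∀ δ δ' : Cstar C, δ.1 = 1 + β.1 → δ'.1 = 1 + β'.1 → P.b β δ' = P.b δ β')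

section klein

variable {x : SmallIdem P a c} {i j : Fin n}

lemma IsPair.inPartition {α β : Cstar C} (h : IsPair α.1 i j) (hβ : β.1 i ≠ β.1 j) :
    InPartition α s(1, 1) β := by
  refine ⟨fun e => hβ ?_, fun e => hβ ?_, (h.weightPartition_eq_iff_ne _).2 hβ⟩
  · rw [e, h.apply_left, h.apply_right]
  · rw [e, Pi.add_apply, Pi.add_apply, h.apply_left, h.apply_right]; rfl

lemma IsPair.perm_of_ne {α β : Cstar C} (h : IsPair α.1 i j)
    (hg : IsCodeAut C (Equiv.swap i j)) (hβ : β.1 i ≠ β.1 j) :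
    (β.perm hg).1 = α.1 + β.1 := (h.comp_swap β.1).trans (if_pos hβ)

lemma IsPair.perm_of_eq {α β : Cstar C} (h : IsPair α.1 i j)
    (hg : IsCodeAut C (Equiv.swap i j)) (hβ : β.1 i = β.1 j) : β.perm hg = β :=
  Cstar.ext ((h.comp_swap β.1).trans (if_neg (not_not.2 hβ)))

lemma IsPair.c_perm (h : IsPair x.word.1 i j) (hbal : x.IsBalanced)
    (hg : IsCodeAut C (Equiv.swap i j)) (β : Cstar C) : c (β.perm hg) = c β := by
  by_cases hβ : β.1 i = β.1 j
  · rw [h.perm_of_eq hg hβ]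
  · exact ((hbal β _ (h.inPartition hβ) (h.perm_of_ne hg hβ)).1).symm

/-- The transposition fixes `β` or replaces it by `α + β`. The extra conditions cover a change of
one argument away from the exceptional words; the exceptions are settled by regularity of `b` at `α`
and `1 + α`, by symmetry, or by the condition on complements. -/
lemma IsPair.b_perm (hx : x.IsRegular) (h : IsPair x.word.1 i j) (hbal : x.IsBalanced)
    (hg : IsCodeAut C (Equiv.swap i j)) (β γ : Cstar C) (h0 : β.1 + γ.1 ≠ 0)
    (h1 : β.1 + γ.1 ≠ 1) : P.b (β.perm hg) (γ.perm hg) = P.b β γ := by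
  have hne : ∀ β γ : Cstar C, β.1 + γ.1 ≠ 0 → γ.1 ≠ β.1 := fun β γ h e =>
    h (word_add_eq_zero.2 e.symm)
  have hne' : ∀ β γ : Cstar C, β.1 + γ.1 ≠ 1 → γ.1 ≠ 1 + β.1 := fun β γ h e =>
    h (by rw [e, add_comm, add_assoc, word_add_self, add_zero])
  -- Only `β` is moved. When `γ` is `α` or `1 + α`, the regularity of `b` replaces the extra
  -- conditions.
  have hmix : ∀ β γ : Cstar C, β.1 + γ.1 ≠ 0 → β.1 + γ.1 ≠ 1 → β.1 i ≠ β.1 j →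
      γ.1 i = γ.1 j → P.b (β.perm hg) γ = P.b β γ := by
    intro β γ h0 h1 hβ hγ
    have hp := h.inPartition hβ
    have hβ' := h.perm_of_ne hg hβ
    by_cases e1 : γ.1 = x.word.1
    · rw [Cstar.ext e1, P.b_symm, P.b_symm β]
      exact hx.b_translate hp.1 hp.2.1 hβ'
    by_cases e2 : γ.1 = 1 + x.word.1
    · rw [P.b_symm, P.b_symm β]
      exact hx.b_compl_eq _ _ _ γ e2 (hp.self_add hβ') hp
    refine ((hbal β _ hp hβ').2.1 γ e1 e2 (hne β γ h0) (hne' β γ h1) (fun e => ?_)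
      fun e => ?_).symm
    · rw [e] at hγ
      exact hβ (by simpa [Cstar.perm] using hγ.symm)
    · rw [e] at hγ
      exact hβ (by simpa [Cstar.perm] using hγ.symm)
  by_cases hβ : β.1 i = β.1 j
  · rw [h.perm_of_eq hg hβ]
    by_cases hγ : γ.1 i = γ.1 j
    · rw [h.perm_of_eq hg hγ]
    · rw [P.b_symm, P.b_symm β]
      exact hmix γ β (by rwa [add_comm]) (by rwa [add_comm]) hγ hβ
  · by_cases hγ : γ.1 i = γ.1 j
    · rw [h.perm_of_eq hg hγ]
      exact hmix β γ h0 h1 hβ hγ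
    · have hpβ := h.inPartition hβ
      have hpγ := h.inPartition hγ
      have hβ' := h.perm_of_ne hg hβ
      have hγ' := h.perm_of_ne hg hγ
      set β' := β.perm hg
      set γ' := γ.perm hg
      have hβ'' : β.1 = x.word.1 + β'.1 := by rw [hβ', word_add_cancel]
      -- Both arguments are moved. If `γ` is `α + β` they are merely exchanged; if it is the
      -- complement of `α + β`, the condition on complements applies; otherwise one argument is
      -- moved at a time.
      by_cases e1 : γ.1 = β'.1
      · have e2 : γ'.1 = β.1 := by rw [hγ', hβ'', e1]
        rw [Cstar.ext e2, Cstar.ext e1, P.b_symm]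
      by_cases e2 : γ.1 = 1 + β'.1
      · have e3 : γ'.1 = 1 + β.1 := by rw [hγ', e2, hβ'']; exact add_left_comm _ _ _
        rw [P.b_symm, (hbal β β' hpβ hβ').2.2 γ' γ e3 e2]
      have hcancel : ∀ u v : Fin n → ZMod 2, x.word.1 + u = 1 + (x.word.1 + v) → u = 1 + v :=
        fun u v e => add_left_cancel (e.trans (add_left_comm _ _ _))
      have hpβ' := hpβ.self_add hβ'
      have step1 : P.b β γ = P.b β' γ := (hbal β β' hpβ hβ').2.1 γ hpγ.1 hpγ.2.1 (hne β γ h0)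
        (hne' β γ h1) e1 e2
      have step2 : P.b γ β' = P.b γ' β' := by
        refine (hbal γ γ' hpγ hγ').2.1 β' hpβ'.1 hpβ'.2.1 (fun e => e1 e.symm) (fun e => e2 ?_)
          (fun e => ?_) (fun e => ?_)
        · rw [e, word_add_cancel]
        · rw [hβ', hγ'] at e
          exact hne β γ h0 (add_left_cancel e).symm
        · rw [hβ', hγ'] at e
          refine hne' β γ h1 ?_
          rw [hcancel _ _ e, word_add_cancel]
      rw [step1, P.b_symm, ← step2, P.b_symm]

/-- The labels of the grading by the Klein four-group. -/
def Label.kleinSign : Label → ℤˣ × ℤˣ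
  | Label.lam => (-1, -1)
  | Label.nu p ε => if p = s(1, 1) then (-ε, ε) else 1
  | _ => 1

lemma Label.kleinSign_nu (ε : ℤˣ) : (Label.nu s(1, 1) ε).kleinSign = (-ε, ε) := by
  simp [Label.kleinSign]

lemma Label.kleinSign_nu_of_ne {p : Sym2 ℕ} (hp : p ≠ s(1, 1)) (ε : ℤˣ) :
    (Label.nu p ε).kleinSign = 1 := by
  simp [Label.kleinSign, hp]

lemma Label.sign_eq_kleinSign (f : Label) :
    Label.sign {s(1, 1)}ᶜ f = f.kleinSign.1 * f.kleinSign.2 := by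
  rcases f with _ | _ | _ | _ | ⟨p, ε⟩
  · rfl
  · rfl
  · rfl
  · rfl
  · by_cases h : p = s(1, 1)
    · simp [Label.sign, Label.kleinSign, h]
    · simp [Label.sign, Label.kleinSign, h]

/-- The eigenvalue of the involution on the part of the grading with the given sign. -/
def SmallIdem.swapSign (x : SmallIdem P a c) (t : ℤˣ × ℤˣ) : ℤˣ :=
  if x.θ 1 1 = 1 then t.2 else t.1

lemma swapSign_mul (s t : ℤˣ × ℤˣ) : x.swapSign (s * t) = x.swapSign s * x.swapSign t := by
  unfold swapSign
  split_ifs <;> rfl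

lemma swapSign_one : x.swapSign 1 = 1 := by
  unfold swapSign
  split_ifs <;> rfl

lemma swapSign_neg : x.swapSign (-1, -1) = -1 := by
  unfold swapSign
  split_ifs <;> rfl

/-- Here `β` and `α + β` both meet `α` in one point, so the swap rule becomes `θ_{-ε} = -θ_ε`;
together with the product `-1` this gives `θ = ±1`. Which label belongs to `1` is a choice of the
labelling, hence the case distinction in `swapSign`. -/
lemma IsPair.theta_sq (h : IsPair x.word.1 i j) {β : Cstar C} (hβ : β.1 i ≠ β.1 j) (ε : ℤˣ) :
    x.θ 1 ε * x.θ 1 ε = 1 ∧ x.θ 1 (-ε) = -x.θ 1 ε := by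
  have hp := h.inPartition hβ
  have h1 := (h.interCard_eq_one_iff β.1).2 hβ
  have h2 : interCard x.word.1 (x.word.1 + β.1) = 1 := by
    rw [interCard_self_add, h1, h.hammingNorm_eq]
  have h3 := x.theta_swap β hp.1 hp.2.1 ε
  have h4 := IsRegular.theta_mul' (x := x) hp.1 hp.2.1 ε
  rw [h1, h2] at h3
  rw [h1] at h4
  have h5 : x.θ 1 (-ε) = -x.θ 1 ε := by rw [h3, neg_neg]
  refine ⟨?_, h5⟩
  rw [h5] at h4
  linear_combination -h4

lemma IsPair.swapSign_nu (h : IsPair x.word.1 i j) {β : Cstar C} (hβ : β.1 i ≠ β.1 j)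
    (ε : ℤˣ) : ((x.swapSign (-ε, ε) : ℤ) : F) = x.θ 1 ε := by
  obtain ⟨h1, h2⟩ := h.theta_sq hβ 1
  have h3 : x.θ 1 1 = 1 ∨ x.θ 1 1 = -1 := mul_self_eq_one_iff.1 h1
  unfold swapSign
  split_ifs with h4
  · rcases Int.units_eq_one_or ε with rfl | rfl
    · simp [h4]
    · simp [h2, h4]
  · have h5 := h3.resolve_left h4
    rcases Int.units_eq_one_or ε with rfl | rfl
    · simp [h5]
    · simp [h2, h5]

/-- The homogeneous components of the grading by the Klein four-group. -/
def SmallIdem.kleinPart (x : SmallIdem P a c) (hg : IsCodeAut C (Equiv.swap i j))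
    (t : ℤˣ × ℤˣ) : Submodule F (Alg F C) :=
  signPart F C {s(1, 1)}ᶜ x.word.1 (t.1 * t.2) ⊓
    Module.End.eigenspace (permMap F hg) ((x.swapSign t : ℤ) : F)

lemma mem_kleinPart {hg : IsCodeAut C (Equiv.swap i j)} {t : ℤˣ × ℤˣ} {v : Alg F C} :
    v ∈ x.kleinPart hg t ↔ v ∈ signPart F C {s(1, 1)}ᶜ x.word.1 (t.1 * t.2) ∧
      permMap F hg v = ((x.swapSign t : ℤ) : F) • v := by
  rw [kleinPart, Submodule.mem_inf, Module.End.mem_eigenspace_iff]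

variable (h : IsPair x.word.1 i j) (hg : IsCodeAut C (Equiv.swap i j))

include h

lemma IsPair.permMap_cw_word : permMap F hg (cw F x.word) = cw F x.word := by
  rw [permMap_cw, h.perm_of_eq hg (by rw [h.apply_left, h.apply_right])]

lemma IsPair.torSum_eq : x.torSum = tor F C i + tor F C j := by
  have : Finset.univ.filter (fun k => x.word.1 k ≠ 0) = {i, j} := by
    ext k; simp [h.2 k]
  rw [torSum, this, Finset.sum_pair h.1]

lemma IsPair.permMap_torSum : permMap F hg x.torSum = x.torSum := by
  rw [h.torSum_eq, map_add, permMap_tor, permMap_tor]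
  simp [add_comm]

/-- The involution fixes `e`, `halfVec`, `A_0` and the `(0,2)`-parts, negates `t_i - t_j`, and
exchanges `e^β` and `e^{α+β}` for the partition `(1,1)`, so that it acts on `ν_ε` by the scalar `θ_ε
= ±1`. -/
lemma IsPair.part_le_kleinPart (f : Label) : x.part f ≤ x.kleinPart hg f.kleinSign := by
  refine le_inf ?_ ?_
  · rw [← Label.sign_eq_kleinSign]
    exact part_le_signPart _ f
  have hw := h.permMap_cw_word (F := F) hg
  have ht := h.permMap_torSum hg
  have hfix : ∀ v, permMap F hg v = v →
      v ∈ Module.End.eigenspace (permMap F hg) ((x.swapSign 1 : ℤ) : F) := fun v hv => by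
    rw [Module.End.mem_eigenspace_iff, swapSign_one, hv]; simp
  rcases f with _ | _ | _ | _ | ⟨p, ε⟩
  · refine (Submodule.span_singleton_le_iff_mem _ _).2 (hfix _ ?_)
    rw [elt, map_add, map_smul, map_smul, hw, ht]
  · refine Submodule.span_le.2 ?_
    rintro _ (⟨k, hk, rfl⟩ | ⟨γ, hγ, rfl⟩)
    · refine hfix _ ?_
      rw [permMap_tor, Equiv.symm_swap, Equiv.swap_apply_of_ne_of_ne]
      · rintro rfl; exact (h.2 k).2 (Or.inl rfl) hk
      · rintro rfl; exact (h.2 k).2 (Or.inr rfl) hk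
    · refine hfix _ ?_
      rw [permMap_cw, h.perm_of_eq hg]
      rw [hγ, Pi.add_apply, Pi.add_apply, h.apply_left, h.apply_right]; rfl
  · refine Submodule.span_le.2 ?_
    rintro _ ⟨k, l, hk, hl, rfl⟩
    refine Module.End.mem_eigenspace_iff.2 ?_
    rw [map_sub, permMap_tor, permMap_tor, Equiv.symm_swap, Label.kleinSign, swapSign_neg]
    rcases (h.2 k).1 hk with rfl | rfl <;> rcases (h.2 l).1 hl with rfl | rfl <;> simp
  · refine (Submodule.span_singleton_le_iff_mem _ _).2 (hfix _ ?_)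
    rw [map_sub, map_smul, hw, ht]
  · refine Submodule.span_le.2 ?_
    rintro _ ⟨β, γ, hβ, hγ, rfl⟩
    by_cases hp : p = s(1, 1)
    · subst hp
      have hne := (h.weightPartition_eq_iff_ne β.1).1 hβ.2.2
      have hne' := (h.weightPartition_eq_iff_ne γ.1).1 (hβ.self_add hγ).2.2
      have e1 : β.perm hg = γ := Cstar.ext ((h.perm_of_ne hg hne).trans hγ.symm)
      have e2 : γ.perm hg = β :=
        Cstar.ext ((h.perm_of_ne hg hne').trans (by rw [hγ, word_add_cancel]))
      refine Module.End.mem_eigenspace_iff.2 ?_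
      rw [Label.kleinSign, if_pos rfl, h.swapSign_nu hne, (h.interCard_eq_one_iff β.1).2 hne,
        map_add, map_smul, permMap_cw, permMap_cw, e1, e2]
      linear_combination (norm := module) (-(h.theta_sq hne ε).1) • cw F β
    · rw [Label.kleinSign, if_neg hp]
      have heq : ∀ δ, InPartition x.word p δ → δ.1 i = δ.1 j := fun δ hδ => by
        by_contra hne
        exact hp (hδ.2.2.symm.trans ((h.weightPartition_eq_iff_ne δ.1).2 hne))
      refine hfix _ ?_
      rw [map_add, map_smul, permMap_cw, permMap_cw, h.perm_of_eq hg (heq β hβ),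
        h.perm_of_eq hg (heq γ (hβ.self_add hγ))]

/-- Symmetrise with respect to the involution `τ`: for an eigenvector `v` with eigenvalue `σ = ±1`,
`v + στv = 2v`. As `2` is invertible, it is enough to symmetrise basis elements. -/
lemma IsPair.kleinPart_le (hx : x.IsRegular) (t : ℤˣ × ℤˣ) :
    x.kleinPart hg t ≤ ⨆ f ∈ {f | Label.kleinSign f = t}, x.part f := by
  have hle : ∀ f, Label.kleinSign f = t → x.part f ≤ ⨆ f ∈ {f | Label.kleinSign f = t}, x.part f :=
    fun f hf => le_iSup₂ (f := fun f (_ : f ∈ {f | Label.kleinSign f = t}) => x.part f) f hf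
  set S := ⨆ f ∈ {f | Label.kleinSign f = t}, x.part f
  have key : signPart F C {s(1, 1)}ᶜ x.word.1 (t.1 * t.2) ≤
      S.comap (LinearMap.id + ((x.swapSign t : ℤ) : F) • permMap F hg) := by
    refine Submodule.span_le.2 ?_
    rintro _ ⟨k | β, hk, rfl⟩
    · show tor F C k + ((x.swapSign t : ℤ) : F) • permMap F hg (tor F C k) ∈ S
      -- Toral elements have parity one, so the two components of `t` agree.
      have ht : t = 1 ∨ t = (-1, -1) := by
        revert hk
        show (1 : ℤˣ) = t.1 * t.2 → _
        generalize t = s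
        revert s
        decide
      rw [permMap_tor, Equiv.symm_swap]
      rcases ht with rfl | rfl
      · rw [swapSign_one]
        by_cases hk0 : x.word.1 k = 0
        · rw [Equiv.swap_apply_of_ne_of_ne]
          · exact S.add_mem (hle _ rfl (IsRegular.tor_mem_zero hk0))
              (S.smul_mem _ (hle _ rfl (IsRegular.tor_mem_zero hk0)))
          · rintro rfl; exact (h.2 k).2 (Or.inl rfl) hk0
          · rintro rfl; exact (h.2 k).2 (Or.inr rfl) hk0
        · have h1 := hx.torSum_mem (hle _ rfl IsRegular.elt_mem) (hle _ rfl IsRegular.halfVec_mem)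
          rw [h.torSum_eq] at h1
          rcases (h.2 k).1 hk0 with rfl | rfl
          · simpa using h1
          · rw [add_comm] at h1; simpa using h1
      · rw [swapSign_neg]
        by_cases hk0 : x.word.1 k = 0
        · rw [Equiv.swap_apply_of_ne_of_ne]
          · simp
          · rintro rfl; exact (h.2 k).2 (Or.inl rfl) hk0
          · rintro rfl; exact (h.2 k).2 (Or.inr rfl) hk0
        · have h1 := hle Label.lam rfl (IsRegular.tor_sub_tor_mem hk0
            (k := Equiv.swap i j k) ((h.2 _).2 (by
              rcases (h.2 k).1 hk0 with rfl | rfl <;> simp)))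
          simpa [sub_eq_add_neg] using h1
    · show cw F β + ((x.swapSign t : ℤ) : F) • permMap F hg (cw F β) ∈ S
      rw [permMap_cw]
      by_cases hβ : β.1 i = β.1 j
      · have hev : basisSign {s(1, 1)}ᶜ x.word.1 (Sum.inr β) = 1 :=
          if_pos ((h.isEvenWord_iff β.1).2 hβ)
        rw [hev] at hk
        have ht : t = 1 ∨ t = (-1, -1) := by
          revert hk
          generalize t = s
          revert s
          decide
        rw [h.perm_of_eq hg hβ]
        rcases ht with rfl | rfl
        · have h1 : cw F β ∈ S := by
            by_cases e1 : β.1 = x.word.1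
            · rw [Cstar.ext e1]
              exact hx.cw_word_mem (hle _ rfl IsRegular.elt_mem) (hle _ rfl IsRegular.halfVec_mem)
            by_cases e2 : β.1 = 1 + x.word.1
            · exact hle _ rfl (IsRegular.compl_mem_zero e2)
            refine IsRegular.cw_mem_of_part_le ⟨e1, e2, rfl⟩ fun ε => hle _ (if_neg fun e => ?_)
            exact (h.weightPartition_eq_iff_ne β.1).1 e hβ
          exact S.add_mem h1 (S.smul_mem _ h1)
        -- A fixed `e^β` has no antisymmetric component.
        · rw [swapSign_neg]; simp
      · have hodd : basisSign {s(1, 1)}ᶜ x.word.1 (Sum.inr β) = -1 :=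
          if_neg fun e => hβ ((h.isEvenWord_iff β.1).1 e)
        rw [hodd] at hk
        obtain ⟨ε, rfl⟩ : ∃ ε, t = (-ε, ε) := by
          revert hk
          generalize t = s
          revert s
          decide
        rw [h.swapSign_nu hβ]
        have h1 := hle (Label.nu s(1, 1) ε) (Label.kleinSign_nu ε)
          (IsRegular.nuVec_mem (h.inPartition hβ) (h.perm_of_ne hg hβ) ε)
        -- As `θ² = 1`, this turns `θ e^β + e^{α+β}` into the symmetrised vector `e^β + θ e^{α+β}`.
        have h2 := S.smul_mem (x.θ 1 ε) h1
        rwa [nuVec, (h.interCard_eq_one_iff β.1).2 hβ, smul_add, smul_smul,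
          (h.theta_sq hβ ε).1, one_smul] at h2
  intro v hv
  obtain ⟨hv1, hv2⟩ := mem_kleinPart.1 hv
  have h1 := key hv1
  change v + ((x.swapSign t : ℤ) : F) • permMap F hg v ∈ S at h1
  rw [hv2, smul_smul] at h1
  have h2 : ((x.swapSign t : ℤ) : F) * ((x.swapSign t : ℤ) : F) = 1 := by
    rw [← Int.cast_mul, ← Units.val_mul, Int.units_mul_self]; simp
  rw [h2, one_smul, ← two_smul F, Submodule.smul_mem_iff _ hx.two_ne_zero] at h1
  exact h1

/-- Parity is multiplicative because `v i + v j` is additive, and the eigenvalue of the involution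
is multiplicative because the involution is an algebra homomorphism. -/
lemma IsPair.mul_mem_kleinPart (hx : x.IsRegular) (hbal : x.IsBalanced) (s t : ℤˣ × ℤˣ)
    {u v : Alg F C} (hu : u ∈ x.kleinPart hg s) (hv : v ∈ x.kleinPart hg t) :
    mul P u v ∈ x.kleinPart hg (s * t) := by
  rw [mem_kleinPart] at *
  constructor
  · have := mul_mem_signPart (P := P) h.isEvenSplit _ _ hu.1 hv.1
    rwa [mul_mul_mul_comm] at this
  · rw [permMap_mul hg hx.a_eq hx.c_eq (h.b_perm hx hbal hg) (h.c_perm hbal hg), hu.2, hv.2,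
      map_smul, map_smul, LinearMap.smul_apply, smul_smul, swapSign_mul]
    push_cast
    rw [mul_comm]

end klein

lemma isGrading_kleinSign {X : Set (SmallIdem P a c)} (hX : ∀ x ∈ X, x.IsRegular)
    (hw : ∀ x ∈ X, hammingNorm x.word.1 = 2) (hbal : ∀ x ∈ X, x.IsBalanced) :
    (idemLaw X).IsGrading fun t => (idemLaw X).carrier ∩ {f | Label.kleinSign f = t} := by
  choose i j hij using fun x : X => exists_isPair (hw x.1 x.2)
  have hg : ∀ x : X, IsCodeAut C (Equiv.swap (i x) (j x)) := fun x =>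
    (hij x).isCodeAut_swap x.1.word.2.1
  refine isGrading_of_subspaces (mul P) (fun x : X => x.1.part) _ (fun x f _ => ⟨_, rfl⟩) ?_
    (fun x t => x.1.kleinPart (hg x) t) ?_ ?_ ?_
  · intro s t hst
    rw [Set.disjoint_left]
    exact fun f (hs : _ = _) (ht : _ = _) => hst (hs.symm.trans ht)
  · rintro x t f (rfl : _ = _)
    exact (hij x).part_le_kleinPart (hg x) f
  · exact fun x t => (hij x).kleinPart_le (hg x) (hX x.1 x.2) t
  · exact fun x s t u hu v hv =>
      (hij x).mul_mem_kleinPart (hg x) (hX x.1 x.2) (hbal x.1 x.2) s t hu hv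

lemma sumPart_kleinSign {α : Cstar C} (hw : hammingNorm α.1 = 2) {x : SmallIdem P a c}
    (hx : x.word.1 ∈ conjugates C α.1) :
    x.sumPart {f | Label.kleinSign f = (1, 1)} = x.part Label.one ⊔ x.part Label.zero ⊔
        x.part Label.lamHalf ⊔ ⨆ ε : ℤˣ, x.part (Label.nu s(0, 2) ε) ∧
      x.sumPart {f | Label.kleinSign f = (-1, 1)} = x.part (Label.nu s(1, 1) 1) ∧
      x.sumPart {f | Label.kleinSign f = (1, -1)} = x.part (Label.nu s(1, 1) (-1)) ∧
      x.sumPart {f | Label.kleinSign f = (-1, -1)} = x.part Label.lam := by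
  have hodd : ∀ ε : ℤˣ, x.sumPart {f | Label.kleinSign f = (-ε, ε)} =
      x.part (Label.nu s(1, 1) ε) := fun ε => by
    refine le_antisymm (iSup₂_le ?_) (le_iSup₂_of_le (Label.nu s(1, 1) ε)
      (Label.kleinSign_nu ε) le_rfl)
    have h1 : (1 : ℤˣ × ℤˣ) ≠ (-ε, ε) := by revert ε; decide
    have h2 : ((-1, -1) : ℤˣ × ℤˣ) ≠ (-ε, ε) := by revert ε; decide
    rintro (_ | _ | _ | _ | ⟨p, δ⟩) hf
    · exact absurd hf h1
    · exact absurd hf h1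
    · exact absurd hf h2
    · exact absurd hf h1
    · change (if p = s(1, 1) then (-δ, δ) else 1) = (-ε, ε) at hf
      split_ifs at hf with hp
      · have e : δ = ε := (Prod.ext_iff.1 hf).2
        rw [hp, e]
      · exact absurd hf h1
  have hodd' : x.sumPart {f | Label.kleinSign f = (1, -1)} = x.part (Label.nu s(1, 1) (-1)) := by
    have h := hodd (-1)
    rwa [neg_neg] at h
  refine ⟨?_, hodd 1, hodd', ?_⟩
  · refine le_antisymm (iSup₂_le ?_) (sup_le (sup_le (sup_le ?_ ?_) ?_) (iSup_le fun ε => ?_))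
    · rintro (_ | _ | _ | _ | ⟨p, δ⟩) hf
      · exact le_sup_of_le_left (le_sup_of_le_left le_sup_left)
      · exact le_sup_of_le_left (le_sup_of_le_left le_sup_right)
      · exact absurd (show ((-1, -1) : ℤˣ × ℤˣ) = (1, 1) from hf) (by decide)
      · exact le_sup_of_le_left le_sup_right
      · have hp : p ≠ s(1, 1) := fun hp => by
          change (if p = s(1, 1) then (-δ, δ) else 1) = ((1, 1) : ℤˣ × ℤˣ) at hf
          rw [if_pos hp] at hf
          revert hf
          revert δ
          decide
        by_cases hbot : x.part (Label.nu p δ) = ⊥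
        · rw [hbot]; exact bot_le
        · rw [(eq_of_part_nu_ne_bot hw hx hbot).resolve_right hp]
          exact le_sup_of_le_right (le_iSup (fun ε => x.part (Label.nu s(0, 2) ε)) δ)
    · exact le_iSup₂_of_le Label.one rfl le_rfl
    · exact le_iSup₂_of_le Label.zero rfl le_rfl
    · exact le_iSup₂_of_le Label.lamHalf rfl le_rfl
    · exact le_iSup₂_of_le (Label.nu s(0, 2) ε)
        (Label.kleinSign_nu_of_ne (by simp) ε) le_rfl
  · refine le_antisymm (iSup₂_le ?_) ?_
    · rintro (_ | _ | _ | _ | ⟨p, δ⟩) hf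
      · exact absurd (show (1 : ℤˣ × ℤˣ) = (-1, -1) from hf) (by decide)
      · exact absurd (show (1 : ℤˣ × ℤˣ) = (-1, -1) from hf) (by decide)
      · exact le_rfl
      · exact absurd (show (1 : ℤˣ × ℤˣ) = (-1, -1) from hf) (by decide)
      · change (if p = s(1, 1) then (-δ, δ) else 1) = ((-1, -1) : ℤˣ × ℤˣ) at hf
        split_ifs at hf
        · exact absurd hf (by revert δ; decide)
        · exact absurd hf (by decide)
    · exact le_iSup₂_of_le Label.lam rfl le_rfl

lemma exists_kleinGrading (hC : IsProjective C) {α : Cstar C} {X : Set (SmallIdem P a c)}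
    (hne : X.Nonempty) (hX : ∀ x ∈ X, x.IsRegular)
    (hXS : ∀ x ∈ X, x.word.1 ∈ conjugates C α.1) (hw : hammingNorm α.1 = 2)
    (hbal : ∀ x ∈ X, x.IsBalanced) :
    ∃ p : ℤˣ × ℤˣ → Set Label, (idemLaw X).IsGrading p ∧ (∀ t, (p t).Nonempty) ∧ ∀ x ∈ X,
      x.sumPart (p (1, 1)) = x.part Label.one ⊔ x.part Label.zero ⊔ x.part Label.lamHalf ⊔
        ⨆ ε : ℤˣ, x.part (Label.nu s(0, 2) ε) ∧
      x.sumPart (p (-1, 1)) = x.part (Label.nu s(1, 1) 1) ∧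
      x.sumPart (p (1, -1)) = x.part (Label.nu s(1, 1) (-1)) ∧
      x.sumPart (p (-1, -1)) = x.part Label.lam := by
  have hwx : ∀ x ∈ X, hammingNorm x.word.1 = 2 := fun x hx => by
    rwa [hammingNorm_of_mem_conjugates (hXS x hx)]
  refine ⟨_, isGrading_kleinSign hX hwx hbal, fun t => ?_, fun x hx => ?_⟩
  · obtain ⟨x, hx⟩ := hne
    have hnu : ∀ ε, x.part (Label.nu s(1, 1) ε) ≠ ⊥ := fun ε => by
      obtain ⟨i, j, hij⟩ := exists_isPair (hwx x hx)
      obtain ⟨v, hv, hvne⟩ := exists_ne_of_isProjective hC hij.1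
      refine IsRegular.part_nu_ne_bot_iff.2 ⟨⟨v, hv, ?_, ?_⟩, hij.inPartition hvne⟩
      · rintro rfl; exact hvne rfl
      · rintro rfl; exact hvne rfl
    have ht : t = 1 ∨ t = (-1, -1) ∨ ∃ ε, t = (-ε, ε) := by
      revert t
      decide
    rcases ht with rfl | rfl | ⟨ε, rfl⟩
    · exact ⟨Label.one, ⟨⟨x, hx⟩, (hX x hx).part_one_ne_bot⟩, rfl⟩
    · exact ⟨Label.lam, ⟨⟨x, hx⟩, IsRegular.part_lam_ne_bot_iff.2 (hwx x hx).ge⟩, rfl⟩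
    · exact ⟨Label.nu s(1, 1) ε, ⟨⟨x, hx⟩, hnu ε⟩, Label.kleinSign_nu ε⟩
  · simp only [idemLaw_carrier_inter X hx]
    exact sumPart_kleinSign hw (hXS x hx)

end idem

section idem

variable {F : Type*} [Field F] {n : ℕ} {C : Submodule (ZMod 2) (Fin n → ZMod 2)}
  {P : Params F C} {a : F} {c : Cstar C → F} {α : Cstar C} {X : Set (SmallIdem P a c)}

open SmallIdem

/-! ## The classification -/

lemma isZ2Graded_iff_caseOne (hne : X.Nonempty) (hX : ∀ x ∈ X, x.IsRegular)
    (hXS : ∀ x ∈ X, x.word.1 ∈ conjugates C α.1) (hw : hammingNorm α.1 = 1) (hC : C = ⊤) :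
    (idemLaw X).IsZ2Graded ↔ CaseOne C α.1 a := by
  constructor
  · rintro ⟨p, hp⟩
    rcases card_eq_two_or_two_lt α with hn | hn
    · obtain ⟨x, hx⟩ := hne
      exact ⟨hw, hC, Or.inl ⟨hn, (halfSign_of_isZ2Grading hX hXS hw hn hp hx).1⟩⟩
    · exact ⟨hw, hC, Or.inr (sign_of_isZ2Grading_of_weight_one hne hX hXS hw hC hn hp).1⟩
  · rintro ⟨-, -, ⟨hn, ha⟩ | hn⟩
    · obtain ⟨x, hx⟩ := hne
      exact ⟨_, isGrading_halfSign hX hXS hw hn ha,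
        Label.lamHalf, ⟨⟨x, hx⟩, IsRegular.part_lamHalf_ne_bot⟩, rfl⟩
    · exact isZ2Graded_of_three hne hX hXS hw hC hn

lemma isZ2Graded_iff (hC : IsProjective C)
    (hgen : Submodule.span (ZMod 2) (conjugates C α.1) = C) (hsupp : ∀ i, ∃ v ∈ C, v i ≠ 0)
    (hne : X.Nonempty) (hX : ∀ x ∈ X, x.IsRegular)
    (hXS : ∀ x ∈ X, x.word.1 ∈ conjugates C α.1) :
    (idemLaw X).IsZ2Graded ↔ CaseOne C α.1 a ∨ CaseTwo C α.1 ∨ CaseThree C α.1 := by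
  have h0 : 0 < hammingNorm α.1 := hammingNorm_pos_iff.2 α.2.2.1
  obtain hw | hw | hw : hammingNorm α.1 = 1 ∨ hammingNorm α.1 = 2 ∨ 2 < hammingNorm α.1 := by
    omega
  · rw [isZ2Graded_iff_caseOne hne hX hXS hw (eq_top_of_weight_one hgen hsupp hw)]
    refine ⟨Or.inl, ?_⟩
    rintro (h | h | h)
    · exact h
    · have := h.1; omega
    · have := h.1; omega
  · obtain ⟨p, hp, -⟩ := exists_isZ2Grading_of_weight_two hC hne hX hXS hw
    exact iff_of_true ⟨p, hp⟩ (Or.inr (Or.inl ⟨hw, exists_isSumOfEvenWeightCodes hC hgen hsupp hw⟩))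
  · constructor
    · rintro ⟨p, hp⟩
      obtain ⟨E, hE, -⟩ := exists_isPlusSubcode_of_isZ2Grading hC hne hX hXS hw hp
      exact Or.inr (Or.inr ⟨hw, isProjective_proj hC α.2.1, ⟨α.1, α.2.1, restrict_self α.1⟩, E, hE⟩)
    · rintro (h | h | ⟨-, -, -, E, hE⟩)
      · have := h.1; omega
      · have := h.1; omega
      · obtain ⟨p, hp, -⟩ := exists_isZ2Grading_of_isPlusSubcode hne hX hXS hE
        exact ⟨p, hp⟩

/-- Only the law of the single idempotent `x` is compared here; since the classification does not
depend on `X`, it also applies to the set `{x}`. -/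
lemma idemLaw_isZ2Graded_iff_eigenLaw {x : SmallIdem P a c} (hx : x.IsRegular)
    (hinj : Set.InjOn x.eigenvalue (idemLaw {x}).carrier) :
    (idemLaw {x}).IsZ2Graded ↔ (eigenLaw P x.elt).IsZ2Graded :=
  isZ2Graded_iff_eigenspaces (mul P) (fun y : ({x} : Set (SmallIdem P a c)) => y.1.part) x.part
    (fun y => congrArg SmallIdem.part y.2) hx.iSupIndep_part hx.iSup_part (mul P x.elt)
    x.eigenvalue hx.part_le_eigenspace fun _ hf _ hg =>
      hinj ⟨⟨x, rfl⟩, hf⟩ ⟨⟨x, rfl⟩, hg⟩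

lemma sumPart_of_weight_one (hX : ∀ x ∈ X, x.IsRegular)
    (hXS : ∀ x ∈ X, x.word.1 ∈ conjugates C α.1) (hw : hammingNorm α.1 = 1) (hC : C = ⊤)
    {p : ℤˣ → Set Label} (hp : (idemLaw X).IsZ2Grading p) {x : SmallIdem P a c} (hx : x ∈ X) :
    (n = 2 → x.sumPart (p 1) = x.part Label.one ⊔ x.part Label.zero ∧
      x.sumPart (p (-1)) = x.part Label.lamHalf) ∧
    (n = 3 → x.sumPart (p 1) = x.part Label.one ⊔ x.part Label.zero ⊔ x.part Label.lamHalf ∧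
      x.sumPart (p (-1)) = ⨆ ε : ℤˣ, x.part (Label.nu s(0, 1) ε)) := by
  have hwx : hammingNorm x.word.1 = 1 := by rwa [hammingNorm_of_mem_conjugates (hXS x hx)]
  constructor
  · intro hn
    simp only [(halfSign_of_isZ2Grading hX hXS hw hn hp hx).2, idemLaw_carrier_inter X hx]
    exact ⟨sumPart_halfSign_one (part_lam_eq_bot hwx) (part_nu_eq_bot hw hn (hXS x hx)),
      sumPart_halfSign_neg_one⟩
  · intro hn
    obtain ⟨-, R, hR, hpR⟩ :=
      sign_of_isZ2Grading_of_weight_one ⟨x, hx⟩ hX hXS hw hC (by omega) hp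
    simp only [hpR, idemLaw_carrier_inter X hx]
    exact sumPart_sign_of_weight_one hw (hXS x hx) hR

end idem

end CodeAlg

end

open CodeAlg in
theorem mainTheorem1 {F : Type*} [Field F] {n : ℕ}
    (C : Submodule (ZMod 2) (Fin n → ZMod 2)) (hC : IsProjective C)
    (α : Cstar C) (hgen : Submodule.span (ZMod 2) (conjugates C α.1) = C)
    (h2 : (2 : F) ≠ 0) (hchar : (hammingNorm α.1 : F) ≠ 0)
    (P : Params F C) (hP : IsNondegenerate P)
    (a : F) (c : Cstar C → F) (hreg : ParamsRegular P α a c)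
    (ha2 : a ≠ 1 / (2 * (hammingNorm α.1 : F))) (ha3 : 3 * (hammingNorm α.1 : F) * a ≠ 1)
    (X : Set (SmallIdem P a c)) (hX : X.Nonempty)
    (hXS : ∀ x ∈ X, x.word.1 ∈ conjugates C α.1) :
    -- the labelled parts form a decomposition into eigenspaces of an idempotent
    (∀ x ∈ X, mul P x.elt x.elt = x.elt ∧ iSupIndep x.part ∧ (⨆ f, x.part f) = ⊤ ∧
      ∀ f, x.part f ≤ Module.End.eigenspace (mul P x.elt) (x.eigenvalue f)) ∧
    -- the classification
    ((idemLaw X).IsZ2Graded ↔ CaseOne C α.1 a ∨ CaseTwo C α.1 ∨ CaseThree C α.1) ∧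
    -- the same for the law on the spectrum, when different labels have different eigenvalues
    (∀ x ∈ X, Set.InjOn x.eigenvalue (idemLaw {x}).carrier →
      ((eigenLaw P x.elt).IsZ2Graded ↔ CaseOne C α.1 a ∨ CaseTwo C α.1 ∨ CaseThree C α.1)) ∧
    -- weight one: the grading
    (∀ p, (idemLaw X).IsZ2Grading p → hammingNorm α.1 = 1 → ∀ x ∈ X,
      (n = 2 → x.sumPart (p 1) = x.part Label.one ⊔ x.part Label.zero ∧
        x.sumPart (p (-1)) = x.part Label.lamHalf) ∧
      (n = 3 → x.sumPart (p 1) = x.part Label.one ⊔ x.part Label.zero ⊔ x.part Label.lamHalf ∧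
        x.sumPart (p (-1)) = ⨆ ε : ℤˣ, x.part (Label.nu s(0, 1) ε))) ∧
    -- weight two: a grading by the group of order two
    (hammingNorm α.1 = 2 → ∃ p, (idemLaw X).IsZ2Grading p ∧ ∀ x ∈ X,
      x.sumPart (p 1) = x.part Label.one ⊔ x.part Label.zero ⊔ x.part Label.lam ⊔
        x.part Label.lamHalf ⊔ ⨆ ε : ℤˣ, x.part (Label.nu s(0, 2) ε) ∧
      x.sumPart (p (-1)) = ⨆ ε : ℤˣ, x.part (Label.nu s(1, 1) ε)) ∧
    -- weight two: a grading by the Klein four-group, under extra conditions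
    (hammingNorm α.1 = 2 →
      (∀ x ∈ X, ∀ β β' : Cstar C, InPartition x.word s(1, 1) β → β'.1 = x.word.1 + β.1 →
        c β = c β' ∧
        (∀ γ : Cstar C, γ.1 ≠ x.word.1 → γ.1 ≠ 1 + x.word.1 → γ.1 ≠ β.1 → γ.1 ≠ 1 + β.1 →
          γ.1 ≠ β'.1 → γ.1 ≠ 1 + β'.1 → P.b β γ = P.b β' γ) ∧
        (∀ δ δ' : Cstar C, δ.1 = 1 + β.1 → δ'.1 = 1 + β'.1 → P.b β δ' = P.b δ β')) →
      ∃ p : ℤˣ × ℤˣ → Set Label, (idemLaw X).IsGrading p ∧ (∀ t, (p t).Nonempty) ∧ ∀ x ∈ X,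
        x.sumPart (p (1, 1)) = x.part Label.one ⊔ x.part Label.zero ⊔ x.part Label.lamHalf ⊔
          ⨆ ε : ℤˣ, x.part (Label.nu s(0, 2) ε) ∧
        x.sumPart (p (-1, 1)) = x.part (Label.nu s(1, 1) 1) ∧
        x.sumPart (p (1, -1)) = x.part (Label.nu s(1, 1) (-1)) ∧
        x.sumPart (p (-1, -1)) = x.part Label.lam) ∧
    -- weight greater than two: every subcode as in case three gives a grading
    (2 < hammingNorm α.1 → ∀ E, IsPlusSubcode (proj C α.1) E →
      ∃ p, (idemLaw X).IsZ2Grading p ∧ ∀ x ∈ X,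
        x.sumPart (p 1) = x.part Label.one ⊔ x.part Label.zero ⊔ x.part Label.lam ⊔
          x.part Label.lamHalf ⊔
          ⨆ m ∈ weights E, ⨆ ε : ℤˣ, x.part (Label.nu s(m, hammingNorm α.1 - m) ε) ∧
        x.sumPart (p (-1)) = ⨆ m ∈ weights (proj C α.1) \ weights E, ⨆ ε : ℤˣ,
          x.part (Label.nu s(m, hammingNorm α.1 - m) ε)) ∧
    -- weight greater than two: and every grading arises in this way
    (2 < hammingNorm α.1 → ∀ p, (idemLaw X).IsZ2Grading p →
      ∃ E, IsPlusSubcode (proj C α.1) E ∧ ∀ x ∈ X,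
        x.sumPart (p 1) = x.part Label.one ⊔ x.part Label.zero ⊔ x.part Label.lam ⊔
          x.part Label.lamHalf ⊔
          ⨆ m ∈ weights E, ⨆ ε : ℤˣ, x.part (Label.nu s(m, hammingNorm α.1 - m) ε) ∧
        x.sumPart (p (-1)) = ⨆ m ∈ weights (proj C α.1) \ weights E, ⨆ ε : ℤˣ,
          x.part (Label.nu s(m, hammingNorm α.1 - m) ε)) := by
  have hreg' : ∀ x ∈ X, x.IsRegular := fun x hx =>
    SmallIdem.isRegular_of_mem_conjugates h2 hchar hP hreg ha2 ha3 x (hXS x hx)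
  refine ⟨fun x hx => ⟨(hreg' x hx).elt_mul_self, (hreg' x hx).iSupIndep_part,
      (hreg' x hx).iSup_part, (hreg' x hx).part_le_eigenspace⟩,
    isZ2Graded_iff hC hgen hP.1 hX hreg' hXS, fun x hx hinj => ?_,
    fun p hp hw x hx =>
      sumPart_of_weight_one hreg' hXS hw (eq_top_of_weight_one hgen hP.1 hw) hp hx,
    exists_isZ2Grading_of_weight_two hC hX hreg' hXS,
    exists_kleinGrading hC hX hreg' hXS,
    fun _ E hE => exists_isZ2Grading_of_isPlusSubcode hX hreg' hXS hE,
    fun hw p hp => exists_isPlusSubcode_of_isZ2Grading hC hX hreg' hXS hw hp⟩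
  rw [← idemLaw_isZ2Graded_iff_eigenLaw (hreg' x hx) hinj]
  refine isZ2Graded_iff hC hgen hP.1 (Set.singleton_nonempty x) ?_ ?_
  · rintro _ rfl
    exact hreg' _ hx
  · rintro _ rfl
    exact hXS _ hx
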